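/- **Setting.** Let $\Omega\subset\mathbb R^n$ be a bounded open set partitioned into finitely many components $\Omega_{d,i}$, $0\le d\le n$, $1\le i\le n_d$, where $\Omega_{d,i}$ is (the interior of) a smooth embedded $d$-dimensional manifold with boundary (corners allowed), and $\partial\Omega_{d,i}=\overline{\Omega_{d,i}}\setminus\Omega_{d,i}$ is contained in $\bigcup_{l<d}\bigcup_j\Omega_{l,j}\cup\partial\Omega$. Let $\nu_{d,i}$ be the exterior unit normal on $\partial\Omega_{d,i}$, tangential to $\Omega_{d,i}$. Components carry the $d$-dimensional and their boundaries the $(d-1)$-dimensional surface measure; $(\cdot,\cdot)_{\mathcal O}$ is the sum of the $L^2(\Omega_{d,i})$ scalar products, and $(\cdot,\cdot)_{\partial\mathcal O_I}$, $(\cdot,\cdot)_{\partial\mathcal O_B}$ are the sums of the $L^2$ scalar products over $\partial\Omega_{d,i}\setminus\partial\Omega$ and $\partial\Omega_{d,i}\cap\partial\Omega$. Let $\beta=(\beta_{d,i})$ be a tangential vector field, smooth up to the boundary of each component, let $\alpha_{d,i}\in L^\infty(\Omega_{d,i})$, and let $\tau_1>0$, $\tau_2\ge0$. Put $[v]_{d,i}=v_{d,i}|_{\partial\Omega_{d,i}}-v_{d-1,j}$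 on $\partial\Omega_{d,i}\cap\Omega_{d-1,j}$, let $[\![f_{d+1}]\!]_d$ be the function on $\Omega_{d,i}$ given by the sum over $j$ of $f_{d+1,j}$ on $\partial\Omega_{d+1,j}\cap\Omega_{d,i}$ (and $[\![\cdot]\!]_n=0$), and $$(D_\beta v)_d=\beta_d\cdot\nabla_dv_d-[\![\nu_{d+1}\cdot\beta_{d+1}[v]_{d+1}]\!]_d,\qquad(\operatorname{Div}\beta)_d=\nabla_d\cdot\beta_d-[\![\nu_{d+1}\cdot\beta_{d+1}]\!]_d,$$ $\gamma=\alpha+\operatorname{Div}\beta$, $Lv=D_\beta v+\gamma v$, where $\nabla_d$ is the tangential gradient. Let $V_\beta$ be the space of $v\in L^2(\mathcal O)$ that have $\beta\cdot\nabla v\in L^2(\mathcal O)$ and boundary traces in $L^2(\partial\Omega_{d,i};|\nu\cdot\beta|)$ (as limits of smooth functions on each component). Let $\{\mathcal T_{h,0}\}_{h\in(0,h_0]}$ be quasi-uniform conforming meshes, of shape regular elements (simplices or parallelepipeds), of a polygonal domain $\Omega_0\supset\Omega$, let $V_{h,0}$ be the space of continuous piecewise linear (respectively tensor product linear) functions,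 $\mathcal T_{h,d,i}$ the set of the elements that meet $\Omega_{d,i}$, and $V_h=\bigoplus_{d,i}V_{h,0}|_{\mathcal T_{h,d,i}}$. Let $E$ be continuous linear extension operators $L^2(\Omega_{d,i})\to L^2(U_\delta(\Omega_{d,i}))$, $H^1(\Omega_{d,i})\to H^1(U_\delta(\Omega_{d,i}))$, with $U_\delta(\Omega_{d,i})$ the $\delta$-neighbourhood in $\mathbb R^n$, assumed to contain the elements of $\mathcal T_{h,d,i}$; let $V^e$ be the set of $Ev$, $v\in V_\beta$, with all components in $H^1(U_\delta(\Omega_{d,i}))$, and $W=V^e+V_h$. With $|x|_-=|\min(x,0)|$ and $s_h(v,w)=\sum_{d,i}\tau_2h^{3-(n-d)}(\nabla_{\mathbb R^n}v_{d,i},\nabla_{\mathbb R^n}w_{d,i})_{\mathcal T_{h,d,i}}$, let $$a_h(v,w)=(Lv,w)_{\mathcal O}+\tau_1h(Lv,Lw)_{\mathcal O}+s_h(v,w)+(|\nu\cdot\beta|_-[v],[w])_{\partial\mathcal O_I}+(|\nu\cdot\beta|_-v,w)_{\partial\mathcal O_B},$$ $$|||v|||_h^2=\|v\|_{\mathcal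 O}^2+h\|Lv\|_{\mathcal O}^2+s_h(v,v)+(|\nu\cdot\beta|[v],[v])_{\partial\mathcal O_I}+(|\nu\cdot\beta|v,v)_{\partial\mathcal O_B},\qquad|||v|||_{h,*}^2=h^{-1}\|v\|_{\mathcal O}^2+|||v|||_h^2.$$ **Lemma (continuity and coercivity of $a_h$).** (i) There is a constant $C>0$ such that $$|a_h(v,w)|\le C\,|||v|||_{h,*}\,|||w|||_h\qquad\text{for all }v,w\in W.$$ (ii) If there is a constant $c_0>0$ with $c_0\le2\alpha+\operatorname{Div}\beta$ almost everywhere on every component, then there is a constant $C>0$ such that $$|||v|||_h^2\le C\,a_h(v,v)\qquad\text{for all }v\in W.$$ The constants depend on the fractured domain and on $\alpha,\beta,\tau_1,\tau_2$ (and on $c_0$ in (ii)), but not on $h$, on the meshes, on $E$, or on $v,w$. -/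

import Mathlib

open Set Filter MeasureTheory
open scoped Topology ContDiff ENNReal RealInnerProductSpace

noncomputable section

/-- Euclidean space `ℝⁿ`. -/
abbrev Euc (n : ℕ) : Type := EuclideanSpace ℝ (Fin n)

variable {n : ℕ}

/-! ### Embedded manifolds with boundary and corners -/

/-- `S ⊆ ℝⁿ` is the interior of a smooth embedded `d`-dimensional manifold with boundary (corners
are allowed): around every point of the closure of `S` there is a smooth diffeomorphism between
open subsets of `ℝⁿ` that carries `S` to the open corner `(0, ∞)ᵏ × ℝᵈ⁻ᵏ × {0}` for some `k ≤ d`. -/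
def IsSubmanifoldWithCorners (d : ℕ) (S : Set (Euc n)) : Prop :=
  ∀ p ∈ closure S, ∃ Φ : OpenPartialHomeomorph (Euc n) (Euc n), ∃ k ≤ d,
    p ∈ Φ.source ∧ ContDiffOn ℝ ∞ Φ Φ.source ∧ ContDiffOn ℝ ∞ Φ.symm Φ.target ∧
    S ∩ Φ.source = {x ∈ Φ.source |
      (∀ j : Fin n, (j : ℕ) < k → 0 < Φ x j) ∧ ∀ j : Fin n, d ≤ (j : ℕ) → Φ x j = 0}

/-- The boundary `∂S = closure S \ S` of the manifold `S`. -/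
def bdry (S : Set (Euc n)) : Set (Euc n) := closure S \ S

/-- The `d`-dimensional surface measure on `S`. -/
def surf (d : ℕ) (S : Set (Euc n)) : Measure (Euc n) := (μHE[d]).restrict S

/-- The natural `(d-1)`-dimensional measure on the boundary of a `d`-dimensional manifold `S`
(for `d = 0` the boundary is empty). -/
def surfBdry (d : ℕ) (S : Set (Euc n)) : Measure (Euc n) := surf (d - 1) (bdry S)

/-- The tangent space `T_x S`; at boundary points it is the full `d`-dimensional space. -/
def tangentSpaceAt (S : Set (Euc n)) (x : Euc n) : Submodule ℝ (Euc n) :=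
  Submodule.span ℝ (tangentConeAt ℝ S x)

/-- The orthogonal projection `P` of `ℝⁿ` onto `T_x S`. -/
def tangentProj (S : Set (Euc n)) (x : Euc n) : Euc n →L[ℝ] Euc n :=
  (tangentSpaceAt S x).starProjection

/-- The tangential gradient `P ∇φ` of a differentiable function `φ` on `ℝⁿ`. -/
def tangentialGradient (S : Set (Euc n)) (φ : Euc n → ℝ) (x : Euc n) : Euc n :=
  tangentProj S x (gradient φ x)

/-- The tangential divergence `tr (P ∘ Db)` of a vector field `b`. -/
def tangentialDiv (S : Set (Euc n)) (b : Euc n → Euc n) (x : Euc n) : ℝ :=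
  LinearMap.trace ℝ (Euc n) (tangentProj S x ∘L fderiv ℝ b x).toLinearMap

/-- `ν` is the exterior unit normal to `S` at the boundary point `x`: a unit vector, tangential
to `S`, orthogonal to the boundary `∂S`, and pointing out of `S`. -/
def IsExteriorNormal (S : Set (Euc n)) (x ν : Euc n) : Prop :=
  ‖ν‖ = 1 ∧ ν ∈ tangentSpaceAt S x ∧
    (∀ y ∈ tangentConeAt ℝ (bdry S) x, ⟪ν, y⟫ = 0) ∧
    ∀ y ∈ posTangentConeAt S x, ⟪ν, y⟫ ≤ 0

open Classical in
/-- The exterior unit normal field of `S` (zero at the corners, where there is none). -/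
def exteriorNormal (S : Set (Euc n)) (x : Euc n) : Euc n :=
  if h : ∃ ν, IsExteriorNormal S x ν then h.choose else 0

/-! ### Function spaces on one component -/

/-- `v ∈ L²(S)` has the (weak) directional derivative `g = b · ∇_S v ∈ L²(S)` and the boundary
trace `t ∈ L²(∂S; |ν · b|)`: the triple `(v, g, t)` is the limit, in these three spaces, of
`(φ, b · ∇_S φ, φ|_∂S)` for smooth functions `φ`. -/
def HasDirDerivTrace (d : ℕ) (S : Set (Euc n)) (b : Euc n → Euc n) (v g t : Euc n → ℝ) : Prop :=
  MemLp v 2 (surf d S) ∧ MemLp g 2 (surf d S) ∧ AEStronglyMeasurable t (surfBdry d S) ∧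
  ∃ φ : ℕ → Euc n → ℝ, (∀ k, ContDiff ℝ ∞ (φ k)) ∧
    Tendsto (fun k => eLpNorm (fun x => φ k x - v x) 2 (surf d S)) atTop (𝓝 0) ∧
    Tendsto (fun k => eLpNorm (fun x => ⟪b x, tangentialGradient S (φ k) x⟫ - g x) 2 (surf d S))
      atTop (𝓝 0) ∧
    Tendsto (fun k => eLpNorm
      (fun x => √|⟪exteriorNormal S x, b x⟫| * (φ k x - t x)) 2 (surfBdry d S)) atTop (𝓝 0)

open Classical in
/-- The pair `(b · ∇_S v, v|_∂S)` (zero if it does not exist). -/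
def dirDerivTrace (d : ℕ) (S : Set (Euc n)) (b : Euc n → Euc n) (v : Euc n → ℝ) :
    (Euc n → ℝ) × (Euc n → ℝ) :=
  if h : ∃ p : (Euc n → ℝ) × (Euc n → ℝ), HasDirDerivTrace d S b v p.1 p.2 then h.choose else 0

/-- `v ∈ H¹(S)` with tangential gradient `g`: `(v, g)` is the limit in `L²(S)` of
`(φ, ∇_S φ)` for smooth functions `φ`. -/
def HasTangentialGradient (d : ℕ) (S : Set (Euc n)) (v : Euc n → ℝ) (g : Euc n → Euc n) : Prop :=
  MemLp v 2 (surf d S) ∧ MemLp g 2 (surf d S) ∧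
  ∃ φ : ℕ → Euc n → ℝ, (∀ k, ContDiff ℝ ∞ (φ k)) ∧
    Tendsto (fun k => eLpNorm (fun x => φ k x - v x) 2 (surf d S)) atTop (𝓝 0) ∧
    Tendsto (fun k => eLpNorm (fun x => tangentialGradient S (φ k) x - g x) 2 (surf d S))
      atTop (𝓝 0)

/-- `f ∈ H¹(U)` for an open set `U ⊆ ℝⁿ`, with weak gradient `g`. -/
def HasWeakGradient (U : Set (Euc n)) (f : Euc n → ℝ) (g : Euc n → Euc n) : Prop :=
  MemLp f 2 (volume.restrict U) ∧ MemLp g 2 (volume.restrict U) ∧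
  ∀ φ : Euc n → ℝ, ContDiff ℝ ∞ φ → HasCompactSupport φ → tsupport φ ⊆ U →
    ∫ x in U, f x • gradient φ x = -∫ x in U, φ x • g x

open Classical in
/-- The weak gradient of `f` in the open set `U` (zero if `f ∉ H¹(U)`). -/
def weakGradient (U : Set (Euc n)) (f : Euc n → ℝ) : Euc n → Euc n :=
  if h : ∃ g, HasWeakGradient U f g then h.choose else 0

/-- `Ext` is a continuous linear extension operator from the `d`-dimensional manifold `S` to its
`δ`-neighbourhood, `L²(S) → L²(U_δ(S))` and `H¹(S) → H¹(U_δ(S))`. That `Ext u` restricts to `u`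
on `S` is also required in the sense of mean values over small balls. -/
structure IsExtensionOperator (d : ℕ) (S : Set (Euc n)) (δ : ℝ)
    (Ext : (Euc n → ℝ) → Euc n → ℝ) : Prop where
  map_add : ∀ u w, MemLp u 2 (surf d S) → MemLp w 2 (surf d S) → Ext (u + w) = Ext u + Ext w
  map_smul : ∀ (c : ℝ) u, MemLp u 2 (surf d S) → Ext (c • u) = c • Ext u
  extends_val : ∀ u, MemLp u 2 (surf d S) → EqOn (Ext u) u S
  extends_mean : ∀ u, MemLp u 2 (surf d S) → ∀ᵐ x ∂surf d S,
    Tendsto (fun r => ⨍ y in Metric.ball x r, |Ext u y - u x|) (𝓝[>] 0) (𝓝 0)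
  bound_L2 : ∃ C : ℝ≥0∞, C ≠ ⊤ ∧ ∀ u, MemLp u 2 (surf d S) →
    MemLp (Ext u) 2 (volume.restrict (Metric.thickening δ S)) ∧
    eLpNorm (Ext u) 2 (volume.restrict (Metric.thickening δ S)) ≤ C * eLpNorm u 2 (surf d S)
  bound_H1 : ∃ C : ℝ≥0∞, C ≠ ⊤ ∧ ∀ u g, HasTangentialGradient d S u g →
    ∃ G, HasWeakGradient (Metric.thickening δ S) (Ext u) G ∧
      eLpNorm (Ext u) 2 (volume.restrict (Metric.thickening δ S)) +
        eLpNorm G 2 (volume.restrict (Metric.thickening δ S)) ≤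
      C * (eLpNorm u 2 (surf d S) + eLpNorm g 2 (surf d S))

/-! ### Meshes -/

/-- Simplices with linear polynomials, or parallelepipeds with tensor product polynomials. -/
inductive ElementKind : Type
  | simplex
  | cube

/-- The reference element. -/
def refElement (n : ℕ) : ElementKind → Set (Euc n)
  | .simplex => {x | (∀ i, 0 ≤ x i) ∧ ∑ i, x i ≤ 1}
  | .cube => {x | ∀ i, 0 ≤ x i ∧ x i ≤ 1}

/-- The polynomials on the reference element: of total degree at most one on the simplex, of degree
at most one in each variable on the cube. -/
def refPoly (n : ℕ) : ElementKind → Set (MvPolynomial (Fin n) ℝ)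
  | .simplex => {p | p.totalDegree ≤ 1}
  | .cube => {p | ∀ i, p.degreeOf i ≤ 1}

/-- A finite conforming mesh: the elements are nondegenerate affine images of the reference
element, they do not overlap, and any two of them meet in a common (possibly empty) face. -/
structure Mesh (n : ℕ) where
  kind : ElementKind
  card : ℕ
  aff : Fin card → (Euc n ≃ᵃ[ℝ] Euc n)
  disjoint_interior : ∀ S T, S ≠ T →
    Disjoint (interior (aff S '' refElement n kind)) (interior (aff T '' refElement n kind))
  conforming : ∀ S T, IsExtreme ℝ (aff S '' refElement n kind)
    ((aff S '' refElement n kind) ∩ (aff T '' refElement n kind))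

namespace Mesh

variable (M : Mesh n)

/-- The closed element `T`. -/
def elem (T : Fin M.card) : Set (Euc n) := M.aff T '' refElement n M.kind

/-- The finite element space `V_{h,0}` of continuous piecewise polynomial functions. -/
def feSpace : Set (Euc n → ℝ) :=
  {v | ContinuousOn v (⋃ T, M.elem T) ∧ ∀ T, ∃ p ∈ refPoly n M.kind,
    ∀ x ∈ refElement n M.kind, v (M.aff T x) = MvPolynomial.eval (fun i => x i) p}

/-- The union of the elements in the active mesh `{T : T ∩ S ≠ ∅}` of `S`. -/
def active (S : Set (Euc n)) : Set (Euc n) :=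
  ⋃ T ∈ {T | (M.elem T ∩ S).Nonempty}, M.elem T

end Mesh

/-! ### Fractured domains -/

/-- A fractured domain `Ω ⊆ ℝⁿ`: a bounded open set partitioned into components `Ω_{d,i}`, where
`Ω_{d,i}` is a smooth `d`-dimensional manifold whose boundary is contained in the union of the
lower dimensional components and of `∂Ω`. -/
structure FracturedDomain (n : ℕ) where
  Ω : Set (Euc n)
  N : ℕ → ℕ
  comp : ∀ d, Fin (N d) → Set (Euc n)
  isOpen_Ω : IsOpen Ω
  isBounded_Ω : Bornology.IsBounded Ω
  N_eq_zero : ∀ d, n < d → N d = 0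
  iUnion_comp : ⋃ d, ⋃ i, comp d i = Ω
  disjoint_comp : ∀ a b : Σ d, Fin (N d), a ≠ b → Disjoint (comp a.1 a.2) (comp b.1 b.2)
  submanifold : ∀ d i, IsSubmanifoldWithCorners d (comp d i)
  bdry_subset : ∀ d i, bdry (comp d i) ⊆ (⋃ l < d, ⋃ j, comp l j) ∪ frontier Ω

namespace FracturedDomain

variable (D : FracturedDomain n)

/-- A family of functions, one for each component. -/
abbrev Field (F : Type) : Type := ∀ d, Fin (D.N d) → Euc n → F

/-- `β` is a smooth tangential vector field on the fractured domain (smooth up to the boundary of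
each component). -/
def IsSmoothTangential (β : D.Field (Euc n)) : Prop :=
  ∀ d i, ContDiff ℝ ∞ (β d i) ∧ ∀ x ∈ D.comp d i, β d i x ∈ tangentSpaceAt (D.comp d i) x

/-- The scalar product `(v, w)_𝒪`. -/
def inner𝒪 (v w : D.Field ℝ) : ℝ :=
  ∑ d ∈ Finset.range (n + 1), ∑ i, ∫ x, v d i x * w d i x ∂surf d (D.comp d i)

/-- The scalar product over `∂𝒪_I`, the part of `⨆ ∂Ω_{d,i}` that is not on `∂Ω`. -/
def innerI (v w : D.Field ℝ) : ℝ :=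
  ∑ d ∈ Finset.range (n + 1), ∑ i,
    ∫ x in (frontier D.Ω)ᶜ, v d i x * w d i x ∂surfBdry d (D.comp d i)

/-- The scalar product over `∂𝒪_B`, the part of `⨆ ∂Ω_{d,i}` that is on `∂Ω`. -/
def innerB (v w : D.Field ℝ) : ℝ :=
  ∑ d ∈ Finset.range (n + 1), ∑ i,
    ∫ x in frontier D.Ω, v d i x * w d i x ∂surfBdry d (D.comp d i)

/-- The function `ν · β` on the boundaries of the components. -/
def normalFlux (β : D.Field (Euc n)) : D.Field ℝ :=
  fun d i x => ⟪exteriorNormal (D.comp d i) x, β d i x⟫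

open Classical in
/-- The jump operator `⟦f⟧`: on `Ω_{d,i}`, the sum of the functions `f_{d+1,j}` that live on the
boundaries `∂Ω_{d+1,j}`. -/
def sumJump (f : D.Field ℝ) : D.Field ℝ :=
  fun d _ x => ∑ j, if x ∈ bdry (D.comp (d + 1) j) then f (d + 1) j x else 0

/-- The boundary trace of `v_{d,i}` on `∂Ω_{d,i}`. -/
def trace (β : D.Field (Euc n)) (v : D.Field ℝ) : D.Field ℝ :=
  fun d i => (dirDerivTrace d (D.comp d i) (β d i) (v d i)).2

open Classical in
/-- The jump `[v]` on `∂Ω_{d,i}`: the trace of `v_{d,i}` minus the values of the functions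
`v_{d-1,j}` on the components `Ω_{d-1,j}` (no component has `d = 0` and a nonempty boundary). -/
def jump (β : D.Field (Euc n)) (v : D.Field ℝ) : D.Field ℝ :=
  fun d i x => D.trace β v d i x - ∑ j, if x ∈ D.comp (d - 1) j then v (d - 1) j x else 0

/-- The directional derivative `(D_β v)_d = β_d · ∇_d v_d - ⟦ν_{d+1} · β_{d+1} [v]_{d+1}⟧_d`. -/
def Dβ (β : D.Field (Euc n)) (v : D.Field ℝ) : D.Field ℝ :=
  fun d i x => (dirDerivTrace d (D.comp d i) (β d i) (v d i)).1 x -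
    D.sumJump (fun e j y => D.normalFlux β e j y * D.jump β v e j y) d i x

/-- The divergence `(Div β)_d = ∇_d · β_d - ⟦ν_{d+1} · β_{d+1}⟧_d`. -/
def Div (β : D.Field (Euc n)) : D.Field ℝ :=
  fun d i x => tangentialDiv (D.comp d i) (β d i) x - D.sumJump (D.normalFlux β) d i x

/-- The operator `L v = D_β v + γ v` with `γ = α + Div β`. -/
def L (β : D.Field (Euc n)) (α : D.Field ℝ) (v : D.Field ℝ) : D.Field ℝ :=
  fun d i x => D.Dβ β v d i x + (α d i x + D.Div β d i x) * v d i x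

/-- The space `V_β` of functions `v ∈ L²(𝒪)` with `β · ∇v ∈ L²(𝒪)` (and with traces on the
boundaries, so that `[v]` is defined). -/
def Vβ (β : D.Field (Euc n)) : Set (D.Field ℝ) :=
  {v | ∀ d i, ∃ g t, HasDirDerivTrace d (D.comp d i) (β d i) (v d i) g t}

/-- The setting of the discretization: a polygonal domain `Ω₀ ⊇ Ω`, a family of quasi-uniform
meshes of `Ω₀` with mesh parameter `h ∈ (0, h₀]` and shape regular elements, and extension
operators to neighbourhoods of the components that contain the active meshes. -/
structure Discretization where
  Ω₀ : Set (Euc n)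
  isOpen_Ω₀ : IsOpen Ω₀
  subset_Ω₀ : D.Ω ⊆ Ω₀
  h₀ : ℝ
  h₀_pos : 0 < h₀
  mesh : ℝ → Mesh n
  iUnion_elem : ∀ h ∈ Ioc 0 h₀, ⋃ T, (mesh h).elem T = closure Ω₀
  quasiUniform : ∃ c > 0, ∃ C : ℝ, ∀ h ∈ Ioc 0 h₀, ∀ T,
    Metric.diam ((mesh h).elem T) ≤ C * h ∧ ∃ x, Metric.ball x (c * h) ⊆ (mesh h).elem T
  δ : ℝ
  δ_pos : 0 < δ
  Ext : ∀ d, Fin (D.N d) → (Euc n → ℝ) → Euc n → ℝ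
  isExtension : ∀ d i, IsExtensionOperator d (D.comp d i) δ (Ext d i)
  active_subset : ∀ h ∈ Ioc 0 h₀, ∀ d i,
    (mesh h).active (D.comp d i) ⊆ Metric.thickening δ (D.comp d i)

namespace Discretization

variable {D} (A : D.Discretization) (β : D.Field (Euc n)) (α : D.Field ℝ) (τ₁ τ₂ h : ℝ)

/-- The space `V^e` of the extensions `v^e = E v` of functions `v ∈ V_β`. As `s_h` involves
the full gradient of `v^e`, its elements are required to be in `H¹`. -/
def Ve : Set (D.Field ℝ) :=
  {v | (∃ u ∈ D.Vβ β, ∀ d i, v d i = A.Ext d i (u d i)) ∧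
    ∀ d i, ∃ G, HasWeakGradient (Metric.thickening A.δ (D.comp d i)) (v d i) G}

/-- The finite element space `V_h = ⨁ V_{h,d,i}`. -/
def Vh : Set (D.Field ℝ) :=
  {v | ∀ d i, v d i ∈ (A.mesh h).feSpace}

/-- The space `W = V^e + V_h`. -/
def W : Set (D.Field ℝ) :=
  {v | ∃ u ∈ A.Ve β, ∃ w ∈ A.Vh h, ∀ d i, v d i = u d i + w d i}

/-- The stabilization form `s_{h,d,i}(v, w) = τ₂ h^{3 - (n - d)} (∇v, ∇w)` over the active mesh of
`Ω_{d,i}`. -/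
def stab (d : ℕ) (i : Fin (D.N d)) (v w : Euc n → ℝ) : ℝ :=
  τ₂ * h ^ (3 - ((n : ℤ) - (d : ℤ))) *
    ∫ x in (A.mesh h).active (D.comp d i),
      ⟪weakGradient (interior ((A.mesh h).active (D.comp d i))) v x,
        weakGradient (interior ((A.mesh h).active (D.comp d i))) w x⟫

/-- The absolute value `|ν · β|_-` of the negative part of `ν · β`. -/
def inflow : D.Field ℝ := fun d i x => |min (D.normalFlux β d i x) 0|

/-- The form `a_{h,d,i}(v, w) = (L v, w) + (τ₁ h L v, L w) + s_{h,d,i}(v, w)` on `Ω_{d,i}`. -/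
def aComp (d : ℕ) (i : Fin (D.N d)) (v w : D.Field ℝ) : ℝ :=
  (∫ x, D.L β α v d i x * w d i x ∂surf d (D.comp d i)) +
  (∫ x, τ₁ * h * D.L β α v d i x * D.L β α w d i x ∂surf d (D.comp d i)) +
  A.stab τ₂ h d i (v d i) (w d i)

/-- The discrete form `a_h`. -/
def a (v w : D.Field ℝ) : ℝ :=
  ∑ d ∈ Finset.range (n + 1), ∑ i, A.aComp β α τ₁ τ₂ h d i v w +
  D.innerI (fun d i x => inflow β d i x * D.jump β v d i x) (D.jump β w) +
  D.innerB (fun d i x => inflow β d i x * D.trace β v d i x) (D.trace β w)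

/-- The square of the energy norm `|||v|||_h`. -/
def energySq (v : D.Field ℝ) : ℝ :=
  D.inner𝒪 v v + h * D.inner𝒪 (D.L β α v) (D.L β α v) +
  ∑ d ∈ Finset.range (n + 1), ∑ i, A.stab τ₂ h d i (v d i) (v d i) +
  D.innerI (fun d i x => |D.normalFlux β d i x| * D.jump β v d i x) (D.jump β v) +
  D.innerB (fun d i x => |D.normalFlux β d i x| * D.trace β v d i x) (D.trace β v)

/-- The energy norm `|||v|||_h`. -/
def energyNorm (v : D.Field ℝ) : ℝ := √(A.energySq β α τ₂ h v)

/-- The norm `|||v|||_{h,*}`. -/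
def energyNormStar (v : D.Field ℝ) : ℝ :=
  √(h⁻¹ * D.inner𝒪 v v + A.energySq β α τ₂ h v)

end Discretization

end FracturedDomain

end

/-! Everything rests on one identity. For `v, w ∈ V_β`, (Lv, w) + (v, Lw) = ((2α + Div β)v, w) + ∑ ∫
(ν·β)[v][w], where the last sum runs over the whole boundaries of all components
(`inner_L_add_inner_L`). The inner and the outer boundary terms merge because no component meets
`∂Ω`, so that `[v]` is the plain trace there (`innerI_add_innerB`).

Continuity: replace (Lv, w) in `a_h` by means of the identity. The derivative moves to `w`, where
`h^{1/2} Lw` is controlled, and `v` pays with `h^{-1/2}`; the boundary weights `ν·β` and `|ν·β|_-`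
add up to the positive part of `ν·β`. Cauchy–Schwarz then bounds each term. Coercivity: with `v = w`
the identity evaluates (Lv, v), and `(ν·β)/2 + |ν·β|_- = |ν·β|/2`, so `a_h(v,v)` equals half of the
zero order term plus `τ₁h‖Lv‖²`, `s_h(v,v)` and half of the boundary norm.

The identity comes from integration by parts on each component. The coupling terms of `D_β` and `Div
β` cancel on summation: a pair `Ω_{d,i}`, `Ω_{d+1,j}` contributes integrals over `Ω_{d,i} ∩
∂Ω_{d+1,j}` that can be read on either component (`integral_sumJump_mul`), and the rest is the
expansion of trace = jump + lower value.

On one component the formula is proved for smooth functions and passes to `V_β` by the density that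
is part of the definition of that space. For smooth functions it is the divergence theorem on a
compact manifold with corners: the area formula moves the integrals to coordinates, `√g` times the
tangential divergence is the flat divergence of `√g B` (`sum_fderiv_density`), the normal flux
through a face is `-√g B_j` (`jac_comp_faceIncl_mul_inner`), and the divergence theorem on a box
together with a partition of unity concludes.

It remains to see that `W ⊆ V_β`. Extensions agree with the extended function on the component. A
finite element function is Lipschitz on the possibly nonconvex polygonal domain, by Hoffman's bound
for pairs of elements. A Lipschitz function has a directional derivative and a trace: the
derivatives of its smooth approximations are bounded in `L²`, and a convexity argument selects
approximations for which they converge strongly. -/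

noncomputable section

variable {n : ℕ}

/-! ### The area formula -/

/-- The factor `√det(AᵀA)` by which a linear map `A : ℝᵐ → ℝⁿ` changes the `m`-dimensional
volume. -/
def jac {m : ℕ} (A : (Fin m → ℝ) →L[ℝ] Euc n) : ℝ :=
  √(Matrix.gram ℝ fun i => A (Pi.single i 1)).det

open scoped NNReal

/-- On `s` the map `f` factors through `g`, and the factor is `K`-Lipschitz on `g '' s`. Used in
both directions to compare an immersion with its derivative. -/
theorem euclideanHausdorffMeasure_image_le_of_dist_le {X Y Z : Type*} [MetricSpace Y]
    [MetricSpace Z] [MeasurableSpace Y] [BorelSpace Y] [MeasurableSpace Z] [BorelSpace Z]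
    {f : X → Y} {g : X → Z} {s : Set X} {K : ℝ≥0} (m : ℕ)
    (h : ∀ x ∈ s, ∀ y ∈ s, dist (f x) (f y) ≤ K * dist (g x) (g y)) :
    μHE[m] (f '' s) ≤ (K : ℝ≥0∞) ^ m * μHE[m] (g '' s) := by
  rcases s.eq_empty_or_nonempty with rfl | ⟨x₀, hx₀⟩
  · simp
  have : Nonempty X := ⟨x₀⟩
  have hmem : ∀ z ∈ g '' s, Function.invFunOn g s z ∈ s ∧ g (Function.invFunOn g s z) = z :=
    fun z hz => ⟨Function.invFunOn_mem hz, Function.invFunOn_eq hz⟩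
  have hL : LipschitzOnWith K (f ∘ Function.invFunOn g s) (g '' s) := by
    refine LipschitzOnWith.of_dist_le_mul fun z hz w hw => ?_
    have := h _ (hmem z hz).1 _ (hmem w hw).1
    rwa [(hmem z hz).2, (hmem w hw).2] at this
  have himg : (f ∘ Function.invFunOn g s) '' (g '' s) = f '' s := by
    rw [← image_comp]
    refine image_congr fun x hx => ?_
    have h2 := hmem (g x) (mem_image_of_mem g hx)
    -- `g` need not be injective, but the hypothesis at distance zero shows that `f` is constant on
    -- its fibres.
    have := h _ h2.1 x hx
    rw [h2.2, dist_self, mul_zero] at this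
    exact dist_le_zero.1 this
  have := hL.hausdorffMeasure_image_le (d := m) (Nat.cast_nonneg m)
  rw [himg, ENNReal.rpow_natCast] at this
  simp only [Measure.euclideanHausdorffMeasure_def, Measure.smul_apply]
  rw [mul_smul_comm]
  exact smul_le_smul_of_nonneg_left this zero_le

/-- An orthonormal basis of the range splits `A` into a square matrix `M` followed by an isometry.
Then `AᵀA = MᵀM`, so `jac A = |det M|`, and Lebesgue measure scales by `|det M|`. -/
theorem euclideanHausdorffMeasure_image_linear {m : ℕ} (A : (Fin m → ℝ) →L[ℝ] Euc n)
    (hA : Function.Injective A) (s : Set (Fin m → ℝ)) :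
    μHE[m] (A '' s) = ENNReal.ofReal (jac A) * volume s := by
  have hfin : Module.finrank ℝ A.range = m := by
    have := LinearMap.finrank_range_of_inj (f := A.toLinearMap) hA
    simpa using this
  let b : OrthonormalBasis (Fin m) ℝ A.range :=
    (stdOrthonormalBasis ℝ A.range).reindex (finCongr hfin)
  let M : (Fin m → ℝ) →ₗ[ℝ] (Fin m → ℝ) :=
    (WithLp.linearEquiv 2 ℝ (Fin m → ℝ)).toLinearMap ∘ₗ b.repr.toLinearEquiv.toLinearMap ∘ₗ
      A.toLinearMap.rangeRestrict
  let T : EuclideanSpace ℝ (Fin m) → Euc n := fun x => (b.repr.symm x : Euc n)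
  have hT : Isometry T := isometry_subtype_coe.comp b.repr.symm.isometry
  have hfac : ∀ x, A x = T (WithLp.toLp 2 (M x)) := fun x => by
    simp [T, M]
  have h1 : A '' s = T '' (WithLp.toLp 2 '' (M '' s)) := by
    rw [← image_comp, ← image_comp]
    exact image_congr fun x _ => hfac x
  have h2 : volume (WithLp.toLp 2 '' (M '' s) : Set (EuclideanSpace ℝ (Fin m))) =
      volume (M '' s) := by
    have := (EuclideanSpace.volume_preserving_symm_measurableEquiv_toLp (Fin m)).measure_preimage_equiv
      (M '' s)
    rw [← this]
    congr 1
    ext x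
    constructor
    · rintro ⟨y, hy, rfl⟩; exact hy
    · intro hx; exact ⟨_, hx, rfl⟩
  have h3 : jac A = |LinearMap.det M| := by
    have hg : (Matrix.gram ℝ fun i => A (Pi.single i 1)) =
        (LinearMap.toMatrix' M).transpose * LinearMap.toMatrix' M := by
      ext i j
      rw [Matrix.gram_apply, hfac, hfac]
      have : ∀ x y : EuclideanSpace ℝ (Fin m), ⟪T x, T y⟫ = ⟪x, y⟫ := fun x y => by
        simp only [T]
        rw [← Submodule.coe_inner, LinearIsometryEquiv.inner_map_map]
      rw [this]
      simp only [Matrix.mul_apply, Matrix.transpose_apply, LinearMap.toMatrix'_apply,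
        PiLp.inner_apply, RCLike.inner_apply, conj_trivial]
      refine Finset.sum_congr rfl fun l _ => ?_
      rw [mul_comm]
    rw [jac, hg, Matrix.det_mul, Matrix.det_transpose, LinearMap.det_toMatrix',
      Real.sqrt_mul_self_eq_abs]
  rw [h1, hT.euclideanHausdorffMeasure_image, EuclideanSpace.euclideanHausdorffMeasure_eq_volume,
    h2, Measure.addHaar_image_linearMap, h3]

theorem jac_pos {m : ℕ} {A : (Fin m → ℝ) →L[ℝ] Euc n} (hA : Function.Injective A) :
    0 < jac A := by
  refine Real.sqrt_pos.2 (Matrix.PosDef.det_pos ?_)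
  rw [Matrix.posDef_gram_iff_linearIndependent]
  have := (Pi.basisFun ℝ (Fin m)).linearIndependent.map' A.toLinearMap
    (LinearMap.ker_eq_bot.2 hA)
  have h2 : (fun i => A (Pi.single i 1)) = A.toLinearMap ∘ Pi.basisFun ℝ (Fin m) := by
    ext i
    simp [Pi.basisFun_apply]
  rw [h2]
  exact this

theorem continuous_jac {m : ℕ} : Continuous (jac : ((Fin m → ℝ) →L[ℝ] Euc n) → ℝ) := by
  unfold jac
  refine Real.continuous_sqrt.comp (Continuous.matrix_det ?_)
  refine continuous_matrix fun i j => ?_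
  simp only [Matrix.gram_apply]
  fun_prop

/-- Near every point an immersion changes the measure nearly as its derivative does. -/
theorem exists_nhds_area_le {m : ℕ} {f : (Fin m → ℝ) → Euc n} {x : Fin m → ℝ}
    {f' : (Fin m → ℝ) →L[ℝ] Euc n} (hf : HasStrictFDerivAt f f' x) (hA : Function.Injective f')
    {c : ℝ≥0} (hc : 1 < c) :
    ∃ V ∈ 𝓝 x, ∀ s ⊆ V, μHE[m] (f '' s) ≤ c * (ENNReal.ofReal (jac f') * volume s) ∧
      ENNReal.ofReal (jac f') * volume s ≤ c * μHE[m] (f '' s) := by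
  obtain ⟨K, hK0, hK⟩ := f'.toLinearMap.exists_antilipschitzWith (LinearMap.ker_eq_bot.2 hA)
  have hlim : ∀ᶠ ε : ℝ in 𝓝[>] 0, (1 + ε) ^ m < c ∧ (1 - ε)⁻¹ ^ m < c ∧ ε < 1 := by
    have h1 : Tendsto (fun ε : ℝ => (1 + ε) ^ m) (𝓝 0) (𝓝 1) := by
      have : Continuous (fun ε : ℝ => (1 + ε) ^ m) := by fun_prop
      simpa using this.tendsto 0
    have h2 : Tendsto (fun ε : ℝ => (1 - ε)⁻¹ ^ m) (𝓝 0) (𝓝 1) := by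
      have : ContinuousAt (fun ε : ℝ => (1 - ε)⁻¹ ^ m) 0 := by
        refine ContinuousAt.pow (ContinuousAt.inv₀ (by fun_prop) (by simp)) m
      simpa [ContinuousAt] using this
    have hc' : (1 : ℝ) < c := by exact_mod_cast hc
    refine nhdsWithin_le_nhds ?_
    filter_upwards [h1.eventually_lt_const hc', h2.eventually_lt_const hc',
      eventually_lt_nhds (zero_lt_one (α := ℝ))] with ε a b d using ⟨a, b, d⟩
  obtain ⟨ε, ⟨h1, h2, h3⟩, hε⟩ := (hlim.and self_mem_nhdsWithin).exists
  have hε : 0 < ε := hε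
  lift ε to ℝ≥0 using hε.le
  have hε' : 0 < ε := by exact_mod_cast hε
  -- As `‖y - z‖ ≤ K‖f'(y - z)‖`, the tolerance `ε / K` makes the linearization error at most
  -- `ε‖f'(y - z)‖`. Hence `f` and `f'` dominate each other's distances with the factors `1 + ε` and
  -- `(1 - ε)⁻¹`.
  obtain ⟨V, hV, hV'⟩ := hf.approximates_deriv_on_nhds (c := ε / K)
    (Or.inr (div_pos hε' hK0))
  refine ⟨V, hV, fun s hs => ?_⟩
  have key : ∀ y ∈ s, ∀ z ∈ s, ‖f y - f z - f' (y - z)‖ ≤ ε * ‖f' (y - z)‖ := by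
    intro y hy z hz
    refine (hV' y (hs hy) z (hs hz)).trans ?_
    have := hK.le_mul_dist y z
    rw [dist_eq_norm, dist_eq_norm] at this
    simp only [ContinuousLinearMap.coe_coe, ← map_sub] at this
    calc ((ε / K : ℝ≥0) : ℝ) * ‖y - z‖ ≤ ((ε / K : ℝ≥0) : ℝ) * (K * ‖f' (y - z)‖) := by gcongr
      _ = ε * ‖f' (y - z)‖ := by
        have : (K : ℝ) ≠ 0 := by exact_mod_cast hK0.ne'
        push_cast
        field_simp
  have hd1 : ∀ y ∈ s, ∀ z ∈ s, dist (f y) (f z) ≤ ((1 + ε : ℝ≥0) : ℝ) * dist (f' y) (f' z) := by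
    intro y hy z hz
    rw [dist_eq_norm, dist_eq_norm, ← map_sub]
    have := norm_le_norm_add_norm_sub' (f y - f z) (f' (y - z))
    have := key y hy z hz
    push_cast
    linarith
  have h3' : ε < 1 := by exact_mod_cast h3
  have hd2 : ∀ y ∈ s, ∀ z ∈ s, dist (f' y) (f' z) ≤ (((1 - ε)⁻¹ : ℝ≥0) : ℝ) * dist (f y) (f z) := by
    intro y hy z hz
    rw [dist_eq_norm, dist_eq_norm, ← map_sub]
    have := norm_le_norm_add_norm_sub (f y - f z) (f' (y - z))
    have := key y hy z hz
    rw [NNReal.coe_inv, NNReal.coe_sub h3'.le, NNReal.coe_one, inv_mul_eq_div,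
      le_div_iff₀ (by linarith)]
    linarith
  rw [← euclideanHausdorffMeasure_image_linear f' hA]
  constructor
  · refine (euclideanHausdorffMeasure_image_le_of_dist_le m hd1).trans ?_
    gcongr
    have : (1 + ε) ^ m ≤ c := by exact_mod_cast h1.le
    exact_mod_cast this
  · refine (euclideanHausdorffMeasure_image_le_of_dist_le m hd2).trans ?_
    gcongr
    have : (1 - ε)⁻¹ ^ m ≤ c := by
      rw [← NNReal.coe_le_coe]
      push_cast
      rw [NNReal.coe_sub h3'.le]
      exact h2.le
    exact_mod_cast this

/-- The area formula for an injective immersion. -/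
theorem euclideanHausdorffMeasure_image_eq_lintegral {m : ℕ} {f : (Fin m → ℝ) → Euc n}
    {U : Set (Fin m → ℝ)} (hU : IsOpen U) (hf : ContDiffOn ℝ 1 f U) (hinj : InjOn f U)
    (hf' : ∀ x ∈ U, Function.Injective (fderiv ℝ f x)) {s : Set (Fin m → ℝ)}
    (hs : MeasurableSet s) (hsU : s ⊆ U) :
    μHE[m] (f '' s) = ∫⁻ x in s, ENNReal.ofReal (jac (fderiv ℝ f x)) := by
  set J : (Fin m → ℝ) → ℝ≥0∞ := fun x => ENNReal.ofReal (jac (fderiv ℝ f x)) with hJ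
  have hJc : ContinuousOn (fun x => jac (fderiv ℝ f x)) U :=
    continuous_jac.comp_continuousOn (hf.continuousOn_fderiv_of_isOpen hU le_rfl)
  -- One factor `c` pays for replacing `f` by its derivative at `x`, the other for freezing the
  -- Jacobian at `x`.
  have hlocal : ∀ c : ℝ≥0, 1 < c → ∀ x ∈ U, ∃ V, IsOpen V ∧ x ∈ V ∧ ∀ u ⊆ V, MeasurableSet u →
      μHE[m] (f '' u) ≤ (c : ℝ≥0∞) ^ 2 * ∫⁻ x in u, J x ∧
      ∫⁻ x in u, J x ≤ (c : ℝ≥0∞) ^ 2 * μHE[m] (f '' u) := by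
    intro c hc x hx
    have hst : HasStrictFDerivAt f (fderiv ℝ f x) x :=
      (hf.contDiffAt (hU.mem_nhds hx)).hasStrictFDerivAt one_ne_zero
    obtain ⟨V, hV, hV'⟩ := exists_nhds_area_le hst (hf' x hx) hc
    have hc' : (1 : ℝ) < c := by exact_mod_cast hc
    have hpos := jac_pos (hf' x hx)
    have hcx := hJc.continuousAt (hU.mem_nhds hx)
    have e1 : ∀ᶠ y in 𝓝 x, jac (fderiv ℝ f y) < c * jac (fderiv ℝ f x) :=
      hcx.eventually_lt_const (by nlinarith)
    have e2 : ∀ᶠ y in 𝓝 x, jac (fderiv ℝ f x) / c < jac (fderiv ℝ f y) :=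
      hcx.eventually_const_lt (by rw [div_lt_iff₀ (by linarith)]; nlinarith)
    obtain ⟨V', hV'V, hV'o, hxV'⟩ := mem_nhds_iff.1 (inter_mem hV (e1.and e2))
    refine ⟨V', hV'o, hxV', fun u hu hum => ?_⟩
    replace hu := hu.trans hV'V
    obtain ⟨b1, b2⟩ := hV' u (hu.trans inter_subset_left)
    have j1 : ∫⁻ y in u, J y ≤ c * (ENNReal.ofReal (jac (fderiv ℝ f x)) * volume u) := by
      rw [← mul_assoc, ← setLIntegral_const]
      refine setLIntegral_mono' hum fun y hy => ?_
      rw [← ENNReal.ofReal_coe_nnreal, ← ENNReal.ofReal_mul c.coe_nonneg]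
      exact ENNReal.ofReal_le_ofReal (hu hy).2.1.le
    have j2 : ENNReal.ofReal (jac (fderiv ℝ f x)) * volume u ≤ c * ∫⁻ y in u, J y := by
      rw [← setLIntegral_const, ← lintegral_const_mul' _ _ ENNReal.coe_ne_top]
      refine setLIntegral_mono' hum fun y hy => ?_
      rw [← ENNReal.ofReal_coe_nnreal, ← ENNReal.ofReal_mul c.coe_nonneg]
      have := (hu hy).2.2
      rw [div_lt_iff₀ (by linarith)] at this
      exact ENNReal.ofReal_le_ofReal (by linarith)
    constructor
    · refine b1.trans ?_
      rw [pow_two, mul_assoc]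
      gcongr
    · refine j1.trans ?_
      rw [pow_two, mul_assoc]
      gcongr
  have hglobal : ∀ c : ℝ≥0, 1 < c → μHE[m] (f '' s) ≤ (c : ℝ≥0∞) ^ 2 * ∫⁻ x in s, J x ∧
      ∫⁻ x in s, J x ≤ (c : ℝ≥0∞) ^ 2 * μHE[m] (f '' s) := by
    intro c hc
    choose! V hVo hxV hV using hlocal c hc
    obtain ⟨T, hTU, hTc, hT⟩ := TopologicalSpace.countable_cover_nhdsWithin
      fun x hx => nhdsWithin_le_nhds ((hVo x hx).mem_nhds (hxV x hx))
    rcases s.eq_empty_or_nonempty with rfl | ⟨x₀, hx₀⟩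
    · simp
    have hTne : T.Nonempty := by
      obtain ⟨y, hy⟩ := mem_iUnion.1 (hT (hsU hx₀))
      simp only [mem_iUnion] at hy
      exact ⟨y, hy.1⟩
    obtain ⟨q, rfl⟩ := hTc.exists_eq_range hTne
    have hq : ∀ k, q k ∈ U := fun k => hTU (mem_range_self k)
    -- Countably many of the neighbourhoods cover `s`. Made disjoint, they turn the local bounds
    -- into a bound for the sums, with the same `c`.
    let I : ℕ → Set (Fin m → ℝ) := disjointed fun k => V (q k)
    have hIm : ∀ k, MeasurableSet (I k) :=
      fun k => MeasurableSet.disjointed (fun k => (hVo _ (hq k)).measurableSet) k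
    have hcov : s = ⋃ k, s ∩ I k := by
      rw [← inter_iUnion, iUnion_disjointed, eq_comm, inter_eq_left]
      refine hsU.trans (hT.trans ?_)
      simp
    have hdisj : Pairwise (Function.onFun Disjoint fun k => s ∩ I k) := fun i j hij =>
      (disjoint_disjointed (fun k => V (q k)) hij).mono inter_subset_right inter_subset_right
    have hmeas : ∀ k, MeasurableSet (s ∩ I k) := fun k => hs.inter (hIm k)
    have e1 : ∫⁻ x in s, J x = ∑' k, ∫⁻ x in s ∩ I k, J x := by
      conv_lhs => rw [hcov]
      rw [lintegral_iUnion hmeas hdisj]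
    have e2 : μHE[m] (f '' s) = ∑' k, μHE[m] (f '' (s ∩ I k)) := by
      conv_lhs => rw [hcov, image_iUnion]
      refine measure_iUnion (fun i j hij => ?_) fun k => ?_
      · rw [Function.onFun, disjoint_iff_inter_eq_empty,
          ← hinj.image_inter (inter_subset_left.trans hsU) (inter_subset_left.trans hsU),
          (hdisj hij).inter_eq, image_empty]
      · exact (hmeas k).image_of_continuousOn_injOn
          (hf.continuousOn.mono (inter_subset_left.trans hsU))
          (hinj.mono (inter_subset_left.trans hsU))
    have hk := fun k => hV _ (hq k) (s ∩ I k)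
      (inter_subset_right.trans (disjointed_subset _ _)) (hmeas k)
    rw [e1, e2, ← ENNReal.tsum_mul_left, ← ENNReal.tsum_mul_left]
    exact ⟨ENNReal.tsum_le_tsum fun k => (hk k).1, ENNReal.tsum_le_tsum fun k => (hk k).2⟩
  have hle : ∀ a b : ℝ≥0∞, (∀ c : ℝ≥0, 1 < c → a ≤ (c : ℝ≥0∞) ^ 2 * b) → a ≤ b := by
    intro a b hab
    have hlim : Tendsto (fun c : ℝ≥0 => (c : ℝ≥0∞) ^ 2 * b) (𝓝[>] 1) (𝓝 (1 * b)) := by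
      refine ENNReal.Tendsto.mul_const ?_ (Or.inl one_ne_zero)
      have : Continuous fun c : ℝ≥0 => (c : ℝ≥0∞) ^ 2 := by fun_prop
      simpa using (this.tendsto 1).mono_left nhdsWithin_le_nhds
    rw [one_mul] at hlim
    refine ge_of_tendsto hlim ?_
    filter_upwards [self_mem_nhdsWithin] with c hc using hab c hc
  exact le_antisymm (hle _ _ fun c hc => (hglobal c hc).1) (hle _ _ fun c hc => (hglobal c hc).2)

/-- The area formula as an identity of measures. -/
theorem map_withDensity_jac_eq {m : ℕ} {f : (Fin m → ℝ) → Euc n}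
    {U : Set (Fin m → ℝ)} (hU : IsOpen U) (hf : ContDiffOn ℝ 1 f U) (hinj : InjOn f U)
    (hf' : ∀ x ∈ U, Function.Injective (fderiv ℝ f x)) {s : Set (Fin m → ℝ)}
    (hs : MeasurableSet s) (hsU : s ⊆ U) :
    ((volume.restrict s).withDensity fun x => ENNReal.ofReal (jac (fderiv ℝ f x))).map f =
      μHE[m].restrict (f '' s) := by
  have hcont : ContinuousOn f s := hf.continuousOn.mono hsU
  have hae : AEMeasurable f ((volume.restrict s).withDensity
      fun x => ENNReal.ofReal (jac (fderiv ℝ f x))) :=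
    (hcont.aemeasurable hs).mono_ac (withDensity_absolutelyContinuous _ _)
  ext t ht
  have hst : MeasurableSet (s ∩ f ⁻¹' t) := by
    have := hs.subtype_image (hcont.domRestrict.measurable ht)
    rwa [show s.domRestrict f ⁻¹' t = Subtype.val ⁻¹' (f ⁻¹' t) from rfl,
      Subtype.image_preimage_coe] at this
  rw [Measure.map_apply_of_aemeasurable hae ht, withDensity_apply',
    Measure.restrict_restrict', inter_comm, Measure.restrict_apply ht,
    ← euclideanHausdorffMeasure_image_eq_lintegral hU hf hinj hf'
      hst (inter_subset_left.trans hsU), image_inter_preimage, inter_comm]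
  exact hs

/-- The area formula for integrals. -/
theorem setIntegral_image_eq_integral_jac_mul {m : ℕ} {f : (Fin m → ℝ) → Euc n}
    {U : Set (Fin m → ℝ)} (hU : IsOpen U) (hf : ContDiffOn ℝ 1 f U) (hinj : InjOn f U)
    (hf' : ∀ x ∈ U, Function.Injective (fderiv ℝ f x)) {s : Set (Fin m → ℝ)}
    (hs : MeasurableSet s) (hsU : s ⊆ U) {g : Euc n → ℝ}
    (hg : AEStronglyMeasurable g (μHE[m].restrict (f '' s))) :
    ∫ x in f '' s, g x ∂μHE[m] = ∫ y in s, jac (fderiv ℝ f y) * g (f y) := by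
  have hcont : ContinuousOn f s := hf.continuousOn.mono hsU
  have hae : AEMeasurable f ((volume.restrict s).withDensity
      fun x => ENNReal.ofReal (jac (fderiv ℝ f x))) :=
    (hcont.aemeasurable hs).mono_ac (withDensity_absolutelyContinuous _ _)
  have hJ : AEMeasurable (fun y => (jac (fderiv ℝ f y)).toNNReal) (volume.restrict s) :=
    (((continuous_jac.comp_continuousOn (hf.continuousOn_fderiv_of_isOpen hU le_rfl)).mono
      hsU).aemeasurable hs).real_toNNReal
  have hmap := map_withDensity_jac_eq hU hf hinj hf' hs hsU
  rw [← hmap] at hg ⊢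
  rw [integral_map hae hg]
  have := integral_withDensity_eq_integral_smul₀ hJ (fun y => g (f y))
  refine this.trans (integral_congr_ae (Eventually.of_forall fun y => ?_))
  simp [NNReal.smul_def, Real.coe_toNNReal _ (Real.sqrt_nonneg _), jac]

/-! ### Linear algebra of parametrizations -/

/-- The Gram matrix `AᵀA` of a linear map `A : ℝᵐ → ℝⁿ`. -/
abbrev gramOf {m : ℕ} (A : (Fin m → ℝ) →L[ℝ] Euc n) : Matrix (Fin m) (Fin m) ℝ :=
  Matrix.gram ℝ fun i => A (Pi.single i 1)

/-- The left inverse `(AᵀA)⁻¹Aᵀ` of an injective linear map `A : ℝᵐ → ℝⁿ`. -/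
def pinv {m : ℕ} (A : (Fin m → ℝ) →L[ℝ] Euc n) : Euc n →L[ℝ] (Fin m → ℝ) :=
  ContinuousLinearMap.pi fun i => ∑ j, (gramOf A)⁻¹ i j • innerSL ℝ (A (Pi.single j 1))

section

variable {m : ℕ} {A : (Fin m → ℝ) →L[ℝ] Euc n}

theorem pinv_apply (v : Euc n) (i : Fin m) :
    pinv A v i = ∑ j, (gramOf A)⁻¹ i j * ⟪A (Pi.single j 1), v⟫ := by
  simp [pinv]

theorem map_eq_sum_single (w : Fin m → ℝ) : A w = ∑ i, w i • A (Pi.single i 1) := by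
  conv_lhs => rw [pi_eq_sum_univ' w]
  simp only [map_sum, map_smul]

theorem inner_single_map (j : Fin m) (w : Fin m → ℝ) :
    ⟪A (Pi.single j 1), A w⟫ = (gramOf A).mulVec w j := by
  rw [map_eq_sum_single w, inner_sum, Matrix.mulVec, dotProduct]
  refine Finset.sum_congr rfl fun i _ => ?_
  rw [inner_smul_right, mul_comm]
  rfl

theorem pinv_apply_eq_mulVec (v : Euc n) :
    pinv A v = (gramOf A)⁻¹.mulVec fun j => ⟪A (Pi.single j 1), v⟫ := by
  ext i
  rw [pinv_apply]
  rfl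

theorem gramOf_symm (i j : Fin m) : gramOf A i j = gramOf A j i := by
  simp only [gramOf, Matrix.gram_apply]
  exact real_inner_comm _ _

theorem gramOf_inv_symm (i j : Fin m) : (gramOf A)⁻¹ i j = (gramOf A)⁻¹ j i := by
  have : (gramOf A).transpose = gramOf A := by
    ext i j
    exact gramOf_symm j i
  conv_lhs => rw [← this, ← Matrix.transpose_nonsing_inv]
  rfl

variable (hA : Function.Injective A)
include hA

theorem det_gramOf_pos : 0 < (gramOf A).det := Real.sqrt_pos.1 (jac_pos hA)

theorem jac_mul_self : jac A * jac A = (gramOf A).det :=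
  Real.mul_self_sqrt (det_gramOf_pos hA).le

theorem isUnit_det_gramOf : IsUnit (gramOf A).det := (det_gramOf_pos hA).ne'.isUnit

theorem pinv_map (w : Fin m → ℝ) : pinv A (A w) = w := by
  rw [pinv_apply_eq_mulVec]
  simp_rw [inner_single_map]
  rw [Matrix.mulVec_mulVec, Matrix.nonsing_inv_mul _ (isUnit_det_gramOf hA), Matrix.one_mulVec]

theorem inner_single_map_pinv (j : Fin m) (v : Euc n) :
    ⟪A (Pi.single j 1), A (pinv A v)⟫ = ⟪A (Pi.single j 1), v⟫ := by
  rw [inner_single_map, pinv_apply_eq_mulVec, Matrix.mulVec_mulVec,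
    Matrix.mul_nonsing_inv _ (isUnit_det_gramOf hA), Matrix.one_mulVec]

/-- `v - A(AᵀA)⁻¹Aᵀv` is orthogonal to every column of `A`. This writes the tangential projection in
coordinates. -/
theorem starProjection_eq_of_eq_range {K : Submodule ℝ (Euc n)} [K.HasOrthogonalProjection]
    (hK : K = LinearMap.range A.toLinearMap) (v : Euc n) :
    K.starProjection v = A (pinv A v) := by
  subst hK
  refine Submodule.eq_starProjection_of_mem_of_inner_eq_zero ⟨_, rfl⟩ ?_
  rintro _ ⟨w, rfl⟩
  simp only [ContinuousLinearMap.coe_coe]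
  rw [map_eq_sum_single w, inner_sum]
  refine Finset.sum_eq_zero fun i _ => ?_
  rw [inner_smul_right, real_inner_comm, inner_sub_right, inner_single_map_pinv hA, sub_self,
    mul_zero]

omit hA in
/-- Jacobi's formula. -/
theorem hasDerivAt_det {G : ℝ → Matrix (Fin m) (Fin m) ℝ} {N : Matrix (Fin m) (Fin m) ℝ} {t : ℝ}
    (hG : HasDerivAt G N t) :
    HasDerivAt (fun s => (G s).det) ((G t).adjugate * N).trace t := by
  -- As a multilinear function of the rows, the determinant has as its derivative the sum over the
  -- rows of determinants with one row replaced; cofactor expansion turns these into entries of the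
  -- adjugate.
  let D : ContinuousMultilinearMap ℝ (fun _ : Fin m => Fin m → ℝ) ℝ :=
    { toMultilinearMap := (Matrix.detRowAlternating (R := ℝ) (n := Fin m)).toMultilinearMap
      cont := Continuous.matrix_det continuous_id }
  have h := (D.hasFDerivAt (G t)).comp_hasDerivAt t hG
  refine h.congr_deriv ?_
  refine (ContinuousMultilinearMap.linearDeriv_apply D (G t) N).trans ?_
  rw [Matrix.trace_mul_comm]
  simp only [Matrix.trace, Matrix.diag_apply]
  refine Finset.sum_congr rfl fun i _ => ?_
  have : D (Function.update (G t) i (N i)) = ((G t).updateRow i (N i)).det := rfl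
  rw [this, ← Matrix.cramer_transpose_apply, Matrix.cramer_eq_adjugate_mulVec,
    ← Matrix.adjugate_transpose, Matrix.mul_apply, Matrix.mulVec, dotProduct]
  refine Finset.sum_congr rfl fun j _ => ?_
  rw [Matrix.transpose_apply, mul_comm]

theorem contDiffAt_jac : ContDiffAt ℝ ∞ (jac : ((Fin m → ℝ) →L[ℝ] Euc n) → ℝ) A := by
  unfold jac
  refine ContDiffAt.sqrt ?_ (det_gramOf_pos hA).ne'
  simp only [Matrix.det_apply, Matrix.gram_apply]
  refine ContDiffAt.sum fun σ _ => ContDiffAt.const_smul _ (contDiffAt_prod fun i _ => ?_)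
  exact ContDiffAt.inner ℝ (by fun_prop) (by fun_prop)

/-- Along `A + tM` the Gram matrix has the derivative `AᵀM + MᵀA`, and Jacobi's formula applies.
Both halves have the same trace against the symmetric matrix `(AᵀA)⁻¹`; this factor 2 cancels that
of the square root. The sum is the trace of `A⁺M`. -/
theorem fderiv_jac (M : (Fin m → ℝ) →L[ℝ] Euc n) :
    fderiv ℝ jac A M = jac A * ∑ i, pinv A (M (Pi.single i 1)) i := by
  have h0 : A + (0 : ℝ) • M = A := by
    ext x
    simp
  have hline : HasDerivAt (fun t : ℝ => A + t • M) M 0 := by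
    simpa using ((hasDerivAt_id (0 : ℝ)).smul_const M).const_add A
  have h1 : HasDerivAt (fun t : ℝ => jac (A + t • M)) (fderiv ℝ jac A M) 0 := by
    have hd : HasFDerivAt jac (fderiv ℝ jac A) (A + (0 : ℝ) • M) := by
      rw [h0]
      exact ((contDiffAt_jac hA).differentiableAt (by simp)).hasFDerivAt
    exact hd.comp_hasDerivAt (0 : ℝ) hline
  let N : Matrix (Fin m) (Fin m) ℝ := Matrix.of fun i j =>
    ⟪A (Pi.single i 1), M (Pi.single j 1)⟫ + ⟪M (Pi.single i 1), A (Pi.single j 1)⟫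
  have hG : HasDerivAt (fun t : ℝ => gramOf (A + t • M)) N 0 := by
    refine hasDerivAt_pi.2 fun i => hasDerivAt_pi.2 fun j => ?_
    have e : ∀ i : Fin m, HasDerivAt (fun t : ℝ => (A + t • M) (Pi.single i 1))
        (M (Pi.single i 1)) 0 := fun i => by
      have := (ContinuousLinearMap.apply ℝ (Euc n)
        (Pi.single i (1 : ℝ) : Fin m → ℝ)).hasFDerivAt.comp_hasDerivAt (0 : ℝ) hline
      exact this
    have := (e i).inner ℝ (e j)
    simpa [N, Matrix.gram_apply] using this
  have h2 := hasDerivAt_det hG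
  have h3 : HasDerivAt (fun t : ℝ => jac (A + t • M))
      (((gramOf (A + (0 : ℝ) • M)).adjugate * N).trace /
        (2 * √((gramOf (A + (0 : ℝ) • M)).det))) 0 := by
    refine h2.sqrt ?_
    rw [h0]
    exact (det_gramOf_pos hA).ne'
  rw [h1.unique h3]
  have hpos := jac_pos hA
  rw [h0]
  have hadj : (gramOf A).adjugate = (gramOf A).det • (gramOf A)⁻¹ := by
    rw [Matrix.inv_def, smul_smul, Ring.mul_inverse_cancel _ (isUnit_det_gramOf hA), one_smul]
  have htr : ((gramOf A)⁻¹ * N).trace = 2 * ∑ i, pinv A (M (Pi.single i 1)) i := by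
    simp only [Matrix.trace, Matrix.diag_apply, Matrix.mul_apply, pinv_apply, N, Matrix.of_apply,
      mul_add, Finset.sum_add_distrib, two_mul]
    congr 1
    rw [Finset.sum_comm]
    refine Finset.sum_congr rfl fun i _ => Finset.sum_congr rfl fun j _ => ?_
    rw [gramOf_inv_symm, real_inner_comm]
  rw [hadj, Matrix.smul_mul, Matrix.trace_smul, htr, smul_eq_mul, ← jac_mul_self hA,
    Real.sqrt_mul_self hpos.le]
  field_simp

end

/-- The inclusion of the hyperplane `{x_j = 0}`. -/
def faceIncl {m : ℕ} (j : Fin (m + 1)) : (Fin m → ℝ) →L[ℝ] (Fin (m + 1) → ℝ) :=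
  LinearMap.toContinuousLinearMap
    { toFun := fun z => j.insertNth (0 : ℝ) z
      map_add' := fun x y => by
        ext i
        refine Fin.succAboveCases j ?_ (fun i => ?_) i <;> simp
      map_smul' := fun c x => by
        ext i
        refine Fin.succAboveCases j ?_ (fun i => ?_) i <;> simp }

/-! ### Hyperplane faces and their unit normals -/

section

variable {m : ℕ} (j : Fin (m + 1))

theorem faceIncl_apply (z : Fin m → ℝ) : faceIncl j z = j.insertNth (0 : ℝ) z := rfl

@[simp]
theorem faceIncl_apply_same (z : Fin m → ℝ) : faceIncl j z j = 0 := by simp [faceIncl_apply]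

@[simp]
theorem faceIncl_apply_succAbove (z : Fin m → ℝ) (i : Fin m) :
    faceIncl j z (j.succAbove i) = z i := by simp [faceIncl_apply]

theorem faceIncl_single (i : Fin m) :
    faceIncl j (Pi.single i 1) = Pi.single (j.succAbove i) 1 := by
  ext l
  refine Fin.succAboveCases j ?_ (fun l => ?_) l
  · simp [Fin.ne_succAbove]
  · simp [Pi.single_apply]

theorem faceIncl_injective : Function.Injective (faceIncl j) := fun x y h => by
  ext i
  simpa using congrFun h (j.succAbove i)

theorem faceIncl_removeNth {y : Fin (m + 1) → ℝ} (hy : y j = 0) :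
    faceIncl j (j.removeNth y) = y := by
  rw [faceIncl_apply, ← hy, Fin.insertNth_self_removeNth]

variable {j} {A : (Fin (m + 1) → ℝ) →L[ℝ] Euc n} (hA : Function.Injective A)
include hA

/-- Restriction to the face deletes row and column `j` of the Gram matrix, which leaves the cofactor
of the entry `(j, j)`; Cramer's rule expresses it by the inverse matrix. -/
theorem det_gramOf_comp_faceIncl :
    (gramOf (A ∘L faceIncl j)).det = (gramOf A).det * (gramOf A)⁻¹ j j := by
  have h1 : gramOf (A ∘L faceIncl j) = (gramOf A).submatrix j.succAbove j.succAbove := by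
    ext a b
    simp [gramOf, Matrix.gram_apply, faceIncl_single]
  have h2 := Matrix.adjugate_fin_succ_eq_det_submatrix (gramOf A) j j
  rw [Even.neg_one_pow ⟨_, rfl⟩, one_mul] at h2
  rw [h1, ← h2, Matrix.inv_def, Matrix.smul_apply, smul_eq_mul, ← mul_assoc,
    Ring.mul_inverse_cancel _ (isUnit_det_gramOf hA), one_mul]

/-- `ν` is orthogonal to all columns except the `j`-th, so `⟪ν, A b⟫ = -c b_j` with `c ≥ 0`. Since
`ν` is a unit vector in the range, `c² g^{jj} = 1`, whereas the squared face Jacobian is `det g ·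
g^{jj}`. So `c` is exactly the ratio of the two Jacobians, and the flux through a face needs no
normal in coordinates. -/
theorem jac_comp_faceIncl_mul_inner {ν : Euc n} (h1 : ‖ν‖ = 1)
    (h2 : ν ∈ LinearMap.range A.toLinearMap)
    (h3 : ∀ i : Fin m, ⟪ν, A (Pi.single (j.succAbove i) 1)⟫ = 0)
    (h4 : ⟪ν, A (Pi.single j 1)⟫ ≤ 0) (b : Fin (m + 1) → ℝ) :
    jac (A ∘L faceIncl j) * ⟪ν, A b⟫ = -(jac A * b j) := by
  obtain ⟨w, rfl⟩ := h2
  simp only [ContinuousLinearMap.coe_coe] at *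
  set c : ℝ := -⟪A w, A (Pi.single j 1)⟫ with hc
  have hc0 : 0 ≤ c := by linarith
  have hb : ∀ b : Fin (m + 1) → ℝ, ⟪A w, A b⟫ = -c * b j := by
    intro b
    rw [map_eq_sum_single b, inner_sum, Fin.sum_univ_succAbove _ j]
    simp only [inner_smul_right, h3, mul_zero, Finset.sum_const_zero, add_zero]
    rw [hc]; ring
  have hw : -c * w j = 1 := by
    rw [← hb w, real_inner_self_eq_norm_sq, h1, one_pow]
  have hwj : w j = -(c * (gramOf A)⁻¹ j j) := by
    have : w = pinv A (A w) := (pinv_map hA w).symm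
    conv_lhs => rw [this, pinv_apply]
    simp only [real_inner_comm (A w), hb]
    rw [Finset.sum_eq_single j]
    · simp; ring
    · intro i _ hij
      simp [hij.symm]
    · simp
  have hcd : c * c * (gramOf A)⁻¹ j j = 1 := by rw [hwj] at hw; linarith
  have hinj : Function.Injective (A ∘L faceIncl j) := hA.comp (faceIncl_injective j)
  have hJ : jac (A ∘L faceIncl j) * c = jac A := by
    have e1 := jac_mul_self hinj
    have e2 := jac_mul_self hA
    rw [det_gramOf_comp_faceIncl hA] at e1
    refine (mul_self_inj (mul_nonneg (jac_pos hinj).le hc0) (jac_pos hA).le).1 ?_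
    calc _ = jac (A ∘L faceIncl j) * jac (A ∘L faceIncl j) * (c * c) := by ring
      _ = (gramOf A).det * (c * c * (gramOf A)⁻¹ j j) := by rw [e1]; ring
      _ = _ := by rw [hcd, mul_one, e2]
  rw [hb, ← hJ]
  ring

-- The column `u` of `(AᵀA)⁻¹` yields the dual vector `A u`, for which `⟪A u, A b⟫ = b_j`. The
-- normal is `-A u / ‖A u‖`, with the sign that makes it point to negative `b_j`.
variable (j) in
theorem exists_unit_normal : ∃ ν : Euc n, ‖ν‖ = 1 ∧ ν ∈ LinearMap.range A.toLinearMap ∧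
    ∃ c : ℝ, c ≤ 0 ∧ ∀ b : Fin (m + 1) → ℝ, ⟪ν, A b⟫ = c * b j := by
  set u : Fin (m + 1) → ℝ := (gramOf A)⁻¹.mulVec (Pi.single j 1) with hu
  have hin : ∀ b : Fin (m + 1) → ℝ, ⟪A u, A b⟫ = b j := by
    intro b
    have h1 : ∀ i, ⟪A u, A (Pi.single i 1)⟫ = if i = j then 1 else 0 := by
      intro i
      rw [real_inner_comm, inner_single_map, hu, Matrix.mulVec_mulVec,
        Matrix.mul_nonsing_inv _ (isUnit_det_gramOf hA), Matrix.one_mulVec, Pi.single_apply]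
    rw [map_eq_sum_single b, inner_sum]
    simp [inner_smul_right, h1]
  have hpos : 0 < ‖A u‖ := by
    refine norm_pos_iff.2 fun h0 => ?_
    have := hin (Pi.single j 1)
    rw [h0, inner_zero_left] at this
    simp at this
  refine ⟨-(‖A u‖⁻¹ • A u), ?_, ?_, -‖A u‖⁻¹, by simp, fun b => ?_⟩
  · rw [norm_neg, norm_smul, norm_inv, norm_norm, inv_mul_cancel₀ hpos.ne']
  · exact Submodule.neg_mem _ (Submodule.smul_mem _ _ ⟨u, rfl⟩)
  · rw [inner_neg_left, real_inner_smul_left, hin, neg_mul]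

end

/-! ### Local parametrizations of manifolds with corners -/

/-- A smooth parametrization `ψ` of the part of the `d`-dimensional manifold `S` in an open set `W`
by an open part of the corner `(0, ∞)ᵏ × ℝᵈ⁻ᵏ`, with a smooth left inverse `π`. -/
structure CornerChart (d : ℕ) (S : Set (Euc n)) where
  k : ℕ
  W : Set (Euc n)
  U : Set (Fin d → ℝ)
  ψ : (Fin d → ℝ) → Euc n
  π : Euc n → (Fin d → ℝ)
  isOpen_W : IsOpen W
  isOpen_U : IsOpen U
  contDiffOn_ψ : ContDiffOn ℝ ∞ ψ U
  contDiffOn_π : ContDiffOn ℝ ∞ π W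
  ψ_mem_W : ∀ y ∈ U, ψ y ∈ W
  π_ψ : ∀ y ∈ U, π (ψ y) = y
  π_mem_U : ∀ x ∈ closure S ∩ W, π x ∈ U
  ψ_π : ∀ x ∈ closure S ∩ W, ψ (π x) = x
  ψ_mem_iff : ∀ y ∈ U, ψ y ∈ S ↔ ∀ j : Fin d, (j : ℕ) < k → 0 < y j
  ψ_mem_closure_iff : ∀ y ∈ U, ψ y ∈ closure S ↔ ∀ j : Fin d, (j : ℕ) < k → 0 ≤ y j

/-- The chart is the straightening map `Φ` composed with the inclusion of, and the projection to,
the first `d` coordinates. The definition describes only `S` itself; the closure is described by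
limits, which turn strict inequalities into weak ones. -/
theorem IsSubmanifoldWithCorners.exists_chart {d : ℕ} {S : Set (Euc n)} (hd : d ≤ n)
    (hS : IsSubmanifoldWithCorners d S) {p : Euc n} (hp : p ∈ closure S) :
    ∃ C : CornerChart d S, p ∈ C.W := by
  obtain ⟨Φ, k, hk, hpΦ, hΦ, hΦs, hSΦ⟩ := hS p hp
  let ι : (Fin d → ℝ) → Euc n := fun y =>
    WithLp.toLp 2 fun i => if h : (i : ℕ) < d then y ⟨i, h⟩ else 0
  let r : Euc n → (Fin d → ℝ) := fun x i => x (Fin.castLE hd i)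
  have hι : ContDiff ℝ ∞ ι := by
    refine (PiLp.contDiff_toLp (𝕜 := ℝ)).comp (contDiff_pi.2 fun i => ?_)
    by_cases h : (i : ℕ) < d
    · simp only [h, dite_true]; fun_prop
    · simp only [h, dite_false]; fun_prop
  have hr : ContDiff ℝ ∞ r := by
    refine contDiff_pi.2 fun i => ?_
    fun_prop
  have hrι : ∀ y, r (ι y) = y := fun y => by
    ext i
    simp [r, ι]
  have hι1 : ∀ y (j : Fin d), ι y (Fin.castLE hd j) = y j := fun y j => congrFun (hrι y) j
  have hι2 : ∀ y (j : Fin n), d ≤ (j : ℕ) → ι y j = 0 := fun y j hj => by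
    simp [ι, not_lt.2 hj]
  have hmem : ∀ x ∈ Φ.source, x ∈ S ↔
      (∀ j : Fin n, (j : ℕ) < k → 0 < Φ x j) ∧ ∀ j : Fin n, d ≤ (j : ℕ) → Φ x j = 0 := by
    intro x hx
    have := Set.ext_iff.1 hSΦ x
    simp only [mem_inter_iff, mem_ofPred_eq, hx, and_true, true_and] at this
    exact this
  have hclos : ∀ x ∈ closure S ∩ Φ.source,
      (∀ j : Fin n, (j : ℕ) < k → 0 ≤ Φ x j) ∧ ∀ j : Fin n, d ≤ (j : ℕ) → Φ x j = 0 := by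
    rintro x ⟨hx, hxs⟩
    have hne : (𝓝[S ∩ Φ.source] x).NeBot := by
      have : x ∈ closure (S ∩ Φ.source) :=
        Φ.open_source.inter_closure.trans (by rw [inter_comm]) ⟨hxs, hx⟩
      exact mem_closure_iff_nhdsWithin_neBot.1 this
    have ht : ∀ j, Tendsto (fun z => Φ z j) (𝓝[S ∩ Φ.source] x) (𝓝 (Φ x j)) := fun j =>
      (((EuclideanSpace.proj j : Euc n →L[ℝ] ℝ).continuous.tendsto _).comp
        (Φ.continuousAt hxs)).mono_left nhdsWithin_le_nhds
    constructor
    · intro j hj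
      refine ge_of_tendsto (ht j) ?_
      filter_upwards [self_mem_nhdsWithin] with z hz
      exact (((hmem z hz.2).1 hz.1).1 j hj).le
    · intro j hj
      refine tendsto_nhds_unique (ht j) (tendsto_const_nhds.congr' ?_)
      filter_upwards [self_mem_nhdsWithin] with z hz
      exact (((hmem z hz.2).1 hz.1).2 j hj).symm
  have hιr : ∀ x ∈ closure S ∩ Φ.source, ι (r (Φ x)) = Φ x := by
    intro x hx
    ext j
    by_cases hj : (j : ℕ) < d
    · simp [ι, r, hj]
    · rw [hι2 _ _ (not_lt.1 hj), (hclos x hx).2 j (not_lt.1 hj)]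
  have hUo : IsOpen (ι ⁻¹' Φ.target) := Φ.open_target.preimage hι.continuous
  have hψ : ContDiffOn ℝ ∞ (Φ.symm ∘ ι) (ι ⁻¹' Φ.target) :=
    hΦs.comp hι.contDiffOn fun y hy => hy
  have hψS : ∀ y ∈ ι ⁻¹' Φ.target, (Φ.symm ∘ ι) y ∈ S ↔ ∀ j : Fin d, (j : ℕ) < k → 0 < y j := by
    intro y hy
    refine (hmem _ (Φ.map_target hy)).trans ?_
    rw [Φ.right_inv hy]
    constructor
    · intro h j hj
      have := h.1 (Fin.castLE hd j) hj
      rwa [hι1] at this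
    · refine fun h => ⟨fun j hj => ?_, hι2 y⟩
      have := h ⟨j, hj.trans_le hk⟩ hj
      rw [← hι1 y] at this
      exact this
  refine ⟨⟨k, Φ.source, ι ⁻¹' Φ.target, Φ.symm ∘ ι, r ∘ Φ, Φ.open_source, hUo, hψ,
    hr.comp_contDiffOn hΦ, fun y hy => Φ.map_target hy, fun y hy => ?_, fun x hx => ?_,
    fun x hx => ?_, hψS, fun y hy => ⟨fun h j hj => ?_, fun h => ?_⟩⟩, hpΦ⟩
  · simp only [Function.comp_apply]
    rw [Φ.right_inv hy, hrι]
  · simp only [Function.comp_apply, mem_preimage]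
    rw [hιr x hx]
    exact Φ.map_source hx.2
  · simp only [Function.comp_apply]
    rw [hιr x hx, Φ.left_inv hx.2]
  · have := (hclos _ ⟨h, Φ.map_target hy⟩).1 (Fin.castLE hd j) hj
    rwa [Function.comp_apply, Φ.right_inv hy, hι1] at this
  -- Conversely, a point with weak inequalities is the limit of points moved along `(1, …, 1)`, for
  -- which the inequalities are strict.
  · have hc : Continuous fun t : ℝ => y + t • (1 : Fin d → ℝ) := by fun_prop
    have ht : Tendsto (fun t : ℝ => y + t • (1 : Fin d → ℝ)) (𝓝[>] 0) (𝓝 y) := by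
      simpa using (hc.tendsto 0).mono_left nhdsWithin_le_nhds
    refine mem_closure_of_tendsto ((hψ.continuousOn.continuousAt (hUo.mem_nhds hy)).tendsto.comp ht)
      ?_
    filter_upwards [ht.eventually_mem (hUo.mem_nhds hy), self_mem_nhdsWithin] with t htU ht0
    refine (hψS _ htU).2 fun j hj => ?_
    have := h j hj
    have : (0 : ℝ) < t := ht0
    simp only [Pi.add_apply, Pi.smul_apply, Pi.one_apply, smul_eq_mul, mul_one]
    linarith

/-- The difference quotients of `t ↦ ψ (y + t v)` for `t ↓ 0` exhibit `A v` as a tangent vector.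
Only small positive `t` matter, so the lemma applies at corners. -/
theorem map_mem_posTangentConeAt {d : ℕ} {ψ : (Fin d → ℝ) → Euc n}
    {A : (Fin d → ℝ) →L[ℝ] Euc n} {y v : Fin d → ℝ} {s : Set (Euc n)} (hψ : HasFDerivAt ψ A y)
    (h : ∀ᶠ t : ℝ in 𝓝[>] 0, ψ (y + t • v) ∈ s) : A v ∈ posTangentConeAt s (ψ y) := by
  have hl : HasDerivAt (fun t : ℝ => ψ (y + t • v)) (A v) 0 := by
    have h1 : HasDerivAt (fun t : ℝ => y + t • v) v 0 := by
      simpa using ((hasDerivAt_id (0 : ℝ)).smul_const v).const_add y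
    refine HasFDerivAt.comp_hasDerivAt (0 : ℝ) ?_ h1
    simpa using hψ
  refine mem_tangentConeAt_of_seq (𝓝[>] (0 : ℝ)) (fun t => (t⁻¹).toNNReal)
    (fun t => ψ (y + t • v) - ψ y) ?_ ?_ ?_
  · have := hl.continuousAt.tendsto.mono_left (nhdsWithin_le_nhds (s := Ioi 0))
    simpa using this.sub_const (ψ y)
  · simpa using h
  · have h2 := hl.tendsto_slope.mono_left (nhdsGT_le_nhdsNE 0)
    refine h2.congr' ?_
    filter_upwards [self_mem_nhdsWithin] with t ht
    have : (0 : ℝ) < t := ht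
    simp [slope_def_module, NNReal.smul_def, Real.coe_toNNReal _ (inv_pos.2 this).le]

theorem posTangentConeAt_subset_tangentConeAt (s : Set (Euc n)) (x : Euc n) :
    posTangentConeAt s x ⊆ tangentConeAt ℝ s x := fun _ h => tangentConeAt_mono_field h

namespace CornerChart

variable {d : ℕ} {S : Set (Euc n)} (C : CornerChart d S)

/-- The derivative of the parametrization. -/
abbrev dψ (y : Fin d → ℝ) : (Fin d → ℝ) →L[ℝ] Euc n := fderiv ℝ C.ψ y

/-- The derivative of the coordinates. -/
abbrev dπ (x : Euc n) : Euc n →L[ℝ] (Fin d → ℝ) := fderiv ℝ C.π x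

/-- The parameters of the points of `S`. -/
def openCorner : Set (Fin d → ℝ) := {y ∈ C.U | ∀ j : Fin d, (j : ℕ) < C.k → 0 < y j}

/-- The parameters of the points of the closure of `S`. -/
def closedCorner : Set (Fin d → ℝ) := {y ∈ C.U | ∀ j : Fin d, (j : ℕ) < C.k → 0 ≤ y j}

theorem openCorner_subset : C.openCorner ⊆ C.closedCorner :=
  fun _ hy => ⟨hy.1, fun j hj => (hy.2 j hj).le⟩

theorem hasFDerivAt_ψ {y : Fin d → ℝ} (hy : y ∈ C.U) : HasFDerivAt C.ψ (C.dψ y) y :=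
  ((C.contDiffOn_ψ.contDiffAt (C.isOpen_U.mem_nhds hy)).differentiableAt (by simp)).hasFDerivAt

theorem hasFDerivAt_π {x : Euc n} (hx : x ∈ C.W) : HasFDerivAt C.π (C.dπ x) x :=
  ((C.contDiffOn_π.contDiffAt (C.isOpen_W.mem_nhds hx)).differentiableAt (by simp)).hasFDerivAt

theorem dπ_dψ {y : Fin d → ℝ} (hy : y ∈ C.U) (v : Fin d → ℝ) :
    C.dπ (C.ψ y) (C.dψ y v) = v := by
  have h1 := (C.hasFDerivAt_π (C.ψ_mem_W y hy)).comp y (C.hasFDerivAt_ψ hy)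
  have h2 : HasFDerivAt (C.π ∘ C.ψ) (ContinuousLinearMap.id ℝ (Fin d → ℝ)) y := by
    refine (hasFDerivAt_id y).congr_of_eventuallyEq ?_
    filter_upwards [C.isOpen_U.mem_nhds hy] with z hz using C.π_ψ z hz
  exact DFunLike.congr_fun (h1.unique h2) v

theorem dψ_injective {y : Fin d → ℝ} (hy : y ∈ C.U) : Function.Injective (C.dψ y) :=
  Function.LeftInverse.injective (g := C.dπ (C.ψ y)) fun v => C.dπ_dψ hy v

theorem injOn_ψ : InjOn C.ψ C.U := fun y hy z hz h => by
  rw [← C.π_ψ y hy, ← C.π_ψ z hz, h]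

theorem contDiffOn_dψ : ContDiffOn ℝ ∞ C.dψ C.U :=
  C.contDiffOn_ψ.fderiv_of_isOpen C.isOpen_U (by simp)

theorem contDiffOn_ψ_one : ContDiffOn ℝ 1 C.ψ C.U :=
  C.contDiffOn_ψ.of_le (by simp)

theorem image_openCorner : C.ψ '' C.openCorner = S ∩ C.W := by
  ext x
  constructor
  · rintro ⟨y, hy, rfl⟩
    exact ⟨(C.ψ_mem_iff y hy.1).2 hy.2, C.ψ_mem_W y hy.1⟩
  · intro hx
    have hx' : x ∈ closure S ∩ C.W := ⟨subset_closure hx.1, hx.2⟩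
    have hU := C.π_mem_U x hx'
    refine ⟨C.π x, ⟨hU, (C.ψ_mem_iff _ hU).1 ?_⟩, C.ψ_π x hx'⟩
    rw [C.ψ_π x hx']
    exact hx.1

/-- Tangent vectors to the closure of `S` are of the form `Dψ (Dπ v)`. -/
theorem dψ_dπ_of_mem_tangentConeAt {y : Fin d → ℝ} (hy : y ∈ C.closedCorner) {v : Euc n}
    (hv : v ∈ tangentConeAt ℝ (closure S) (C.ψ y)) : C.dψ y (C.dπ (C.ψ y) v) = v := by
  have hW := C.isOpen_W.mem_nhds (C.ψ_mem_W y hy.1)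
  have hcl := (C.ψ_mem_closure_iff y hy.1).2 hy.2
  rw [← tangentConeAt_inter_nhds hW] at hv
  have h1 : HasFDerivAt (C.ψ ∘ C.π) (C.dψ y ∘L C.dπ (C.ψ y)) (C.ψ y) := by
    refine HasFDerivAt.comp _ ?_ (C.hasFDerivAt_π (C.ψ_mem_W y hy.1))
    rw [C.π_ψ y hy.1]
    exact C.hasFDerivAt_ψ hy.1
  have h2 : HasFDerivWithinAt (C.ψ ∘ C.π) (ContinuousLinearMap.id ℝ (Euc n)) (closure S ∩ C.W)
      (C.ψ y) :=
    (hasFDerivWithinAt_id _ _).congr (fun x hx => C.ψ_π x hx)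
      (C.ψ_π _ ⟨hcl, C.ψ_mem_W y hy.1⟩)
  -- `ψ ∘ π` is the identity on the closure of `S` inside `W`, and two derivatives within a set
  -- agree on its tangent cone.
  exact h1.hasFDerivWithinAt.unique_on h2 hv

theorem add_smul_mem_U {y : Fin d → ℝ} (hy : y ∈ C.U) (v : Fin d → ℝ) :
    ∀ᶠ t : ℝ in 𝓝[>] 0, y + t • v ∈ C.U := by
  have hc : Continuous fun t : ℝ => y + t • v := by fun_prop
  have ht : Tendsto (fun t : ℝ => y + t • v) (𝓝[>] 0) (𝓝 y) := by
    simpa using (hc.tendsto 0).mono_left nhdsWithin_le_nhds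
  exact ht.eventually_mem (C.isOpen_U.mem_nhds hy)

/-- The tangent space is a linear span, so for the range to be contained in it the directions `+e_i`
suffice; moving along them never leaves the closed corner, even at boundary points. -/
theorem tangentSpaceAt_eq {y : Fin d → ℝ} (hy : y ∈ C.closedCorner) :
    tangentSpaceAt S (C.ψ y) = LinearMap.range (C.dψ y).toLinearMap := by
  unfold tangentSpaceAt
  rw [← tangentConeAt_closure]
  apply le_antisymm
  · refine Submodule.span_le.2 fun v hv => ?_
    exact ⟨_, C.dψ_dπ_of_mem_tangentConeAt hy hv⟩
  · rintro _ ⟨b, rfl⟩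
    simp only [ContinuousLinearMap.coe_coe]
    rw [map_eq_sum_single b]
    refine Submodule.sum_mem _ fun i _ => Submodule.smul_mem _ _ (Submodule.subset_span ?_)
    refine posTangentConeAt_subset_tangentConeAt _ _
      (map_mem_posTangentConeAt (C.hasFDerivAt_ψ hy.1) ?_)
    filter_upwards [C.add_smul_mem_U hy.1 (Pi.single i 1), self_mem_nhdsWithin] with t htU ht
    refine (C.ψ_mem_closure_iff _ htU).2 fun j hj => ?_
    have := hy.2 j hj
    have ht : (0 : ℝ) < t := ht
    simp only [Pi.add_apply, Pi.smul_apply, smul_eq_mul, Pi.single_apply]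
    split_ifs <;> linarith

theorem tangentProj_eq {y : Fin d → ℝ} (hy : y ∈ C.closedCorner) (v : Euc n) :
    tangentProj S (C.ψ y) v = C.dψ y (pinv (C.dψ y) v) :=
  starProjection_eq_of_eq_range (C.dψ_injective hy.1) (C.tangentSpaceAt_eq hy) v

end CornerChart

/-! ### Regular boundary points and the exterior normal in a chart -/

namespace CornerChart

variable {m : ℕ} {S : Set (Euc n)} (C : CornerChart (m + 1) S) {j : Fin (m + 1)}

/-- The parameters of the regular boundary points on the face `y_j = 0`. -/
def face (j : Fin (m + 1)) : Set (Fin m → ℝ) :=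
  {z | faceIncl j z ∈ C.U ∧ ∀ i : Fin m, (j.succAbove i : ℕ) < C.k → 0 < z i}

theorem faceIncl_mem_closedCorner {z : Fin m → ℝ} (hz : z ∈ C.face j) :
    faceIncl j z ∈ C.closedCorner := by
  refine ⟨hz.1, fun l => ?_⟩
  refine Fin.succAboveCases j ?_ (fun i => ?_) l
  · intro _
    simp
  · intro hi
    simpa using (hz.2 i hi).le

theorem ψ_mem_bdry_iff {y : Fin (m + 1) → ℝ} (hy : y ∈ C.U) :
    C.ψ y ∈ bdry S ↔ y ∈ C.closedCorner ∧ ∃ l : Fin (m + 1), (l : ℕ) < C.k ∧ y l = 0 := by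
  rw [bdry, Set.mem_sdiff, C.ψ_mem_closure_iff y hy, C.ψ_mem_iff y hy]
  constructor
  · rintro ⟨h1, h2⟩
    push Not at h2
    obtain ⟨l, hl, hl'⟩ := h2
    exact ⟨⟨hy, h1⟩, l, hl, le_antisymm hl' (h1 l hl)⟩
  · rintro ⟨h1, l, hl, hl'⟩
    exact ⟨h1.2, fun h => (h l hl).ne' hl'⟩

variable (hj : (j : ℕ) < C.k)
include hj

theorem ψ_faceIncl_mem_bdry {z : Fin m → ℝ} (hz : z ∈ C.face j) :
    C.ψ (faceIncl j z) ∈ bdry S :=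
  (C.ψ_mem_bdry_iff hz.1).2 ⟨C.faceIncl_mem_closedCorner hz, j, hj, by simp⟩

/-- The curves along `e_i`, `i ≠ j`, stay in the face and the curve along `e_j` enters `S`; tested
with them, any exterior normal satisfies the hypotheses of `jac_comp_faceIncl_mul_inner`. Hence the
choice in `exteriorNormal` does not matter. -/
theorem jac_mul_inner_of_isExteriorNormal {z : Fin m → ℝ} (hz : z ∈ C.face j) {ν : Euc n}
    (hν : IsExteriorNormal S (C.ψ (faceIncl j z)) ν) (b : Fin (m + 1) → ℝ) :
    jac (C.dψ (faceIncl j z) ∘L faceIncl j) * ⟪ν, C.dψ (faceIncl j z) b⟫ =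
      -(jac (C.dψ (faceIncl j z)) * b j) := by
  have hzU := hz.1
  refine jac_comp_faceIncl_mul_inner (C.dψ_injective hzU) hν.1
    (by rw [← C.tangentSpaceAt_eq (C.faceIncl_mem_closedCorner hz)]; exact hν.2.1) ?_ ?_ b
  · intro i
    refine hν.2.2.1 _ (posTangentConeAt_subset_tangentConeAt _ _
      (map_mem_posTangentConeAt (C.hasFDerivAt_ψ hzU) ?_))
    filter_upwards [C.add_smul_mem_U hzU (Pi.single (j.succAbove i) 1), self_mem_nhdsWithin]
      with t htU ht
    rw [← faceIncl_single, ← map_smul, ← map_add] at htU ⊢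
    refine C.ψ_faceIncl_mem_bdry hj ⟨htU, fun l hl => ?_⟩
    have := hz.2 l hl
    have ht : (0 : ℝ) < t := ht
    simp only [Pi.add_apply, Pi.smul_apply, smul_eq_mul, Pi.single_apply]
    split_ifs <;> linarith
  · refine hν.2.2.2 _ (map_mem_posTangentConeAt (C.hasFDerivAt_ψ hzU) ?_)
    filter_upwards [C.add_smul_mem_U hzU (Pi.single j 1), self_mem_nhdsWithin] with t htU ht
    refine (C.ψ_mem_iff _ htU).2 fun l => ?_
    have ht : (0 : ℝ) < t := ht
    refine Fin.succAboveCases j ?_ (fun i => ?_) l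
    · intro _
      simpa using ht
    · intro hi
      simpa using hz.2 i hi

/-- The vector of `exists_unit_normal` acts on a tangent vector as a nonpositive multiple of its
`j`-th coordinate, so only the differential of `π_j` has to be understood: it vanishes on the
tangents of the boundary, because `π_j = 0` there near a regular point, and it is nonnegative on the
cone of `S`, because `π_j > 0` on `S`. Without existence the field `exteriorNormal` would be zero.
-/
theorem exists_isExteriorNormal {z : Fin m → ℝ} (hz : z ∈ C.face j) :
    ∃ ν, IsExteriorNormal S (C.ψ (faceIncl j z)) ν := by
  have hzU := hz.1
  have hcl := C.faceIncl_mem_closedCorner hz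
  obtain ⟨ν, h1, h2, c, hc, h3⟩ := exists_unit_normal j (C.dψ_injective hzU)
  have hπj : HasFDerivAt (fun x => C.π x j)
      ((ContinuousLinearMap.proj j : (Fin (m + 1) → ℝ) →L[ℝ] ℝ) ∘L C.dπ (C.ψ (faceIncl j z)))
      (C.ψ (faceIncl j z)) :=
    (ContinuousLinearMap.proj (R := ℝ) (φ := fun _ => ℝ) j).hasFDerivAt.comp _
      (C.hasFDerivAt_π (C.ψ_mem_W _ hzU))
  have hπ0 : C.π (C.ψ (faceIncl j z)) j = 0 := by rw [C.π_ψ _ hzU]; simp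
  have hπc : ContinuousAt C.π (C.ψ (faceIncl j z)) :=
    (C.hasFDerivAt_π (C.ψ_mem_W _ hzU)).continuousAt
  refine ⟨ν, h1, by rw [C.tangentSpaceAt_eq hcl]; exact h2, fun v hv => ?_, fun v hv => ?_⟩
  · have hv' : v ∈ tangentConeAt ℝ (closure S) (C.ψ (faceIncl j z)) :=
      tangentConeAt_mono sdiff_subset hv
    rw [← C.dψ_dπ_of_mem_tangentConeAt hcl hv', h3]
    -- near a regular point of the face the coordinate `π_j` vanishes on the boundary
    have hev : ∀ᶠ x in 𝓝[bdry S] C.ψ (faceIncl j z), C.π x j = 0 := by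
      have e1 : ∀ᶠ x in 𝓝 (C.ψ (faceIncl j z)),
          x ∈ C.W ∧ ∀ i : Fin m, (j.succAbove i : ℕ) < C.k → 0 < C.π x (j.succAbove i) := by
        refine (C.isOpen_W.eventually_mem (C.ψ_mem_W _ hzU)).and (eventually_all.2 fun i => ?_)
        by_cases hi : (j.succAbove i : ℕ) < C.k
        · have hlt : 0 < C.π (C.ψ (faceIncl j z)) (j.succAbove i) := by
            rw [C.π_ψ _ hzU]
            simpa using hz.2 i hi
          have := ((continuous_apply (j.succAbove i)).continuousAt.comp hπc).eventually_const_lt hlt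
          filter_upwards [this] with x hx _ using hx
        · exact Eventually.of_forall fun x h => absurd h hi
      filter_upwards [nhdsWithin_le_nhds e1, self_mem_nhdsWithin] with x hx hxb
      have hxW : x ∈ closure S ∩ C.W := ⟨hxb.1, hx.1⟩
      rw [← C.ψ_π x hxW] at hxb
      obtain ⟨-, l, hl, hl0⟩ := (C.ψ_mem_bdry_iff (C.π_mem_U x hxW)).1 hxb
      rcases Fin.eq_self_or_eq_succAbove j l with rfl | ⟨i, rfl⟩
      · exact hl0
      · exact absurd hl0 (hx.2 i hl).ne'
    have h0 : HasFDerivWithinAt (fun x => C.π x j) (0 : Euc n →L[ℝ] ℝ) (bdry S)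
        (C.ψ (faceIncl j z)) :=
      (hasFDerivWithinAt_const (0 : ℝ) _ _).congr_of_eventuallyEq hev hπ0
    have := hπj.hasFDerivWithinAt.unique_on h0 hv
    have e : C.dπ (C.ψ (faceIncl j z)) v j = 0 := this
    rw [e, mul_zero]
  · have hv' : v ∈ tangentConeAt ℝ (closure S) (C.ψ (faceIncl j z)) :=
      tangentConeAt_mono subset_closure (posTangentConeAt_subset_tangentConeAt _ _ hv)
    rw [← C.dψ_dπ_of_mem_tangentConeAt hcl hv', h3]
    have hmax : IsLocalMaxOn (fun x => -C.π x j) S (C.ψ (faceIncl j z)) := by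
      filter_upwards [nhdsWithin_le_nhds (C.isOpen_W.mem_nhds (C.ψ_mem_W _ hzU)),
        self_mem_nhdsWithin] with x hxW hxS
      have hx : x ∈ closure S ∩ C.W := ⟨subset_closure hxS, hxW⟩
      rw [hπ0, neg_zero, neg_nonpos]
      rw [← C.ψ_π x hx] at hxS
      exact ((C.ψ_mem_iff _ (C.π_mem_U x hx)).1 hxS j hj).le
    have := hmax.hasFDerivWithinAt_nonpos hπj.neg.hasFDerivWithinAt hv
    have e : -(C.dπ (C.ψ (faceIncl j z)) v j) ≤ 0 := this
    exact mul_nonpos_of_nonpos_of_nonneg hc (by linarith)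

/-- The normal component of a tangential vector in coordinates. -/
theorem jac_mul_inner_exteriorNormal {z : Fin m → ℝ} (hz : z ∈ C.face j)
    (b : Fin (m + 1) → ℝ) :
    jac (C.dψ (faceIncl j z) ∘L faceIncl j) *
      ⟪exteriorNormal S (C.ψ (faceIncl j z)), C.dψ (faceIncl j z) b⟫ =
      -(jac (C.dψ (faceIncl j z)) * b j) := by
  have h := C.exists_isExteriorNormal hj hz
  rw [exteriorNormal, dif_pos h]
  exact C.jac_mul_inner_of_isExteriorNormal hj hz h.choose_spec b

end CornerChart

/-! ### The divergence theorem on a corner -/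

/-- The divergence theorem on the part of the corner `(0, ∞)ᵏ × ℝᵈ⁻ᵏ` in `U`, for a vector field
that vanishes near the points of the corner outside of a compact subset of `U`. -/
theorem integral_divergence_corner {m : ℕ} (k : ℕ) {U K : Set (Fin (m + 1) → ℝ)} (hU : IsOpen U)
    (hK : IsCompact K) (hKU : K ⊆ U) {F : (Fin (m + 1) → ℝ) → Fin (m + 1) → ℝ}
    (hF : ContDiffOn ℝ 1 F U)
    (h0 : ∀ y ∈ U, (∀ j : Fin (m + 1), (j : ℕ) < k → 0 ≤ y j) → y ∉ K → F =ᶠ[𝓝 y] 0) :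
    ∫ y in {y ∈ U | ∀ j : Fin (m + 1), (j : ℕ) < k → 0 < y j},
      ∑ i, fderiv ℝ F y (Pi.single i 1) i =
    -∑ j ∈ Finset.univ.filter fun j : Fin (m + 1) => (j : ℕ) < k,
      ∫ z in {z : Fin m → ℝ | faceIncl j z ∈ U ∧ ∀ i : Fin m, (j.succAbove i : ℕ) < k → 0 < z i},
        F (faceIncl j z) j := by
  classical
  obtain ⟨R, hR0, hR⟩ : ∃ R : ℝ, 0 < R ∧ ∀ y ∈ K, ∀ i, |y i| < R := by
    obtain ⟨R, hR⟩ := hK.isBounded.exists_norm_le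
    refine ⟨max R 0 + 1, by positivity, fun y hy i => ?_⟩
    have h1 := norm_le_pi_norm y i
    have h2 := hR y hy
    have h3 := le_max_left R 0
    rw [Real.norm_eq_abs] at h1
    linarith
  let Q : Set (Fin (m + 1) → ℝ) := {y | ∀ j : Fin (m + 1), (j : ℕ) < k → 0 ≤ y j}
  -- The box starts at the true face in the corner directions, and at `-R`, beyond `K`, in the free
  -- directions.
  let a : Fin (m + 1) → ℝ := fun j => if (j : ℕ) < k then 0 else -R
  let b : Fin (m + 1) → ℝ := fun _ => R
  let H : (Fin (m + 1) → ℝ) → Fin (m + 1) → ℝ := U.indicator F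
  let H' : (Fin (m + 1) → ℝ) → (Fin (m + 1) → ℝ) →L[ℝ] (Fin (m + 1) → ℝ) :=
    U.indicator (fderiv ℝ F)
  have ha : ∀ j : Fin (m + 1), (j : ℕ) < k → a j = 0 := fun j hj => by simp [a, hj]
  have ha' : ∀ j : Fin (m + 1), -R ≤ a j := fun j => by
    simp only [a]; split_ifs <;> linarith
  have ha'' : ∀ j : Fin (m + 1), ¬(j : ℕ) < k → a j = -R := fun j hj => by simp [a, hj]
  have hab : a ≤ b := fun j => by
    simp only [a, b]; split_ifs <;> linarith
  have hH0 : ∀ y ∈ Q, y ∉ K → H y = 0 := fun y hy hyK => by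
    by_cases hyU : y ∈ U
    · simp only [H, indicator_of_mem hyU]
      exact (h0 y hyU hy hyK).self_of_nhds
    · simp [H, hyU]
  have hH'0 : ∀ y ∈ Q, y ∉ K → H' y = 0 := fun y hy hyK => by
    by_cases hyU : y ∈ U
    · simp only [H', indicator_of_mem hyU]
      rw [(h0 y hyU hy hyK).fderiv_eq]
      simp
    · simp [H', hyU]
  -- The extension by zero may jump at boundary points of `U` outside of the closed corner `Q`.
  -- Within `Q` it is continuous: near a point off the compact set `K ⊆ U` it vanishes.
  have hcont : ∀ {E : Type} [NormedAddCommGroup E] (G : (Fin (m + 1) → ℝ) → E),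
      ContinuousOn G U → (∀ y ∈ Q, y ∉ K → U.indicator G y = 0) →
      ContinuousOn (U.indicator G) Q := by
    intro E _ G hG hG0 y hy
    by_cases hyK : y ∈ K
    · have hyU := hKU hyK
      refine ContinuousAt.continuousWithinAt ?_
      refine (hG.continuousAt (hU.mem_nhds hyU)).congr ?_
      filter_upwards [hU.mem_nhds hyU] with z hz using (indicator_of_mem hz _).symm
    · have : U.indicator G =ᶠ[𝓝[Q] y] fun _ => 0 := by
        filter_upwards [nhdsWithin_le_nhds (hK.isClosed.isOpen_compl.mem_nhds hyK),
          self_mem_nhdsWithin] with z hz hzQ using hG0 z hzQ hz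
      exact continuousWithinAt_const.congr_of_eventuallyEq this (hG0 y hy hyK)
  have hHc : ContinuousOn H Q := hcont F hF.continuousOn hH0
  have hH'c : ContinuousOn H' Q := hcont _ (hF.continuousOn_fderiv_of_isOpen hU le_rfl) hH'0
  have hIccQ : Icc a b ⊆ Q := fun y hy j hj => by
    have := hy.1 j
    rwa [ha j hj] at this
  have hQo : ∀ y ∈ pi univ fun i => Ioo (a i) (b i), Q ∈ 𝓝 y := by
    intro y hy
    have : (pi univ fun i => Ioo (a i) (b i)) ⊆ Q := fun z hz =>
      hIccQ ⟨fun j => (hz j trivial).1.le, fun j => (hz j trivial).2.le⟩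
    exact mem_of_superset ((isOpen_set_pi finite_univ fun i _ => isOpen_Ioo).mem_nhds hy) this
  have hdiv := integral_divergence_of_hasFDerivAt_off_countable a b hab H H' ∅ countable_empty
    (hHc.mono hIccQ) (fun y hy => ?_) ?_
  · -- the volume integral
    have hL : ∫ y in {y ∈ U | ∀ j : Fin (m + 1), (j : ℕ) < k → 0 < y j},
        ∑ i, fderiv ℝ F y (Pi.single i 1) i = ∫ y in Icc a b, ∑ i, H' y (Pi.single i 1) i := by
      let P : Set (Fin (m + 1) → ℝ) := {y | ∀ j : Fin (m + 1), (j : ℕ) < k → 0 < y j}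
      have hPm : MeasurableSet P := by
        have : P = ⋂ j : Fin (m + 1), {y | (j : ℕ) < k → 0 < y j} := by
          ext; simp [P]
        rw [this]
        refine MeasurableSet.iInter fun j => ?_
        by_cases hj : (j : ℕ) < k
        · simpa [hj] using measurableSet_lt measurable_const (measurable_pi_apply j)
        · simp [hj]
      have e1 : {y ∈ U | ∀ j : Fin (m + 1), (j : ℕ) < k → 0 < y j} = P ∩ U := by
        ext; simp [P, and_comm]
      rw [e1, ← setIntegral_indicator hU.measurableSet]
      have e2 : U.indicator (fun y => ∑ i, fderiv ℝ F y (Pi.single i 1) i) =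
          fun y => ∑ i, H' y (Pi.single i 1) i := by
        ext y
        by_cases hy : y ∈ U <;> simp [H', hy]
      have hae : (pi univ fun i => Ioo (a i) (b i)) =ᵐ[volume] Icc a b :=
        Measure.univ_pi_Ioo_ae_eq_Icc
      rw [e2, ← setIntegral_congr_set hae]
      refine setIntegral_eq_of_subset_of_forall_sdiff_eq_zero hPm ?_ ?_
      · intro y hy j hj
        have := (hy j trivial).1
        rwa [ha j hj] at this
      · rintro y ⟨hyP, hy⟩
        -- A point of `K` with positive corner coordinates would lie in the open box, so the part of
        -- the corner outside of the box does not contribute.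
        have : y ∉ K := fun hyK => hy fun j _ => by
          have hj := abs_lt.1 (hR y hyK j)
          refine ⟨?_, hj.2⟩
          by_cases hjk : (j : ℕ) < k
          · rw [ha j hjk]; exact hyP j hjk
          · rw [ha'' j hjk]; exact hj.1
        rw [hH'0 y (fun j hj => (hyP j hj).le) this]
        simp
    rw [hL, hdiv, ← Finset.sum_neg_distrib, Finset.sum_filter]
    refine Finset.sum_congr rfl fun j _ => ?_
    have hins : ∀ c, |c| ≤ R → (((j : ℕ) < k) → 0 ≤ c) →
        ∀ z ∈ Icc (a ∘ j.succAbove) (b ∘ j.succAbove), j.insertNth c z ∈ Q := by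
      intro c hc hc0 z hz l
      refine Fin.succAboveCases j ?_ (fun i => ?_) l
      · intro hj; simpa using hc0 hj
      · intro hi
        have := hz.1 i
        simp only [Function.comp_apply, ha _ hi] at this
        simpa using this
    -- `K` lies strictly inside `|y_i| < R`, so the artificial faces at `±R` carry no flux. Only the
    -- lower faces `y_j = 0` with `j < k` remain, with a minus sign.
    have hz0 : ∀ c, |c| = R → (((j : ℕ) < k) → 0 ≤ c) →
        ∫ z in Icc (a ∘ j.succAbove) (b ∘ j.succAbove), H (j.insertNth c z) j = 0 := by
      intro c hc hc0
      refine setIntegral_eq_zero_of_forall_eq_zero fun z hz => ?_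
      rw [hH0 _ (hins c hc.le hc0 z hz) fun hmem => ?_]
      · rfl
      · have := hR _ hmem j
        rw [Fin.insertNth_apply_same, hc] at this
        exact lt_irrefl _ this
    rw [hz0 (b j) (abs_of_pos hR0) fun _ => hR0.le, zero_sub]
    split_ifs with hj
    · rw [ha j hj]
      congr 1
      let P : Set (Fin m → ℝ) := {z | ∀ i : Fin m, (j.succAbove i : ℕ) < k → 0 < z i}
      have hPm : MeasurableSet P := by
        have : P = ⋂ i : Fin m, {z | (j.succAbove i : ℕ) < k → 0 < z i} := by
          ext; simp [P]
        rw [this]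
        refine MeasurableSet.iInter fun i => ?_
        by_cases hi : (j.succAbove i : ℕ) < k
        · simpa [hi] using measurableSet_lt measurable_const (measurable_pi_apply i)
        · simp [hi]
      have e1 : {z : Fin m → ℝ | faceIncl j z ∈ U ∧
          ∀ i : Fin m, (j.succAbove i : ℕ) < k → 0 < z i} = P ∩ faceIncl j ⁻¹' U := by
        ext; simp [P, and_comm]
      have hUj : MeasurableSet (faceIncl j ⁻¹' U) :=
        (hU.preimage (faceIncl j).continuous).measurableSet
      rw [e1, ← setIntegral_indicator hUj]
      have e2 : (faceIncl j ⁻¹' U).indicator (fun z => F (faceIncl j z) j) =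
          fun z => H (faceIncl j z) j := by
        ext z
        by_cases hz : faceIncl j z ∈ U <;> simp [H, hz]
      have hae : (pi univ fun i => Ioo ((a ∘ j.succAbove) i) ((b ∘ j.succAbove) i)) =ᵐ[volume]
          Icc (a ∘ j.succAbove) (b ∘ j.succAbove) := Measure.univ_pi_Ioo_ae_eq_Icc
      rw [e2, ← setIntegral_congr_set hae]
      symm
      refine setIntegral_eq_of_subset_of_forall_sdiff_eq_zero hPm ?_ ?_
      · intro z hz i hi
        have := (hz i trivial).1
        simpa only [Function.comp_apply, ha _ hi] using this
      · rintro z ⟨hzP, hz⟩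
        have : faceIncl j z ∉ K := fun hzK => hz fun i _ => by
          have hi := abs_lt.1 (hR _ hzK (j.succAbove i))
          rw [faceIncl_apply_succAbove] at hi
          refine ⟨?_, hi.2⟩
          by_cases hik : (j.succAbove i : ℕ) < k
          · rw [Function.comp_apply, ha _ hik]; exact hzP i hik
          · rw [Function.comp_apply, ha'' _ hik]; exact hi.1
        rw [hH0 _ (fun l => ?_) this]
        · rfl
        · refine Fin.succAboveCases j ?_ (fun i => ?_) l
          · intro _; simp
          · intro hi; simpa using (hzP i hi).le
    · rw [ha'' j hj, hz0 (-R) (by rw [abs_neg, abs_of_pos hR0]) fun h => absurd h hj, neg_zero]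
  · have hy' := hy.1
    by_cases hyU : y ∈ U
    · have h1 : HasFDerivAt F (fderiv ℝ F y) y :=
        ((hF.contDiffAt (hU.mem_nhds hyU)).differentiableAt one_ne_zero).hasFDerivAt
      simp only [H', indicator_of_mem hyU]
      refine h1.congr_of_eventuallyEq ?_
      filter_upwards [hU.mem_nhds hyU] with z hz using indicator_of_mem hz _
    · have hyK : y ∉ K := fun h => hyU (hKU h)
      simp only [H', indicator_of_notMem hyU]
      refine (hasFDerivAt_const (0 : Fin (m + 1) → ℝ) y).congr_of_eventuallyEq ?_
      filter_upwards [hK.isClosed.isOpen_compl.mem_nhds hyK, hQo y hy'] with z hz hzQ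
        using hH0 z hzQ hz
  · refine ContinuousOn.integrableOn_compact isCompact_Icc ?_
    refine continuousOn_finsetSum _ fun i _ => ?_
    exact (continuous_apply i).comp_continuousOn ((hH'c.mono hIccQ).clm_apply continuousOn_const)

/-! ### The tangential divergence in coordinates -/

namespace CornerChart

variable {d : ℕ} {S : Set (Euc n)} (C : CornerChart d S)

theorem closedCorner_subset_closure : C.closedCorner ⊆ closure C.openCorner := by
  intro y hy
  have hc : Continuous fun t : ℝ => y + t • (1 : Fin d → ℝ) := by fun_prop
  have ht : Tendsto (fun t : ℝ => y + t • (1 : Fin d → ℝ)) (𝓝[>] 0) (𝓝 y) := by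
    simpa using (hc.tendsto 0).mono_left nhdsWithin_le_nhds
  refine mem_closure_of_tendsto ht ?_
  filter_upwards [ht.eventually_mem (C.isOpen_U.mem_nhds hy.1), self_mem_nhdsWithin] with t htU ht0
  refine ⟨htU, fun j hj => ?_⟩
  have := hy.2 j hj
  have : (0 : ℝ) < t := ht0
  simp only [Pi.add_apply, Pi.smul_apply, Pi.one_apply, smul_eq_mul, mul_one]
  linarith

theorem isOpen_openCorner : IsOpen C.openCorner := by
  have : C.openCorner = C.U ∩ ⋂ j : Fin d, {y | (j : ℕ) < C.k → 0 < y j} := by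
    ext; simp [openCorner]
  rw [this]
  refine C.isOpen_U.inter (isOpen_iInter_of_finite fun j => ?_)
  by_cases hj : (j : ℕ) < C.k
  · simpa [hj] using isOpen_lt continuous_const (continuous_apply j)
  · simp [hj]

theorem contDiffOn_dπ_ψ : ContDiffOn ℝ ∞ (fun y => C.dπ (C.ψ y)) C.U :=
  (C.contDiffOn_π.fderiv_of_isOpen C.isOpen_W (by simp)).comp C.contDiffOn_ψ C.ψ_mem_W

/-- The coordinates `Dπ f` of a vector field. -/
def coords (f : Euc n → Euc n) (y : Fin d → ℝ) : Fin d → ℝ := C.dπ (C.ψ y) (f (C.ψ y))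

variable {f : Euc n → Euc n}

theorem contDiffOn_coords (hf : ContDiff ℝ ∞ f) : ContDiffOn ℝ ∞ (C.coords f) C.U :=
  C.contDiffOn_dπ_ψ.clm_apply (hf.comp_contDiffOn C.contDiffOn_ψ)

/-- Tangency is assumed on `S` only. It reaches the boundary by continuity, as the open corner is
dense in the closed one; the normal flux needs it there. -/
theorem dψ_coords (hf : ContDiff ℝ ∞ f) (htan : ∀ x ∈ S, f x ∈ tangentSpaceAt S x)
    {y : Fin d → ℝ} (hy : y ∈ C.closedCorner) : C.dψ y (C.coords f y) = f (C.ψ y) := by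
  have hopen : ∀ z ∈ C.openCorner, C.dψ z (C.coords f z) = f (C.ψ z) := by
    intro z hz
    have h1 := htan _ ((C.ψ_mem_iff z hz.1).2 hz.2)
    rw [C.tangentSpaceAt_eq (C.openCorner_subset hz)] at h1
    obtain ⟨w, hw⟩ := h1
    simp only [ContinuousLinearMap.coe_coe] at hw
    rw [coords, ← hw, C.dπ_dψ hz.1]
  have hne : (𝓝[C.openCorner] y).NeBot :=
    mem_closure_iff_nhdsWithin_neBot.1 (C.closedCorner_subset_closure hy)
  have hU := C.isOpen_U.mem_nhds hy.1
  have h1 : ContinuousAt (fun z => C.dψ z (C.coords f z)) y :=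
    (C.contDiffOn_dψ.continuousOn.continuousAt hU).clm_apply
      ((C.contDiffOn_coords hf).continuousOn.continuousAt hU)
  have h2 : ContinuousAt (fun z => f (C.ψ z)) y :=
    hf.continuous.continuousAt.comp (C.contDiffOn_ψ.continuousOn.continuousAt hU)
  refine tendsto_nhds_unique (h1.tendsto.mono_left (nhdsWithin_le_nhds (s := C.openCorner)))
    ((h2.tendsto.mono_left nhdsWithin_le_nhds).congr' ?_)
  filter_upwards [self_mem_nhdsWithin] with z hz using (hopen z hz).symm

/-- The projection is `A A⁺` with `A = Dψ`, and cyclicity of the trace turns `tr(A A⁺ Df)` into a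
trace over the parameter space. -/
theorem tangentialDiv_eq_sum {y : Fin d → ℝ} (hy : y ∈ C.closedCorner) :
    tangentialDiv S f (C.ψ y) =
      ∑ i, pinv (C.dψ y) (fderiv ℝ f (C.ψ y) (C.dψ y (Pi.single i 1))) i := by
  have h1 : (tangentProj S (C.ψ y) ∘L fderiv ℝ f (C.ψ y)).toLinearMap =
      (C.dψ y).toLinearMap ∘ₗ ((pinv (C.dψ y)).toLinearMap ∘ₗ (fderiv ℝ f (C.ψ y)).toLinearMap) := by
    ext1 v
    exact C.tangentProj_eq hy _
  rw [tangentialDiv, h1, LinearMap.trace_comp_comm',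
    LinearMap.trace_eq_matrix_trace ℝ (Pi.basisFun ℝ (Fin d))]
  simp only [Matrix.trace, Matrix.diag_apply, LinearMap.toMatrix_apply]
  refine Finset.sum_congr rfl fun i _ => ?_
  simp

/-- The field `√g F` whose divergence is `√g` times the tangential divergence. -/
def density (f : Euc n → Euc n) (y : Fin d → ℝ) : Fin d → ℝ := jac (C.dψ y) • C.coords f y

theorem contDiffOn_jac_dψ : ContDiffOn ℝ ∞ (fun y => jac (C.dψ y)) C.U := fun y hy =>
  (contDiffAt_jac (C.dψ_injective hy)).comp_contDiffWithinAt y (C.contDiffOn_dψ y hy)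

theorem contDiffOn_density (hf : ContDiff ℝ ∞ f) : ContDiffOn ℝ ∞ (C.density f) C.U :=
  C.contDiffOn_jac_dψ.smul (C.contDiffOn_coords hf)

/-- Differentiating `f ∘ ψ = A B` gives `Df(A v) = D²ψ(v, B) + A DB v`. After `A⁺` and the trace,
the second term is the flat divergence of `B`. By `fderiv_jac` and the symmetry of `D²ψ`, the first
one is the derivative of `√g` along `B`, divided by `√g`. -/
theorem sum_fderiv_density (hf : ContDiff ℝ ∞ f) (htan : ∀ x ∈ S, f x ∈ tangentSpaceAt S x)
    {y : Fin d → ℝ} (hy : y ∈ C.openCorner) :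
    ∑ i, fderiv ℝ (C.density f) y (Pi.single i 1) i =
      jac (C.dψ y) * tangentialDiv S f (C.ψ y) := by
  have hyU := hy.1
  have hU := C.isOpen_U.mem_nhds hyU
  set A := C.dψ y with hA
  have hAinj : Function.Injective A := C.dψ_injective hyU
  set B := C.coords f y with hB
  set DB := fderiv ℝ (C.coords f) y with hDB
  set D2 := fderiv ℝ C.dψ y with hD2
  have hcB : HasFDerivAt (C.coords f) DB y :=
    (((C.contDiffOn_coords hf).contDiffAt hU).differentiableAt (by simp)).hasFDerivAt
  have hcA : HasFDerivAt C.dψ D2 y :=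
    ((C.contDiffOn_dψ.contDiffAt hU).differentiableAt (by simp)).hasFDerivAt
  have hcJ : HasFDerivAt (fun z => jac (C.dψ z)) (fderiv ℝ jac A ∘L D2) y :=
    (((contDiffAt_jac hAinj).differentiableAt (by simp)).hasFDerivAt).comp y hcA
  have hF : fderiv ℝ (C.density f) y =
      jac A • DB + (fderiv ℝ jac A ∘L D2).smulRight B := (hcJ.smul hcB).fderiv
  have hsymm : ∀ v w, D2 v w = D2 w v := by
    have hs : IsSymmSndFDerivAt ℝ C.ψ y :=
      (C.contDiffOn_ψ.contDiffAt hU).isSymmSndFDerivAt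
        (by rw [minSmoothness_of_isRCLikeNormedField]; exact WithTop.coe_le_coe.2 (le_top : (2 : ℕ∞) ≤ ⊤))
    exact fun v w => hs.eq v w
  have hDf : ∀ v, fderiv ℝ f (C.ψ y) (A v) = D2 v B + A (DB v) := by
    intro v
    have e1 : HasFDerivAt (fun z => f (C.ψ z)) (fderiv ℝ f (C.ψ y) ∘L A) y :=
      ((hf.differentiable (by simp)) _).hasFDerivAt.comp y (C.hasFDerivAt_ψ hyU)
    have e2 := hcA.clm_apply hcB
    have e3 : (fun z => f (C.ψ z)) =ᶠ[𝓝 y] fun z => C.dψ z (C.coords f z) := by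
      filter_upwards [C.isOpen_openCorner.mem_nhds hy] with z hz
        using (C.dψ_coords hf htan (C.openCorner_subset hz)).symm
    have := DFunLike.congr_fun (e1.unique (e2.congr_of_eventuallyEq e3)) v
    simp only [ContinuousLinearMap.comp_apply, _root_.add_apply,
      ContinuousLinearMap.flip_apply] at this
    rw [this, add_comm]
  have hJB : ∑ i, fderiv ℝ jac A (D2 (Pi.single i 1)) * B i = fderiv ℝ jac A (D2 B) := by
    conv_rhs => rw [pi_eq_sum_univ' B]
    simp only [map_sum, map_smul, smul_eq_mul, mul_comm]
  rw [C.tangentialDiv_eq_sum (C.openCorner_subset hy), hF, ← hA]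
  simp only [_root_.add_apply, _root_.smul_apply,
    ContinuousLinearMap.smulRight_apply, ContinuousLinearMap.comp_apply, Pi.add_apply,
    Pi.smul_apply, smul_eq_mul, Finset.sum_add_distrib, hDf, map_add, pinv_map hAinj]
  rw [hJB, fderiv_jac hAinj]
  simp only [hsymm B, mul_add, Finset.mul_sum, ← Finset.sum_add_distrib]
  refine Finset.sum_congr rfl fun i _ => ?_
  ring

end CornerChart

/-! ### Measures on a manifold with corners and on its boundary -/

/-- `S` has compact closure and corner charts around all points of its closure. -/
structure HasCornerCharts (d : ℕ) (S : Set (Euc n)) : Prop where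
  exists_chart : ∀ p ∈ closure S, ∃ C : CornerChart d S, p ∈ C.W
  isCompact : IsCompact (closure S)

theorem aestronglyMeasurable_restrict_of_locally {X : Type*} [TopologicalSpace X]
    [SecondCountableTopology X] [MeasurableSpace X] {μ : Measure X} {K : Set X} {f : X → ℝ}
    (h : ∀ x ∈ K, ∃ W ∈ 𝓝 x, AEStronglyMeasurable f (μ.restrict (K ∩ W))) :
    AEStronglyMeasurable f (μ.restrict K) := by
  choose! W hW hf using h
  obtain ⟨t, htK, htc, ht⟩ := TopologicalSpace.countable_cover_nhdsWithin
    fun x hx => nhdsWithin_le_nhds (hW x hx)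
  have := htc.to_subtype
  have h1 : AEStronglyMeasurable f (μ.restrict (⋃ x : t, K ∩ W x)) :=
    AEStronglyMeasurable.iUnion fun x => hf x (htK x.2)
  refine h1.mono_set fun x hx => ?_
  obtain ⟨y, hy⟩ := mem_iUnion.1 (ht hx)
  simp only [mem_iUnion] at hy
  exact mem_iUnion.2 ⟨⟨y, hy.1⟩, hx, hy.2⟩

theorem continuousOn_gramOf_inv {m : ℕ} :
    ContinuousOn (fun A : (Fin m → ℝ) →L[ℝ] Euc n => (gramOf A)⁻¹)
      {A | Function.Injective A} := by
  have hc : Continuous fun A : (Fin m → ℝ) →L[ℝ] Euc n => gramOf A := by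
    refine continuous_matrix fun i j => ?_
    simp only [Matrix.gram_apply]
    fun_prop
  have : ∀ A : (Fin m → ℝ) →L[ℝ] Euc n, (gramOf A)⁻¹ = (gramOf A).det⁻¹ • (gramOf A).adjugate :=
    fun A => by rw [Matrix.inv_def, Ring.inverse_eq_inv']
  simp_rw [this]
  exact (hc.matrix_det.continuousOn.inv₀ fun A hA => (det_gramOf_pos hA).ne').smul
    hc.matrix_adjugate.continuousOn

theorem continuousOn_pinv {m : ℕ} :
    ContinuousOn (fun p : ((Fin m → ℝ) →L[ℝ] Euc n) × Euc n => pinv p.1 p.2)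
      {p | Function.Injective p.1} := by
  refine continuousOn_pi.2 fun i => ?_
  simp_rw [pinv_apply]
  refine continuousOn_finsetSum _ fun j _ => ?_
  have h1 : ContinuousOn (fun p : ((Fin m → ℝ) →L[ℝ] Euc n) × Euc n => (gramOf p.1)⁻¹ i j)
      {p | Function.Injective p.1} := by
    have h2 : Continuous fun M : Matrix (Fin m) (Fin m) ℝ => M i j := by fun_prop
    exact h2.comp_continuousOn (continuousOn_gramOf_inv.comp continuousOn_fst fun p hp => hp)
  refine h1.mul (Continuous.continuousOn ?_)
  fun_prop

theorem measure_image_lt_top_of_isCompact {m : ℕ} {f : (Fin m → ℝ) → Euc n}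
    {U : Set (Fin m → ℝ)} (hU : IsOpen U) (hf : ContDiffOn ℝ 1 f U) (hinj : InjOn f U)
    (hf' : ∀ x ∈ U, Function.Injective (fderiv ℝ f x)) {B : Set (Fin m → ℝ)}
    (hB : IsCompact B) (hBU : B ⊆ U) : μHE[m] (f '' B) < ⊤ := by
  rw [euclideanHausdorffMeasure_image_eq_lintegral hU hf hinj hf' hB.measurableSet hBU]
  refine Integrable.lintegral_lt_top ?_
  refine ContinuousOn.integrableOn_compact hB ?_
  exact (continuous_jac.comp_continuousOn (hf.continuousOn_fderiv_of_isOpen hU le_rfl)).mono hBU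

namespace CornerChart

section

variable {d : ℕ} {S : Set (Euc n)} (C : CornerChart d S)

/-- Gives local finiteness of the surface measures, since the Jacobian is bounded over a compact set
of parameters. -/
theorem exists_nhds_subset_image {p : Euc n} (hp : p ∈ closure S ∩ C.W) :
    ∃ V ∈ 𝓝 p, ∃ B : Set (Fin d → ℝ), IsCompact B ∧ B ⊆ C.U ∧
      ∀ x ∈ closure S ∩ V, x ∈ C.W ∧ C.π x ∈ B := by
  have hU := C.π_mem_U p hp
  obtain ⟨B, hB, hBc, hBU⟩ := exists_mem_nhds_isCompact_mapsTo (continuous_id (X := Fin d → ℝ))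
    (C.isOpen_U.mem_nhds hU)
  have hc : ContinuousAt C.π p := (C.hasFDerivAt_π hp.2).continuousAt
  refine ⟨C.W ∩ C.π ⁻¹' B, inter_mem (C.isOpen_W.mem_nhds hp.2) (hc hB), B, hBc, hBU, ?_⟩
  exact fun x hx => ⟨hx.2.1, hx.2.2⟩

/-- The open corner is open in the parameter space, hence `S` is relatively open in its closure and
`bdry S` is closed. -/
theorem eventually_mem_of_mem {p : Euc n} (hp : p ∈ S ∩ C.W) :
    ∀ᶠ x in 𝓝 p, x ∈ closure S → x ∈ S := by
  have hp' : p ∈ closure S ∩ C.W := ⟨subset_closure hp.1, hp.2⟩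
  have hc : ContinuousAt C.π p := (C.hasFDerivAt_π hp.2).continuousAt
  have hopen : C.π p ∈ C.openCorner := by
    refine ⟨C.π_mem_U p hp', (C.ψ_mem_iff _ (C.π_mem_U p hp')).1 ?_⟩
    rw [C.ψ_π p hp']
    exact hp.1
  filter_upwards [hc (C.isOpen_openCorner.mem_nhds hopen), C.isOpen_W.mem_nhds hp.2]
    with x hx hxW hxS
  rw [← C.ψ_π x ⟨hxS, hxW⟩]
  exact (C.ψ_mem_iff _ hx.1).2 hx.2

theorem continuousOn_tangentialDiv {f : Euc n → Euc n} (hf : ContDiff ℝ ∞ f) :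
    ContinuousOn (tangentialDiv S f) (closure S ∩ C.W) := by
  have hπ : ContinuousOn C.π (closure S ∩ C.W) := C.contDiffOn_π.continuousOn.mono inter_subset_right
  have hA : ContinuousOn (fun x => C.dψ (C.π x)) (closure S ∩ C.W) :=
    C.contDiffOn_dψ.continuousOn.comp hπ C.π_mem_U
  have h1 : ContinuousOn (fun x => ∑ i, pinv (C.dψ (C.π x))
      (fderiv ℝ f x (C.dψ (C.π x) (Pi.single i 1))) i) (closure S ∩ C.W) := by
    refine continuousOn_finsetSum _ fun i _ => ?_
    refine (continuous_apply i).comp_continuousOn ?_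
    refine continuousOn_pinv.comp (f := fun x => (C.dψ (C.π x),
      fderiv ℝ f x (C.dψ (C.π x) (Pi.single i 1)))) (hA.prodMk ?_)
      fun x hx => C.dψ_injective (C.π_mem_U x hx)
    exact (hf.continuous_fderiv (by simp)).continuousOn.clm_apply (hA.clm_apply continuousOn_const)
  refine h1.congr fun x hx => ?_
  have hU := C.π_mem_U x hx
  have hcl : C.π x ∈ C.closedCorner := by
    refine ⟨hU, (C.ψ_mem_closure_iff _ hU).1 ?_⟩
    rw [C.ψ_π x hx]
    exact hx.1
  have := C.tangentialDiv_eq_sum (f := f) hcl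
  rw [C.ψ_π x hx] at this
  exact this

end

section

variable {m : ℕ} {S : Set (Euc n)} (C : CornerChart (m + 1) S) (j : Fin (m + 1))

/-- The parametrization of the face `y_j = 0`. -/
def ψface (z : Fin m → ℝ) : Euc n := C.ψ (faceIncl j z)

theorem isOpen_faceIncl_preimage : IsOpen (faceIncl j ⁻¹' C.U) :=
  C.isOpen_U.preimage (faceIncl j).continuous

theorem contDiffOn_ψface : ContDiffOn ℝ 1 (C.ψface j) (faceIncl j ⁻¹' C.U) :=
  C.contDiffOn_ψ_one.comp (faceIncl j).contDiff.contDiffOn fun _ hz => hz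

theorem injOn_ψface : InjOn (C.ψface j) (faceIncl j ⁻¹' C.U) := fun _ hz _ hw h =>
  faceIncl_injective j (C.injOn_ψ hz hw h)

theorem fderiv_ψface {z : Fin m → ℝ} (hz : faceIncl j z ∈ C.U) :
    fderiv ℝ (C.ψface j) z = C.dψ (faceIncl j z) ∘L faceIncl j :=
  ((C.hasFDerivAt_ψ hz).comp z (faceIncl j).hasFDerivAt).fderiv

theorem fderiv_ψface_injective {z : Fin m → ℝ} (hz : faceIncl j z ∈ C.U) :
    Function.Injective (fderiv ℝ (C.ψface j) z) := by
  rw [C.fderiv_ψface j hz]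
  exact (C.dψ_injective hz).comp (faceIncl_injective j)

theorem isOpen_face : IsOpen (C.face j) := by
  have : C.face j = faceIncl j ⁻¹' C.U ∩
      ⋂ i : Fin m, {z | (j.succAbove i : ℕ) < C.k → 0 < z i} := by
    ext; simp [face]
  rw [this]
  refine (C.isOpen_faceIncl_preimage j).inter (isOpen_iInter_of_finite fun i => ?_)
  by_cases hi : (j.succAbove i : ℕ) < C.k
  · simpa [hi] using isOpen_lt continuous_const (continuous_apply i)
  · simp [hi]

theorem face_subset : C.face j ⊆ faceIncl j ⁻¹' C.U := fun _ hz => hz.1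

theorem measurableSet_image_face : MeasurableSet (C.ψface j '' C.face j) :=
  (C.isOpen_face j).measurableSet.image_of_continuousOn_injOn
    ((C.contDiffOn_ψface j).continuousOn.mono (C.face_subset j))
    ((C.injOn_ψface j).mono (C.face_subset j))

theorem pairwise_disjoint_image_face (s : Set (Fin (m + 1))) (hs : ∀ j ∈ s, (j : ℕ) < C.k) :
    s.Pairwise (Function.onFun Disjoint fun j => C.ψface j '' C.face j) := by
  intro i hi j hj hij
  rw [Function.onFun, disjoint_left]
  rintro _ ⟨z, hz, rfl⟩ ⟨w, hw, h⟩
  have h2 : faceIncl j w = faceIncl i z := C.injOn_ψ hw.1 hz.1 h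
  obtain ⟨l, rfl⟩ := Fin.exists_succAbove_eq hij
  have := congrFun h2 (j.succAbove l)
  rw [faceIncl_apply_succAbove, faceIncl_apply_same] at this
  exact (hw.2 l (hs _ hi)).ne' this

variable {j} in
theorem image_face_subset (hj : (j : ℕ) < C.k) : C.ψface j '' C.face j ⊆ bdry S ∩ C.W := by
  rintro _ ⟨z, hz, rfl⟩
  exact ⟨C.ψ_faceIncl_mem_bdry hj hz, C.ψ_mem_W _ hz.1⟩

/-- Up to the corners, the boundary consists of the regular parts of the faces. -/
theorem bdry_inter_ae_eq : (bdry S ∩ C.W : Set (Euc n)) =ᵐ[μHE[m]]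
    ⋃ j ∈ Finset.univ.filter fun j : Fin (m + 1) => (j : ℕ) < C.k, C.ψface j '' C.face j := by
  refine EventuallyLE.antisymm (ae_le_set.2 ?_) (LE.le.eventuallyLE ?_)
  -- A boundary point that is not on a regular face has a second vanishing coordinate. It therefore
  -- lies in the image of a hyperplane of a face, which is a null set by the area formula.
  · refine measure_mono_null (t := ⋃ j : Fin (m + 1), ⋃ i : Fin m,
      C.ψface j '' (faceIncl j ⁻¹' C.U ∩ {z | z i = 0})) ?_
      (measure_iUnion_null fun j => measure_iUnion_null fun i => ?_)
    · rintro x ⟨⟨hxb, hxW⟩, hx⟩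
      have hxcl : x ∈ closure S ∩ C.W := ⟨hxb.1, hxW⟩
      have hU := C.π_mem_U x hxcl
      rw [← C.ψ_π x hxcl] at hxb
      obtain ⟨hcl, j, hj, hj0⟩ := (C.ψ_mem_bdry_iff hU).1 hxb
      have hz : faceIncl j (j.removeNth (C.π x)) = C.π x := faceIncl_removeNth j hj0
      have hex : ∃ i : Fin m, (j.succAbove i : ℕ) < C.k ∧ ¬0 < j.removeNth (C.π x) i := by
        by_contra hcon
        push Not at hcon
        refine hx (mem_iUnion₂.2 ⟨j, by simpa using hj, j.removeNth (C.π x), ⟨?_, hcon⟩, ?_⟩)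
        · rwa [hz]
        · rw [ψface, hz, C.ψ_π x hxcl]
      obtain ⟨i, hi, hi0⟩ := hex
      refine mem_iUnion₂.2 ⟨j, i, j.removeNth (C.π x), ⟨?_, ?_⟩, ?_⟩
      · rwa [mem_preimage, hz]
      · exact le_antisymm (not_lt.1 hi0) (hcl.2 _ hi)
      · rw [ψface, hz, C.ψ_π x hxcl]
    · have hnull : volume {z : Fin m → ℝ | z i = 0} = 0 := Measure.pi_hyperplane _ i 0
      have hm : MeasurableSet {z : Fin m → ℝ | z i = 0} :=
        measurableSet_eq_fun (measurable_pi_apply i) measurable_const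
      rw [euclideanHausdorffMeasure_image_eq_lintegral (C.isOpen_faceIncl_preimage j)
        (C.contDiffOn_ψface j) (C.injOn_ψface j) (fun z hz => C.fderiv_ψface_injective j hz)
        ((C.isOpen_faceIncl_preimage j).measurableSet.inter hm) inter_subset_left]
      exact setLIntegral_measure_zero _ _ (measure_mono_null inter_subset_right hnull)
  · exact iUnion₂_subset fun j hj => C.image_face_subset (by simpa using hj)

variable {f : Euc n → Euc n}

variable {j} in
theorem jac_mul_inner_exteriorNormal_face (hf : ContDiff ℝ ∞ f)
    (htan : ∀ x ∈ S, f x ∈ tangentSpaceAt S x) (hj : (j : ℕ) < C.k) {z : Fin m → ℝ}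
    (hz : z ∈ C.face j) :
    jac (fderiv ℝ (C.ψface j) z) * ⟪exteriorNormal S (C.ψface j z), f (C.ψface j z)⟫ =
      -C.density f (faceIncl j z) j := by
  have := C.jac_mul_inner_exteriorNormal hj hz (C.coords f (faceIncl j z))
  rw [C.dψ_coords hf htan (C.faceIncl_mem_closedCorner hz)] at this
  rw [C.fderiv_ψface j hz.1, ψface, this]
  rfl

-- `exteriorNormal` is defined by a choice, so its measurability is read off from the explicit
-- formula for the flux, which is continuous on the face.
variable {j} in
theorem aestronglyMeasurable_normal_face (hf : ContDiff ℝ ∞ f)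
    (htan : ∀ x ∈ S, f x ∈ tangentSpaceAt S x) (hj : (j : ℕ) < C.k) :
    AEStronglyMeasurable (fun x => ⟪exteriorNormal S x, f x⟫)
      (μHE[m].restrict (C.ψface j '' C.face j)) := by
  have hm := C.measurableSet_image_face j
  let T := C.ψface j '' C.face j
  let q : Euc n → Fin m → ℝ := fun x => j.removeNth (C.π x)
  have hqψ : ∀ z ∈ C.face j, q (C.ψface j z) = z := fun z hz => by
    simp only [q, ψface, C.π_ψ _ hz.1]
    ext i
    simp [Fin.removeNth]
  have hqc : ContinuousOn q T := by
    have h1 : ContinuousOn C.π T := C.contDiffOn_π.continuousOn.mono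
      ((C.image_face_subset hj).trans inter_subset_right)
    refine continuousOn_pi.2 fun i => ?_
    exact (continuous_apply (j.succAbove i)).comp_continuousOn h1
  have hqm : MapsTo q T (C.face j) := by
    rintro _ ⟨z, hz, rfl⟩
    rwa [hqψ z hz]
  let g : (Fin m → ℝ) → ℝ := fun z =>
    -C.density f (faceIncl j z) j / jac (fderiv ℝ (C.ψface j) z)
  have hg : ContinuousOn g (C.face j) := by
    have h1 : ContinuousOn (fun z => C.density f (faceIncl j z)) (C.face j) :=
      (C.contDiffOn_density hf).continuousOn.comp (faceIncl j).continuous.continuousOn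
        fun z hz => hz.1
    refine ((continuous_apply j).comp_continuousOn h1).neg.div ?_ fun z hz =>
      (jac_pos (C.fderiv_ψface_injective j hz.1)).ne'
    exact (continuous_jac.comp_continuousOn ((C.contDiffOn_ψface j).continuousOn_fderiv_of_isOpen
      (C.isOpen_faceIncl_preimage j) le_rfl)).mono (C.face_subset j)
  refine ((hg.comp hqc hqm).aestronglyMeasurable hm).congr ?_
  filter_upwards [ae_restrict_mem hm] with x hx
  obtain ⟨z, hz, rfl⟩ := hx
  simp only [Function.comp_apply, hqψ z hz, g]
  rw [← C.jac_mul_inner_exteriorNormal_face hf htan hj hz,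
    mul_div_cancel_left₀ _ (jac_pos (C.fderiv_ψface_injective j hz.1)).ne']

theorem aestronglyMeasurable_normal (hf : ContDiff ℝ ∞ f)
    (htan : ∀ x ∈ S, f x ∈ tangentSpaceAt S x) :
    AEStronglyMeasurable (fun x => ⟪exteriorNormal S x, f x⟫) (μHE[m].restrict (bdry S ∩ C.W)) := by
  rw [Measure.restrict_congr_set C.bdry_inter_ae_eq]
  have h1 : AEStronglyMeasurable (fun x => ⟪exteriorNormal S x, f x⟫)
      (μHE[m].restrict (⋃ j : {j : Fin (m + 1) // (j : ℕ) < C.k}, C.ψface j '' C.face j)) :=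
    AEStronglyMeasurable.iUnion fun j => C.aestronglyMeasurable_normal_face hf htan j.2
  refine h1.mono_set (iUnion₂_subset fun j hj => ?_)
  have hj' : (j : ℕ) < C.k := by simpa using hj
  exact subset_iUnion (fun j : {j : Fin (m + 1) // (j : ℕ) < C.k} => C.ψface j '' C.face j) ⟨j, hj'⟩

end

end CornerChart

/-! ### The divergence theorem on a manifold with corners -/

theorem norm_exteriorNormal_le (S : Set (Euc n)) (x : Euc n) : ‖exteriorNormal S x‖ ≤ 1 := by
  unfold exteriorNormal
  split_ifs with h
  · exact h.choose_spec.1.le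
  · simp

theorem tangentialDiv_eq_zero {S : Set (Euc n)} {f : Euc n → Euc n} {x : Euc n}
    (h : fderiv ℝ f x = 0) : tangentialDiv S f x = 0 := by
  simp [tangentialDiv, h]

namespace HasCornerCharts

variable {d m : ℕ} {S : Set (Euc n)}

theorem isClosed_bdry (h : HasCornerCharts d S) : IsClosed (bdry S) := by
  rw [← isOpen_compl_iff, isOpen_iff_mem_nhds]
  intro x hx
  by_cases hxc : x ∈ closure S
  · have hxS : x ∈ S := by
      by_contra hxS
      exact hx ⟨hxc, hxS⟩
    obtain ⟨C, hC⟩ := h.exists_chart x hxc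
    filter_upwards [C.eventually_mem_of_mem ⟨hxS, hC⟩] with y hy hyb using hyb.2 (hy hyb.1)
  · filter_upwards [isClosed_closure.isOpen_compl.mem_nhds hxc] with y hy hyb using hy hyb.1

theorem measurableSet (h : HasCornerCharts d S) : MeasurableSet S := by
  have : S = closure S \ bdry S := by
    rw [bdry, sdiff_sdiff_right_self]
    exact (inter_eq_right.2 subset_closure).symm
  rw [this]
  exact isClosed_closure.measurableSet.diff h.isClosed_bdry.measurableSet

/-- In dimension zero the condition for lying in `S` is vacuous. This makes the value `0 - 1 = 0` of
the boundary dimension harmless. -/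
theorem bdry_eq_empty (h : HasCornerCharts 0 S) : bdry S = ∅ := by
  rw [eq_empty_iff_forall_notMem]
  rintro x ⟨hx, hxS⟩
  obtain ⟨C, hC⟩ := h.exists_chart x hx
  refine hxS ?_
  rw [← C.ψ_π x ⟨hx, hC⟩]
  exact (C.ψ_mem_iff _ (C.π_mem_U x ⟨hx, hC⟩)).2 fun j => j.elim0

theorem isCompact_bdry (h : HasCornerCharts d S) : IsCompact (bdry S) :=
  h.isCompact.of_isClosed_subset h.isClosed_bdry sdiff_subset

theorem measure_closure_lt_top (h : HasCornerCharts d S) : μHE[d] (closure S) < ⊤ := by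
  refine h.isCompact.measure_lt_top_of_nhdsWithin fun p hp => ?_
  obtain ⟨C, hC⟩ := h.exists_chart p hp
  obtain ⟨V, hV, B, hB, hBU, hVB⟩ := C.exists_nhds_subset_image ⟨hp, hC⟩
  refine ⟨closure S ∩ V, inter_mem self_mem_nhdsWithin (nhdsWithin_le_nhds hV), ?_⟩
  refine (measure_mono fun x hx => ?_).trans_lt (measure_image_lt_top_of_isCompact C.isOpen_U
    C.contDiffOn_ψ_one C.injOn_ψ (fun y hy => C.dψ_injective hy) hB hBU)
  exact ⟨C.π x, (hVB x hx).2, C.ψ_π x ⟨hx.1, (hVB x hx).1⟩⟩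

theorem measure_bdry_lt_top (h : HasCornerCharts (m + 1) S) : μHE[m] (bdry S) < ⊤ := by
  refine h.isCompact_bdry.measure_lt_top_of_nhdsWithin fun p hp => ?_
  obtain ⟨C, hC⟩ := h.exists_chart p hp.1
  obtain ⟨V, hV, B, hB, hBU, hVB⟩ := C.exists_nhds_subset_image ⟨hp.1, hC⟩
  refine ⟨bdry S ∩ V, inter_mem self_mem_nhdsWithin (nhdsWithin_le_nhds hV), ?_⟩
  -- The full faces of the compact set `B` are used, not only their regular parts, so that corners
  -- are covered too.
  have hsub : bdry S ∩ V ⊆ ⋃ j : Fin (m + 1), C.ψface j '' (faceIncl j ⁻¹' B) := by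
    rintro x ⟨hxb, hxV⟩
    obtain ⟨hxW, hxB⟩ := hVB x ⟨hxb.1, hxV⟩
    have hxcl : x ∈ closure S ∩ C.W := ⟨hxb.1, hxW⟩
    have hxb' := hxb
    rw [← C.ψ_π x hxcl] at hxb'
    obtain ⟨-, j, hj, hj0⟩ := (C.ψ_mem_bdry_iff (C.π_mem_U x hxcl)).1 hxb'
    have hz : faceIncl j (j.removeNth (C.π x)) = C.π x := faceIncl_removeNth j hj0
    refine mem_iUnion.2 ⟨j, j.removeNth (C.π x), ?_, ?_⟩
    · rwa [mem_preimage, hz]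
    · rw [CornerChart.ψface, hz, C.ψ_π x hxcl]
  refine (measure_mono hsub).trans_lt ?_
  refine (measure_iUnion_fintype_le _ _).trans_lt (ENNReal.sum_lt_top.2 fun j _ => ?_)
  have hemb : Topology.IsClosedEmbedding (faceIncl j) :=
    LinearMap.isClosedEmbedding_of_injective (f := (faceIncl j).toLinearMap)
      (LinearMap.ker_eq_bot.2 (faceIncl_injective j))
  exact measure_image_lt_top_of_isCompact (C.isOpen_faceIncl_preimage j) (C.contDiffOn_ψface j)
    (C.injOn_ψface j) (fun z hz => C.fderiv_ψface_injective j hz) (hemb.isCompact_preimage hB)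
    (preimage_mono hBU)

theorem isFiniteMeasure_surf (h : HasCornerCharts d S) : IsFiniteMeasure (surf d S) :=
  ⟨by
    rw [surf, Measure.restrict_apply_univ]
    exact (measure_mono subset_closure).trans_lt h.measure_closure_lt_top⟩

theorem isFiniteMeasure_surfBdry (h : HasCornerCharts d S) : IsFiniteMeasure (surfBdry d S) :=
  ⟨by
    rw [surfBdry, surf, Measure.restrict_apply_univ]
    rcases d with _ | m
    · rw [h.bdry_eq_empty, measure_empty]
      exact ENNReal.zero_lt_top
    · exact h.measure_bdry_lt_top⟩

variable {f : Euc n → Euc n}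

theorem continuousOn_tangentialDiv (h : HasCornerCharts d S) (hf : ContDiff ℝ ∞ f) :
    ContinuousOn (tangentialDiv S f) (closure S) := by
  intro x hx
  obtain ⟨C, hC⟩ := h.exists_chart x hx
  exact ((C.continuousOn_tangentialDiv hf) x ⟨hx, hC⟩).mono_of_mem_nhdsWithin
    (inter_mem self_mem_nhdsWithin (nhdsWithin_le_nhds (C.isOpen_W.mem_nhds hC)))

theorem aestronglyMeasurable_tangentialDiv (h : HasCornerCharts d S) (hf : ContDiff ℝ ∞ f) :
    AEStronglyMeasurable (tangentialDiv S f) (surf d S) :=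
  ((h.continuousOn_tangentialDiv hf).mono subset_closure).aestronglyMeasurable h.measurableSet

theorem aestronglyMeasurable_normal (h : HasCornerCharts d S) (hf : ContDiff ℝ ∞ f)
    (htan : ∀ x ∈ S, f x ∈ tangentSpaceAt S x) :
    AEStronglyMeasurable (fun x => ⟪exteriorNormal S x, f x⟫) (surfBdry d S) := by
  rcases d with _ | m
  · rw [surfBdry, surf, h.bdry_eq_empty, Measure.restrict_empty]
    exact aestronglyMeasurable_zero_measure _
  · refine aestronglyMeasurable_restrict_of_locally fun x hx => ?_
    obtain ⟨C, hC⟩ := h.exists_chart x hx.1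
    exact ⟨C.W, C.isOpen_W.mem_nhds hC, C.aestronglyMeasurable_normal hf htan⟩

/-- The divergence theorem for a vector field with support in the domain of a chart. -/
theorem integral_tangentialDiv_of_tsupport_subset (h : HasCornerCharts (m + 1) S)
    (C : CornerChart (m + 1) S) (hf : ContDiff ℝ ∞ f)
    (htan : ∀ x ∈ S, f x ∈ tangentSpaceAt S x) (hfW : tsupport f ⊆ C.W) :
    ∫ x, tangentialDiv S f x ∂surf (m + 1) S =
      ∫ x, ⟪exteriorNormal S x, f x⟫ ∂surfBdry (m + 1) S := by
  have hCW := C.isOpen_W.measurableSet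
  have hoff : ∀ x, x ∉ C.W → f =ᶠ[𝓝 x] 0 := fun x hx =>
    notMem_tsupport_iff_eventuallyEq.1 fun hxt => hx (hfW hxt)
  have hL : ∫ x, tangentialDiv S f x ∂surf (m + 1) S =
      ∫ y in C.openCorner, jac (C.dψ y) * tangentialDiv S f (C.ψ y) := by
    have e : ∫ x in S, tangentialDiv S f x ∂μHE[m + 1] =
        ∫ x in C.ψ '' C.openCorner, tangentialDiv S f x ∂μHE[m + 1] := by
      rw [C.image_openCorner]
      refine setIntegral_eq_of_subset_of_forall_sdiff_eq_zero h.measurableSet inter_subset_left ?_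
      intro x hx
      refine tangentialDiv_eq_zero ?_
      rw [(hoff x fun hxW => hx.2 ⟨hx.1, hxW⟩).fderiv_eq]
      simp
    refine e.trans (setIntegral_image_eq_integral_jac_mul C.isOpen_U C.contDiffOn_ψ_one C.injOn_ψ
      (fun y hy => C.dψ_injective hy) C.isOpen_openCorner.measurableSet (fun y hy => hy.1) ?_)
    refine (h.aestronglyMeasurable_tangentialDiv hf).mono_measure (Measure.restrict_mono ?_ le_rfl)
    rw [C.image_openCorner]
    exact inter_subset_left
  -- Within the closed corner the field `√g B` vanishes off this compact set of parameters, as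
  -- `integral_divergence_corner` requires.
  have hK : IsCompact (C.π '' (closure S ∩ tsupport f)) := by
    refine (h.isCompact.inter_right (isClosed_tsupport f)).image_of_continuousOn ?_
    exact C.contDiffOn_π.continuousOn.mono (inter_subset_right.trans hfW)
  have hdiv := integral_divergence_corner C.k C.isOpen_U hK
    (by rintro _ ⟨x, hx, rfl⟩; exact C.π_mem_U x ⟨hx.1, hfW hx.2⟩)
    ((C.contDiffOn_density hf).of_le (by simp)) fun y hyU hy hyK => by
      have hnot : C.ψ y ∉ tsupport f := fun hmem =>
        hyK ⟨C.ψ y, ⟨(C.ψ_mem_closure_iff y hyU).2 hy, hmem⟩, C.π_ψ y hyU⟩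
      have hc : ContinuousAt C.ψ y := (C.hasFDerivAt_ψ hyU).continuousAt
      filter_upwards [hc ((isClosed_tsupport f).isOpen_compl.mem_nhds hnot)] with z hz
      have : f (C.ψ z) = 0 := image_eq_zero_of_notMem_tsupport hz
      simp [CornerChart.density, CornerChart.coords, this]
  obtain ⟨M, hM⟩ : ∃ M, ∀ x ∈ closure S, ‖f x‖ ≤ M :=
    h.isCompact.exists_bound_of_continuousOn hf.continuous.continuousOn
  have hR : ∫ x, ⟪exteriorNormal S x, f x⟫ ∂surfBdry (m + 1) S =
      ∑ j ∈ Finset.univ.filter fun j : Fin (m + 1) => (j : ℕ) < C.k,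
        ∫ x in C.ψface j '' C.face j, ⟪exteriorNormal S x, f x⟫ ∂μHE[m] := by
    have e : ∫ x in bdry S, ⟪exteriorNormal S x, f x⟫ ∂μHE[m] =
        ∫ x in bdry S ∩ C.W, ⟪exteriorNormal S x, f x⟫ ∂μHE[m] := by
      refine setIntegral_eq_of_subset_of_forall_sdiff_eq_zero h.isClosed_bdry.measurableSet
        inter_subset_left fun x hx => ?_
      rw [(hoff x fun hxW => hx.2 ⟨hx.1, hxW⟩).self_of_nhds]
      simp
    refine e.trans ?_
    rw [setIntegral_congr_set C.bdry_inter_ae_eq]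
    refine integral_biUnion_finset _ (fun j _ => C.measurableSet_image_face j)
      (C.pairwise_disjoint_image_face _ fun j hj => by simpa using hj) fun j hj => ?_
    have hj' : (j : ℕ) < C.k := by simpa using hj
    have hsub : C.ψface j '' C.face j ⊆ bdry S := (C.image_face_subset hj').trans inter_subset_left
    have hfin : IsFiniteMeasure (μHE[m].restrict (C.ψface j '' C.face j)) := ⟨by
      rw [Measure.restrict_apply_univ]
      exact (measure_mono hsub).trans_lt h.measure_bdry_lt_top⟩
    refine Integrable.of_bound (C.aestronglyMeasurable_normal_face hf htan hj') M ?_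
    filter_upwards [ae_restrict_mem (C.measurableSet_image_face j)] with x hx
    refine (norm_inner_le_norm _ _).trans ?_
    have h1 := norm_exteriorNormal_le S x
    have h2 := hM x (hsub hx).1
    calc _ ≤ 1 * ‖f x‖ := by gcongr
      _ ≤ M := by rwa [one_mul]
  rw [hL, hR]
  have e1 : ∫ y in C.openCorner, jac (C.dψ y) * tangentialDiv S f (C.ψ y) =
      ∫ y in C.openCorner, ∑ i, fderiv ℝ (C.density f) y (Pi.single i 1) i :=
    setIntegral_congr_fun C.isOpen_openCorner.measurableSet
      fun y hy => (C.sum_fderiv_density hf htan hy).symm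
  rw [e1]
  refine hdiv.trans ?_
  rw [← Finset.sum_neg_distrib]
  refine Finset.sum_congr rfl fun j hj => ?_
  have hj' : (j : ℕ) < C.k := by simpa using hj
  rw [setIntegral_image_eq_integral_jac_mul (C.isOpen_faceIncl_preimage j) (C.contDiffOn_ψface j)
    (C.injOn_ψface j) (fun z hz => C.fderiv_ψface_injective j hz) (C.isOpen_face j).measurableSet
    (C.face_subset j) (C.aestronglyMeasurable_normal_face hf htan hj'), ← integral_neg]
  exact setIntegral_congr_fun (C.isOpen_face j).measurableSet
    fun z hz => (C.jac_mul_inner_exteriorNormal_face hf htan hj' hz).symm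

theorem exists_bound_tangentialDiv (h : HasCornerCharts d S) (hf : ContDiff ℝ ∞ f) :
    ∃ M, ∀ x ∈ S, |tangentialDiv S f x| ≤ M := by
  obtain ⟨M, hM⟩ := h.isCompact.exists_bound_of_continuousOn (h.continuousOn_tangentialDiv hf)
  exact ⟨M, fun x hx => hM x (subset_closure hx)⟩

theorem integrable_tangentialDiv (h : HasCornerCharts d S) (hf : ContDiff ℝ ∞ f) :
    Integrable (tangentialDiv S f) (surf d S) := by
  obtain ⟨M, hM⟩ := h.exists_bound_tangentialDiv hf
  have := h.isFiniteMeasure_surf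
  exact Integrable.of_bound (h.aestronglyMeasurable_tangentialDiv hf) M
    ((ae_restrict_mem h.measurableSet).mono hM)

theorem exists_bound_normal (h : HasCornerCharts d S) (hf : ContDiff ℝ ∞ f) :
    ∃ M, ∀ x ∈ bdry S, |⟪exteriorNormal S x, f x⟫| ≤ M := by
  obtain ⟨M, hM⟩ := h.isCompact.exists_bound_of_continuousOn hf.continuous.continuousOn
  refine ⟨M, fun x hx => (abs_real_inner_le_norm _ _).trans ?_⟩
  calc _ ≤ 1 * ‖f x‖ := by gcongr; exact norm_exteriorNormal_le S x
    _ ≤ M := by rw [one_mul]; exact hM x hx.1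

theorem integrable_normal (h : HasCornerCharts d S) (hf : ContDiff ℝ ∞ f)
    (htan : ∀ x ∈ S, f x ∈ tangentSpaceAt S x) :
    Integrable (fun x => ⟪exteriorNormal S x, f x⟫) (surfBdry d S) := by
  obtain ⟨M, hM⟩ := h.exists_bound_normal hf
  have := h.isFiniteMeasure_surfBdry
  exact Integrable.of_bound (h.aestronglyMeasurable_normal hf htan) M
    ((ae_restrict_mem h.isClosed_bdry.measurableSet).mono hM)

theorem tangentialDiv_eq_zero_of_dim_zero (h : HasCornerCharts 0 S) {x : Euc n} (hx : x ∈ S) :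
    tangentialDiv S f x = 0 := by
  have hx' := subset_closure hx
  obtain ⟨C, hC⟩ := h.exists_chart x hx'
  have hU := C.π_mem_U x ⟨hx', hC⟩
  have := C.tangentialDiv_eq_sum (f := f) (y := C.π x) ⟨hU, fun j => j.elim0⟩
  rwa [C.ψ_π x ⟨hx', hC⟩, Fin.sum_univ_zero] at this

/-- The divergence theorem for tangential vector fields. -/
theorem integral_tangentialDiv (h : HasCornerCharts d S) (hf : ContDiff ℝ ∞ f)
    (htan : ∀ x ∈ S, f x ∈ tangentSpaceAt S x) :
    ∫ x, tangentialDiv S f x ∂surf d S = ∫ x, ⟪exteriorNormal S x, f x⟫ ∂surfBdry d S := by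
  rcases d with _ | m
  · rw [surfBdry, surf, surf, h.bdry_eq_empty, Measure.restrict_empty, integral_zero_measure]
    exact setIntegral_eq_zero_of_forall_eq_zero fun x hx => h.tangentialDiv_eq_zero_of_dim_zero hx
  rcases (closure S).eq_empty_or_nonempty with he | ⟨p, hp⟩
  · have hS : S = ∅ := (closure_empty_iff _).1 he
    simp [surf, surfBdry, bdry, hS]
  have : Nonempty (CornerChart (m + 1) S) := ⟨(h.exists_chart p hp).choose⟩
  choose! C hC using h.exists_chart
  obtain ⟨t, ht, htS⟩ := h.isCompact.elim_nhds_subcover (fun p => (C p).W)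
    fun p hp => (C p).isOpen_W.mem_nhds (hC p hp)
  -- The index `none` stands for the complement of `closure S`: the partition of unity lives on all
  -- of `ℝⁿ`, and its `none` part contributes nothing to either side. Scalar factors keep the pieces
  -- tangential.
  let V : Option t → Set (Euc n) := fun o => o.elim (closure S)ᶜ fun p => (C p).W
  obtain ⟨χ, hχ⟩ := SmoothPartitionOfUnity.exists_isSubordinate (modelWithCornersSelf ℝ (Euc n))
    (s := univ) isClosed_univ V
    (by
      rintro (_ | p)
      · exact isClosed_closure.isOpen_compl
      · exact (C p).isOpen_W)
    (by
      intro x _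
      by_cases hx : x ∈ closure S
      · obtain ⟨p, hp, hxp⟩ := mem_iUnion₂.1 (htS hx)
        exact mem_iUnion.2 ⟨some ⟨p, hp⟩, hxp⟩
      · exact mem_iUnion.2 ⟨none, hx⟩)
  have hsum : ∀ x, ∑ o, χ o x = 1 := fun x => by
    rw [← finsum_eq_sum_of_fintype]
    exact χ.sum_eq_one (mem_univ x)
  have hsm : ∀ o, ContDiff ℝ ∞ (χ o) := fun o => (χ o).contMDiff.contDiff
  let g : Option t → Euc n → Euc n := fun o x => χ o x • f x
  have hg : ∀ o, ContDiff ℝ ∞ (g o) := fun o => (hsm o).smul hf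
  have hgtan : ∀ o, ∀ x ∈ S, g o x ∈ tangentSpaceAt S x := fun o x hx =>
    Submodule.smul_mem _ _ (htan x hx)
  have hfg : f = fun x => ∑ o, g o x := by
    ext1 x
    simp only [g]
    rw [← Finset.sum_smul, hsum, one_smul]
  have hgsupp : ∀ o, tsupport (g o) ⊆ V o := fun o =>
    (closure_mono (Function.support_smul_subset_left _ _)).trans (hχ o)
  have hgi : ∀ o, ∫ x, tangentialDiv S (g o) x ∂surf (m + 1) S =
      ∫ x, ⟪exteriorNormal S x, g o x⟫ ∂surfBdry (m + 1) S := by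
    rintro (_ | p)
    · have hz : ∀ x ∈ closure S, g none =ᶠ[𝓝 x] 0 := fun x hx =>
        notMem_tsupport_iff_eventuallyEq.1 fun hxt => (hgsupp none hxt) hx
      have e1 : ∫ x, tangentialDiv S (g none) x ∂surf (m + 1) S = 0 :=
        setIntegral_eq_zero_of_forall_eq_zero fun x hx => tangentialDiv_eq_zero (by
          rw [(hz x (subset_closure hx)).fderiv_eq]
          simp)
      have e2 : ∫ x, ⟪exteriorNormal S x, g none x⟫ ∂surfBdry (m + 1) S = 0 :=
        setIntegral_eq_zero_of_forall_eq_zero fun x hx => by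
          rw [(hz x hx.1).self_of_nhds]
          simp
      rw [e1, e2]
    · exact h.integral_tangentialDiv_of_tsupport_subset (C p) (hg _) (hgtan _) (hgsupp (some p))
  have hdiv : ∀ x, tangentialDiv S f x = ∑ o, tangentialDiv S (g o) x := fun x => by
    have hfd : fderiv ℝ f x = ∑ o, fderiv ℝ (g o) x := by
      conv_lhs => rw [hfg]
      exact fderiv_fun_sum fun o _ => (hg o).differentiable (by simp) x
    simp only [tangentialDiv, hfd]
    rw [← map_sum]
    congr 1
    ext1 v
    simp [LinearMap.sum_apply]
  simp_rw [hdiv]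
  rw [integral_finsetSum _ fun o _ => h.integrable_tangentialDiv (hg o),
    Finset.sum_congr rfl fun o _ => hgi o,
    ← integral_finsetSum _ fun o _ => h.integrable_normal (hg o) (hgtan o)]
  refine integral_congr_ae (Eventually.of_forall fun x => ?_)
  simp only
  rw [← inner_sum]
  congr 1
  exact (congrFun hfg x).symm

end HasCornerCharts

/-! ### Product rule and integration by parts for smooth functions -/

theorem inner_tangentialGradient {S : Set (Euc n)} {φ : Euc n → ℝ} {x b : Euc n}
    (hb : b ∈ tangentSpaceAt S x) : ⟪b, tangentialGradient S φ x⟫ = fderiv ℝ φ x b := by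
  have hP : tangentProj S x b = b := Submodule.starProjection_eq_self_iff.2 hb
  have h1 : ⟪tangentProj S x b, gradient φ x⟫ = ⟪b, tangentProj S x (gradient φ x)⟫ :=
    Submodule.inner_starProjection_left_eq_right _ _ _
  rw [tangentialGradient, ← h1, hP, real_inner_comm, gradient, InnerProductSpace.toDual_symm_apply]

/-- The term in which `φ` is differentiated has rank one, and its trace is `Dφ(P b)`; tangency of
`b` removes the projection. -/
theorem tangentialDiv_smul {S : Set (Euc n)} {φ : Euc n → ℝ} {b : Euc n → Euc n} {x : Euc n}
    (hφ : DifferentiableAt ℝ φ x) (hb : DifferentiableAt ℝ b x) (hx : b x ∈ tangentSpaceAt S x) :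
    tangentialDiv S (fun y => φ y • b y) x =
      fderiv ℝ φ x (b x) + φ x * tangentialDiv S b x := by
  have hP : tangentProj S x (b x) = b x := Submodule.starProjection_eq_self_iff.2 hx
  have h1 : (tangentProj S x ∘L fderiv ℝ (fun y => φ y • b y) x).toLinearMap =
      φ x • (tangentProj S x ∘L fderiv ℝ b x).toLinearMap +
        (fderiv ℝ φ x).toLinearMap.smulRight (b x) := by
    ext1 v
    rw [fderiv_fun_smul hφ hb]
    simp [hP]
  rw [tangentialDiv, h1, map_add, map_smul, LinearMap.trace_smulRight, add_comm]
  rfl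

/-- Integration by parts for smooth functions. -/
theorem HasCornerCharts.integral_by_parts {d : ℕ} {S : Set (Euc n)} (h : HasCornerCharts d S)
    {b : Euc n → Euc n} (hb : ContDiff ℝ ∞ b) (htan : ∀ x ∈ S, b x ∈ tangentSpaceAt S x)
    {φ χ : Euc n → ℝ} (hφ : ContDiff ℝ ∞ φ) (hχ : ContDiff ℝ ∞ χ) :
    ∫ x, (⟪b x, tangentialGradient S φ x⟫ * χ x + φ x * ⟪b x, tangentialGradient S χ x⟫ +
      tangentialDiv S b x * φ x * χ x) ∂surf d S =
    ∫ x, ⟪exteriorNormal S x, b x⟫ * φ x * χ x ∂surfBdry d S := by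
  have h1 := h.integral_tangentialDiv (f := fun x => (φ x * χ x) • b x) ((hφ.mul hχ).smul hb)
    fun x hx => Submodule.smul_mem _ _ (htan x hx)
  have h2 : ∫ x, tangentialDiv S (fun x => (φ x * χ x) • b x) x ∂surf d S =
      ∫ x, (⟪b x, tangentialGradient S φ x⟫ * χ x + φ x * ⟪b x, tangentialGradient S χ x⟫ +
      tangentialDiv S b x * φ x * χ x) ∂surf d S := by
    refine setIntegral_congr_fun h.measurableSet fun x hx => ?_
    have dφ := hφ.differentiable (by simp) x
    have dχ := hχ.differentiable (by simp) x
    rw [tangentialDiv_smul (φ := fun x => φ x * χ x) (dφ.mul dχ) (hb.differentiable (by simp) x)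
      (htan x hx), inner_tangentialGradient (htan x hx), inner_tangentialGradient (htan x hx),
      fderiv_fun_mul dφ dχ]
    simp only [_root_.add_apply, _root_.smul_apply, smul_eq_mul]
    ring
  rw [← h2, h1]
  refine integral_congr_ae (Eventually.of_forall fun x => ?_)
  simp only [inner_smul_right]
  ring

/-! ### Integration by parts for functions with a directional derivative and a trace -/

theorem tendsto_integral_mul_of_tendsto_eLpNorm {X : Type*} [MeasurableSpace X] {μ : Measure X}
    {u w : ℕ → X → ℝ} {u₀ w₀ : X → ℝ} (hu : ∀ k, MemLp (u k) 2 μ) (hw : ∀ k, MemLp (w k) 2 μ)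
    (hu₀ : MemLp u₀ 2 μ) (hw₀ : MemLp w₀ 2 μ)
    (hul : Tendsto (fun k => eLpNorm (fun x => u k x - u₀ x) 2 μ) atTop (𝓝 0))
    (hwl : Tendsto (fun k => eLpNorm (fun x => w k x - w₀ x) 2 μ) atTop (𝓝 0)) :
    Tendsto (fun k => ∫ x, u k x * w k x ∂μ) atTop (𝓝 (∫ x, u₀ x * w₀ x ∂μ)) := by
  have h1 : Tendsto (fun k => (hu k).toLp) atTop (𝓝 hu₀.toLp) :=
    (Lp.tendsto_Lp_iff_tendsto_eLpNorm'' _ hu _ hu₀).2 hul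
  have h2 : Tendsto (fun k => (hw k).toLp) atTop (𝓝 hw₀.toLp) :=
    (Lp.tendsto_Lp_iff_tendsto_eLpNorm'' _ hw _ hw₀).2 hwl
  have hin : ∀ {f g : X → ℝ} (hf : MemLp f 2 μ) (hg : MemLp g 2 μ),
      ⟪hf.toLp, hg.toLp⟫ = ∫ x, f x * g x ∂μ := by
    intro f g hf hg
    rw [L2.inner_def]
    refine integral_congr_ae ?_
    filter_upwards [hf.coeFn_toLp, hg.coeFn_toLp] with x hx hy
    rw [hx, hy]
    simp [mul_comm]
  simpa only [hin] using h1.inner (𝕜 := ℝ) h2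

theorem memLp_bounded_mul {X : Type*} [MeasurableSpace X] {μ : Measure X} {m u : X → ℝ} {M : ℝ}
    (hm : AEStronglyMeasurable m μ) (hM : ∀ᵐ x ∂μ, |m x| ≤ M) (hu : MemLp u 2 μ) :
    MemLp (fun x => m x * u x) 2 μ := by
  refine MemLp.of_le_mul (c := M) hu (hm.mul hu.1) ?_
  filter_upwards [hM] with x hx
  rw [norm_mul]
  gcongr
  exact hx

theorem memLp_of_tendsto_eLpNorm {X : Type*} [MeasurableSpace X] {μ : Measure X}
    {u : ℕ → X → ℝ} {u₀ : X → ℝ} (hu : ∀ k, MemLp (u k) 2 μ) (hu₀ : AEStronglyMeasurable u₀ μ)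
    (hul : Tendsto (fun k => eLpNorm (fun x => u k x - u₀ x) 2 μ) atTop (𝓝 0)) :
    MemLp u₀ 2 μ := by
  obtain ⟨k, hk⟩ := (hul.eventually_lt_const (ENNReal.zero_lt_top)).exists
  have h1 : MemLp (fun x => u k x - u₀ x) 2 μ := ⟨(hu k).1.sub hu₀, hk⟩
  have := (hu k).sub h1
  convert this using 1
  ext x
  simp

namespace HasCornerCharts

variable {d : ℕ} {S : Set (Euc n)}

theorem memLp_surf (h : HasCornerCharts d S) {f : Euc n → ℝ} (hf : ContinuousOn f (closure S)) :
    MemLp f 2 (surf d S) := by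
  have := h.isFiniteMeasure_surf
  obtain ⟨M, hM⟩ := h.isCompact.exists_bound_of_continuousOn hf
  refine MemLp.of_bound ((hf.mono subset_closure).aestronglyMeasurable h.measurableSet) M ?_
  filter_upwards [ae_restrict_mem h.measurableSet] with x hx using hM x (subset_closure hx)

theorem memLp_surfBdry (h : HasCornerCharts d S) {f : Euc n → ℝ}
    (hf : ContinuousOn f (closure S)) : MemLp f 2 (surfBdry d S) := by
  have := h.isFiniteMeasure_surfBdry
  have hm := h.isClosed_bdry.measurableSet
  obtain ⟨M, hM⟩ := h.isCompact.exists_bound_of_continuousOn hf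
  refine MemLp.of_bound ((hf.mono sdiff_subset).aestronglyMeasurable hm) M ?_
  filter_upwards [ae_restrict_mem hm] with x hx using hM x hx.1

variable {b : Euc n → Euc n} {v g t v' g' t' : Euc n → ℝ}

theorem memLp_dirDeriv (h : HasCornerCharts d S) (hb : ContDiff ℝ ∞ b)
    (htan : ∀ x ∈ S, b x ∈ tangentSpaceAt S x) {φ : Euc n → ℝ} (hφ : ContDiff ℝ ∞ φ) :
    MemLp (fun x => ⟪b x, tangentialGradient S φ x⟫) 2 (surf d S) := by
  have hc : Continuous fun x => fderiv ℝ φ x (b x) :=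
    (hφ.continuous_fderiv (by simp)).clm_apply hb.continuous
  refine (h.memLp_surf hc.continuousOn).ae_eq ?_
  filter_upwards [ae_restrict_mem h.measurableSet] with x hx
  rw [inner_tangentialGradient (htan x hx)]

theorem ae_abs_normal_le (h : HasCornerCharts d S) (hb : ContDiff ℝ ∞ b) :
    ∃ M, ∀ᵐ x ∂surfBdry d S, |⟪exteriorNormal S x, b x⟫| ≤ M := by
  obtain ⟨M, hM⟩ := h.exists_bound_normal hb
  exact ⟨M, (ae_restrict_mem h.isClosed_bdry.measurableSet).mono hM⟩

theorem memLp_sqrt_normal_mul (h : HasCornerCharts d S) (hb : ContDiff ℝ ∞ b)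
    (htan : ∀ x ∈ S, b x ∈ tangentSpaceAt S x) {u : Euc n → ℝ} (hu : MemLp u 2 (surfBdry d S)) :
    MemLp (fun x => √|⟪exteriorNormal S x, b x⟫| * u x) 2 (surfBdry d S) := by
  obtain ⟨M, hM⟩ := h.ae_abs_normal_le hb
  refine memLp_bounded_mul (M := √M) ?_ ?_ hu
  · exact (Real.continuous_sqrt.comp continuous_abs).comp_aestronglyMeasurable
      (h.aestronglyMeasurable_normal hb htan)
  · filter_upwards [hM] with x hx
    rw [abs_of_nonneg (Real.sqrt_nonneg _)]
    exact Real.sqrt_le_sqrt hx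

theorem memLp_sqrt_normal_mul_trace (h : HasCornerCharts d S) (hb : ContDiff ℝ ∞ b)
    (htan : ∀ x ∈ S, b x ∈ tangentSpaceAt S x) (hv : HasDirDerivTrace d S b v g t) :
    MemLp (fun x => √|⟪exteriorNormal S x, b x⟫| * t x) 2 (surfBdry d S) := by
  obtain ⟨-, -, ht, φ, hφ, -, -, hlim⟩ := hv
  refine memLp_of_tendsto_eLpNorm (u := fun k x => √|⟪exteriorNormal S x, b x⟫| * φ k x)
    (fun k => h.memLp_sqrt_normal_mul hb htan (h.memLp_surfBdry (hφ k).continuous.continuousOn))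
    ?_ (by simpa only [mul_sub] using hlim)
  exact ((Real.continuous_sqrt.comp continuous_abs).comp_aestronglyMeasurable
    (h.aestronglyMeasurable_normal hb htan)).mul ht

/-- Writing `F = (F/√|F|) · √|F|` gives each of two traces a weight of size `√|F|`, while the sign
of `F` is kept. The weighted traces are in `L²`; the traces alone need not be. -/
theorem memLp_div_sqrt_normal_mul (h : HasCornerCharts d S) (hb : ContDiff ℝ ∞ b)
    (htan : ∀ x ∈ S, b x ∈ tangentSpaceAt S x) {u : Euc n → ℝ}
    (hum : AEStronglyMeasurable u (surfBdry d S))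
    (hu : MemLp (fun x => √|⟪exteriorNormal S x, b x⟫| * u x) 2 (surfBdry d S)) :
    MemLp (fun x => ⟪exteriorNormal S x, b x⟫ / √|⟪exteriorNormal S x, b x⟫| * u x) 2
      (surfBdry d S) := by
  have hm := h.aestronglyMeasurable_normal hb htan
  refine hu.of_le (((hm.aemeasurable.div ((Real.continuous_sqrt.comp
    continuous_abs).comp_aestronglyMeasurable hm).aemeasurable).aestronglyMeasurable).mul hum) ?_
  refine Eventually.of_forall fun x => ?_
  rw [norm_mul, norm_mul, norm_div, Real.norm_of_nonneg (Real.sqrt_nonneg _), Real.norm_eq_abs,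
    Real.div_sqrt]

/-- Integration by parts. -/
theorem integral_by_parts_trace (h : HasCornerCharts d S) (hb : ContDiff ℝ ∞ b)
    (htan : ∀ x ∈ S, b x ∈ tangentSpaceAt S x) (hv : HasDirDerivTrace d S b v g t)
    (hv' : HasDirDerivTrace d S b v' g' t') :
    ∫ x, g x * v' x ∂surf d S + ∫ x, v x * g' x ∂surf d S +
      ∫ x, tangentialDiv S b x * v x * v' x ∂surf d S =
    ∫ x, ⟪exteriorNormal S x, b x⟫ * t x * t' x ∂surfBdry d S := by
  have ht2 := h.memLp_sqrt_normal_mul_trace hb htan hv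
  have ht2' := h.memLp_sqrt_normal_mul_trace hb htan hv'
  obtain ⟨hvL, hgL, htm, φ, hφ, hφv, hφg, hφt⟩ := hv
  obtain ⟨hvL', hgL', htm', χ, hχ, hχv, hχg, hχt⟩ := hv'
  set F : Euc n → ℝ := fun x => ⟪exteriorNormal S x, b x⟫ with hF
  obtain ⟨M, hM⟩ := h.exists_bound_tangentialDiv hb
  have hMae : ∀ᵐ x ∂surf d S, |tangentialDiv S b x| ≤ M := (ae_restrict_mem h.measurableSet).mono hM
  have hTm := h.aestronglyMeasurable_tangentialDiv hb
  have lφ := fun k => h.memLp_surf (hφ k).continuous.continuousOn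
  have lχ := fun k => h.memLp_surf (hχ k).continuous.continuousOn
  have lgφ := fun k => h.memLp_dirDeriv hb htan (hφ k)
  have lgχ := fun k => h.memLp_dirDeriv hb htan (hχ k)
  have l1 := tendsto_integral_mul_of_tendsto_eLpNorm lgφ lχ hgL hvL' hφg hχv
  have l2 := tendsto_integral_mul_of_tendsto_eLpNorm lφ lgχ hvL hgL' hφv hχg
  have l3 := tendsto_integral_mul_of_tendsto_eLpNorm
    (u := fun k x => tangentialDiv S b x * φ k x) (u₀ := fun x => tangentialDiv S b x * v x)
    (fun k => memLp_bounded_mul hTm hMae (lφ k)) lχ (memLp_bounded_mul hTm hMae hvL) hvL' (by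
      have hup : ∀ k, eLpNorm (fun x => tangentialDiv S b x * φ k x - tangentialDiv S b x * v x) 2
          (surf d S) ≤ ENNReal.ofReal M * eLpNorm (fun x => φ k x - v x) 2 (surf d S) := fun k => by
        refine eLpNorm_le_mul_eLpNorm_of_ae_le_mul ?_ 2
        filter_upwards [hMae] with x hx
        rw [← mul_sub, norm_mul]
        gcongr
        exact hx
      refine tendsto_of_tendsto_of_tendsto_of_le_of_le tendsto_const_nhds ?_
        (fun k => zero_le) hup
      simpa using ENNReal.Tendsto.const_mul hφv (Or.inr ENNReal.ofReal_ne_top)) hχv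
  have l4 := tendsto_integral_mul_of_tendsto_eLpNorm
    (u := fun k x => F x / √|F x| * φ k x) (u₀ := fun x => F x / √|F x| * t x)
    (w := fun k x => √|F x| * χ k x) (w₀ := fun x => √|F x| * t' x)
    (fun k => h.memLp_div_sqrt_normal_mul hb htan (hφ k).continuous.aestronglyMeasurable
      (h.memLp_sqrt_normal_mul hb htan (h.memLp_surfBdry (hφ k).continuous.continuousOn)))
    (fun k => h.memLp_sqrt_normal_mul hb htan (h.memLp_surfBdry (hχ k).continuous.continuousOn))
    (h.memLp_div_sqrt_normal_mul hb htan htm ht2) ht2' (by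
      refine hφt.congr fun k => ?_
      refine eLpNorm_congr_norm_ae (Eventually.of_forall fun x => ?_)
      rw [← mul_sub, norm_mul, norm_mul, norm_div, Real.norm_of_nonneg (Real.sqrt_nonneg _),
        Real.norm_eq_abs (F x), Real.div_sqrt]) (by simpa only [mul_sub] using hχt)
  -- Where the flux vanishes, both sides are zero by the convention `0 / 0 = 0`.
  have hFF : ∀ x a c, F x / √|F x| * a * (√|F x| * c) = F x * a * c := fun x a c => by
    by_cases h0 : F x = 0
    · simp [h0]
    · have : √|F x| ≠ 0 := (Real.sqrt_pos.2 (abs_pos.2 h0)).ne'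
      field_simp
  simp only [hFF] at l4
  have hk : ∀ k, ∫ x, ⟪b x, tangentialGradient S (φ k) x⟫ * χ k x ∂surf d S +
      ∫ x, φ k x * ⟪b x, tangentialGradient S (χ k) x⟫ ∂surf d S +
      ∫ x, tangentialDiv S b x * φ k x * χ k x ∂surf d S =
      ∫ x, F x * φ k x * χ k x ∂surfBdry d S := fun k => by
    have i1 := (lgφ k).integrable_mul (lχ k)
    have i2 := (lφ k).integrable_mul (lgχ k)
    have i3 := (memLp_bounded_mul hTm hMae (lφ k)).integrable_mul (lχ k)
    rw [← h.integral_by_parts hb htan (hφ k) (hχ k)]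
    exact ((integral_add (i1.add i2) i3).trans (congrArg (· + _) (integral_add i1 i2))).symm
  exact tendsto_nhds_unique ((l1.add l2).add l3) (l4.congr fun k => (hk k).symm)

end HasCornerCharts

/-! ### Linear regularity of polytopes -/

section Polytope

open scoped NNReal

variable {ι E F : Type*} [Fintype ι] [NormedAddCommGroup E] [NormedSpace ℝ E]
  [NormedAddCommGroup F] [NormedSpace ℝ F]

/-- The vectors `e i`, `i ∈ J`, have no nontrivial linear relation with nonnegative coefficients. -/
def IsPointed (e : ι → E) (J : Set ι) : Prop :=
  ∀ η : ι → ℝ, 0 ≤ η → (∀ i ∉ J, η i = 0) → ∑ i, η i • e i = 0 → η = 0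

/-- A reduction as in Carathéodory's theorem: as long as the support carries a nontrivial
nonnegative relation, a multiple of it is moved to `μ` and the support shrinks. -/
theorem exists_add_isPointed (e : ι → E) (w : ι → ℝ) (hw : 0 ≤ w) :
    ∃ μ ρ : ι → ℝ, 0 ≤ μ ∧ 0 ≤ ρ ∧ w = μ + ρ ∧ ∑ i, μ i • e i = 0 ∧
      IsPointed e (Function.support ρ) := by
  classical
  induction hm : (Function.support w).ncard using Nat.strong_induction_on generalizing w with
  | _ m ih =>
    by_cases hp : IsPointed e (Function.support w)
    · exact ⟨0, w, le_rfl, hw, by simp, by simp, hp⟩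
    simp only [IsPointed, not_forall, exists_prop] at hp
    obtain ⟨η, hη, hs, he, h0⟩ := hp
    have hne : (Finset.univ.filter fun i => η i ≠ 0).Nonempty := by
      obtain ⟨i, hi⟩ := Function.ne_iff.1 h0
      exact ⟨i, by simpa using hi⟩
    obtain ⟨i₀, hi₀, hmin⟩ := Finset.exists_min_image _ (fun i => w i / η i) hne
    have hi₀' : 0 < η i₀ := (hη i₀).lt_of_ne' (by simpa using hi₀)
    -- The largest multiple of `η` that keeps the weights nonnegative; it annihilates the weight at
    -- `i₀`.
    set s := w i₀ / η i₀ with hsdef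
    have hs0 : 0 ≤ s := div_nonneg (hw i₀) (hη i₀)
    have hle : ∀ i, s * η i ≤ w i := fun i => by
      rcases eq_or_ne (η i) 0 with h | h
      · simpa [h] using hw i
      · have := hmin i (by simpa using h)
        rwa [le_div_iff₀ ((hη i).lt_of_ne' h)] at this
    have hsub : Function.support (w - s • η) ⊂ Function.support w := by
      refine (ssubset_iff_of_subset ?_).2 ⟨i₀, ?_, ?_⟩
      · intro i hi h
        refine hi ?_
        have hw0 : w i = 0 := h
        simp [hw0, hs i (by simp [hw0])]
      · intro h
        exact hi₀'.ne' (hs i₀ (by simpa using h))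
      · simp [hsdef, div_mul_cancel₀ _ hi₀'.ne']
    obtain ⟨μ, ρ, hμ, hρ, hadd, hμe, hpt⟩ := ih _ (hm ▸ ncard_lt_ncard hsub)
      (w - s • η) (fun i => by simpa using hle i) rfl
    refine ⟨μ + s • η, ρ, add_nonneg hμ (smul_nonneg hs0 hη), hρ, ?_, ?_, hpt⟩
    · rw [add_right_comm, ← hadd]; simp
    · simp only [Pi.add_apply, Pi.smul_apply, add_smul, Finset.sum_add_distrib, hμe, smul_eq_mul,
        mul_smul, ← Finset.smul_sum, he]
      simp

/-- On the compact part of the simplex supported in `J` the norm of the combination is positive,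
hence bounded below; homogeneity does the rest. -/
theorem IsPointed.exists_sum_le {e : ι → E} {J : Set ι} (hJ : IsPointed e J) :
    ∃ C : ℝ, 0 ≤ C ∧ ∀ ρ : ι → ℝ, 0 ≤ ρ → (∀ i ∉ J, ρ i = 0) →
      ∑ i, ρ i ≤ C * ‖∑ i, ρ i • e i‖ := by
  have hK : IsCompact (stdSimplex ℝ ι ∩ {ρ | ∀ i ∉ J, ρ i = 0}) := by
    refine (isCompact_stdSimplex ℝ ι).inter_right ?_
    simp only [ofPred_forall]
    exact isClosed_iInter fun i => isClosed_iInter fun _ =>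
      isClosed_eq (continuous_apply i) continuous_const
  obtain ⟨c, hc, hle⟩ := hK.exists_forall_le' (f := fun ρ => ‖∑ i, ρ i • e i‖) (a := 0)
    (by fun_prop) (by
      rintro ρ ⟨⟨h0, h1⟩, h2⟩
      refine norm_pos_iff.2 fun h => ?_
      have := hJ ρ h0 h2 h
      simp [this] at h1)
  refine ⟨c⁻¹, by positivity, fun ρ hρ hs => ?_⟩
  rcases (Finset.sum_nonneg fun i _ => hρ i : 0 ≤ ∑ i, ρ i).eq_or_lt with h | h
  · rw [← h]; positivity
  · have := hle ((∑ i, ρ i)⁻¹ • ρ) ⟨⟨fun i => ?_, ?_⟩, fun i hi => ?_⟩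
    · simp only [Pi.smul_apply, smul_eq_mul, mul_smul, ← Finset.smul_sum, norm_smul,
        norm_inv, Real.norm_of_nonneg h.le] at this
      rw [← div_eq_inv_mul, le_div_iff₀ h] at this
      rw [← div_eq_inv_mul, le_div_iff₀ hc]
      linarith
    · exact mul_nonneg (inv_nonneg.2 h.le) (hρ i)
    · simp [← Finset.mul_sum, inv_mul_cancel₀ h.ne']
    · simp [hs i hi]

/-- Hoffman's bound for systems of linear inequalities. -/
theorem exists_nonneg_relation_near (e : ι → E) {ζ : ι → ℝ} (hζ : 0 ≤ ζ) (hζ1 : ∑ i, ζ i = 1)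
    (hζe : ∑ i, ζ i • e i = 0) :
    ∃ C : ℝ, 0 ≤ C ∧ ∀ w : ι → ℝ, 0 ≤ w → ∃ w' : ι → ℝ, 0 ≤ w' ∧ ∑ i, w' i = ∑ i, w i ∧
      ∑ i, w' i • e i = 0 ∧ ∑ i, |w i - w' i| ≤ C * ‖∑ i, w i • e i‖ := by
  classical
  -- There are only finitely many supports `J`, so the sum of their constants serves for all of
  -- them.
  have hJ : ∀ J : Set ι, ∃ C : ℝ, 0 ≤ C ∧ (IsPointed e J → ∀ ρ : ι → ℝ, 0 ≤ ρ →
      (∀ i ∉ J, ρ i = 0) → ∑ i, ρ i ≤ C * ‖∑ i, ρ i • e i‖) := fun J => by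
    by_cases h : IsPointed e J
    · obtain ⟨C, h0, hC⟩ := h.exists_sum_le
      exact ⟨C, h0, fun _ => hC⟩
    · exact ⟨0, le_rfl, fun h' => absurd h' h⟩
  choose C hC0 hC using hJ
  refine ⟨2 * ∑ J, C J, by have := Finset.sum_nonneg fun J (_ : J ∈ Finset.univ) => hC0 J; linarith,
    fun w hw => ?_⟩
  obtain ⟨μ, ρ, hμ, hρ, hadd, hμe, hpt⟩ := exists_add_isPointed e w hw
  have hρ0 : 0 ≤ ∑ i, ρ i := Finset.sum_nonneg fun i _ => hρ i
  have hwe : ∑ i, w i • e i = ∑ i, ρ i • e i := by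
    simp [hadd, add_smul, Finset.sum_add_distrib, hμe]
  -- The pointed remainder `ρ` is replaced by the multiple of the given relation `ζ` of the same
  -- total weight. This costs at most `2 ∑ ρ_i`, whence the factor 2.
  refine ⟨μ + (∑ i, ρ i) • ζ, add_nonneg hμ (smul_nonneg hρ0 hζ), ?_, ?_, ?_⟩
  · simp [hadd, Finset.sum_add_distrib, ← Finset.mul_sum, hζ1]
  · simp [add_smul, Finset.sum_add_distrib, hμe, mul_smul, ← Finset.smul_sum, hζe]
  · calc ∑ i, |w i - (μ + (∑ i, ρ i) • ζ) i|
        ≤ ∑ i, (ρ i + (∑ i, ρ i) * ζ i) := by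
          refine Finset.sum_le_sum fun i _ => ?_
          have h1 : w i - (μ + (∑ i, ρ i) • ζ) i = ρ i - (∑ i, ρ i) * ζ i := by
            simp [hadd]
          rw [h1]
          refine (abs_sub _ _).trans ?_
          rw [abs_of_nonneg (hρ i), abs_of_nonneg (mul_nonneg hρ0 (hζ i))]
      _ = 2 * ∑ i, ρ i := by
          rw [Finset.sum_add_distrib, ← Finset.mul_sum, hζ1]; ring
      _ ≤ 2 * (∑ J, C J) * ‖∑ i, w i • e i‖ := by
          rw [hwe, mul_assoc]
          gcongr
          refine (hC _ hpt ρ hρ fun i hi => by simpa using hi).trans ?_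
          gcongr
          exact Finset.single_le_sum (f := C) (fun J _ => hC0 J) (Finset.mem_univ _)

/-- Hoffman's bound applied to barycentric weights and the vectors `A i`; because the total weight
is preserved, the corrected point stays in the hull. -/
theorem exists_mem_convexHull_ker_near (s : Finset E) (A : E →ₗ[ℝ] F) {x₀ : E}
    (hx₀ : x₀ ∈ convexHull ℝ (s : Set E)) (hA : A x₀ = 0) :
    ∃ C : ℝ, 0 ≤ C ∧ ∀ x ∈ convexHull ℝ (s : Set E),
      ∃ z ∈ convexHull ℝ (s : Set E), A z = 0 ∧ ‖x - z‖ ≤ C * ‖A x‖ := by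
  have key : ∀ x ∈ convexHull ℝ (s : Set E), ∃ w : s → ℝ, 0 ≤ w ∧ ∑ i, w i = 1 ∧
      ∑ i, w i • (i : E) = x := fun x hx => by
    obtain ⟨w, h0, h1, h2⟩ := Finset.mem_convexHull'.1 hx
    exact ⟨fun i => w i, fun i => h0 i i.2, by rwa [Finset.sum_coe_sort s w],
      by rwa [Finset.sum_coe_sort s fun i => w i • i]⟩
  have hAs : ∀ w : s → ℝ, ∑ i, w i • A i = A (∑ i, w i • (i : E)) := fun w => by simp
  obtain ⟨ζ, hζ, hζ1, hζe⟩ := key x₀ hx₀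
  obtain ⟨C, hC0, hC⟩ := exists_nonneg_relation_near (fun i : s => A i) hζ hζ1
    (by rw [hAs, hζe, hA])
  refine ⟨(∑ i ∈ s, ‖i‖) * C, mul_nonneg (Finset.sum_nonneg fun _ _ => norm_nonneg _) hC0,
    fun x hx => ?_⟩
  obtain ⟨w, hw, hw1, rfl⟩ := key x hx
  obtain ⟨w', hw', hw1', hwe', hle⟩ := hC w hw
  refine ⟨∑ i, w' i • (i : E), ?_, by rw [← hAs, hwe'], ?_⟩
  · exact (convex_convexHull ℝ _).sum_mem (fun i _ => hw' i) (by rw [hw1', hw1])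
      fun i _ => subset_convexHull ℝ _ i.2
  · rw [← Finset.sum_sub_distrib, mul_assoc, ← hAs]
    calc ‖∑ i, (w i • (i : E) - w' i • (i : E))‖ ≤ ∑ i, |w i - w' i| * (∑ i ∈ s, ‖i‖) := by
          refine norm_sum_le_of_le _ fun i _ => ?_
          rw [← sub_smul, norm_smul, Real.norm_eq_abs]
          gcongr
          exact Finset.single_le_sum (f := fun i : E => ‖i‖) (fun _ _ => norm_nonneg _) i.2
      _ ≤ (∑ i ∈ s, ‖i‖) * (C * ‖∑ i, w i • A i‖) := by
          rw [← Finset.sum_mul, mul_comm]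
          gcongr

/-- Two intersecting polytopes are linearly regular. -/
theorem exists_mem_inter_convexHull_near (s t : Finset E)
    (hst : (convexHull ℝ (s : Set E) ∩ convexHull ℝ (t : Set E)).Nonempty) :
    ∃ C : ℝ, 0 ≤ C ∧ ∀ x ∈ convexHull ℝ (s : Set E), ∀ y ∈ convexHull ℝ (t : Set E),
      ∃ z ∈ convexHull ℝ (s : Set E) ∩ convexHull ℝ (t : Set E),
        ‖x - z‖ ≤ C * ‖x - y‖ ∧ ‖y - z‖ ≤ C * ‖x - y‖ := by
  classical
  obtain ⟨z₀, h1, h2⟩ := hst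
  have hprod : convexHull ℝ ((s ×ˢ t : Finset (E × E)) : Set (E × E)) =
      convexHull ℝ (s : Set E) ×ˢ convexHull ℝ (t : Set E) := by
    rw [Finset.coe_product, convexHull_prod]
  -- For the product polytope and the map `(x, y) ↦ x - y` the kernel is the diagonal, that is, the
  -- intersection.
  obtain ⟨C, hC0, hC⟩ := exists_mem_convexHull_ker_near (s ×ˢ t)
    (LinearMap.fst ℝ E E - LinearMap.snd ℝ E E) (x₀ := (z₀, z₀)) (by rw [hprod]; exact ⟨h1, h2⟩)
    (by simp)
  rw [hprod] at hC
  refine ⟨C, hC0, fun x hx y hy => ?_⟩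
  obtain ⟨⟨z, z'⟩, ⟨hz, hz'⟩, hzz, hle⟩ := hC (x, y) ⟨hx, hy⟩
  obtain rfl : z = z' := by simpa [sub_eq_zero] using hzz
  refine ⟨z, ⟨hz, hz'⟩, (norm_fst_le _).trans hle, (norm_snd_le _).trans hle⟩

/-- A function that is Lipschitz on each of two polytopes is Lipschitz on their union. -/
theorem exists_dist_le_of_lipschitzOnWith_convexHull (s t : Finset E) {f : E → ℝ} {K K' : ℝ≥0}
    (hs : LipschitzOnWith K f (convexHull ℝ (s : Set E)))
    (ht : LipschitzOnWith K' f (convexHull ℝ (t : Set E))) :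
    ∃ C : ℝ, 0 ≤ C ∧ ∀ x ∈ convexHull ℝ (s : Set E), ∀ y ∈ convexHull ℝ (t : Set E),
      dist (f x) (f y) ≤ C * dist x y := by
  by_cases hst : (convexHull ℝ (s : Set E) ∩ convexHull ℝ (t : Set E)).Nonempty
  · obtain ⟨C, hC0, hC⟩ := exists_mem_inter_convexHull_near s t hst
    refine ⟨K * C + K' * C, by positivity, fun x hx y hy => ?_⟩
    obtain ⟨z, ⟨hz, hz'⟩, h1, h2⟩ := hC x hx y hy
    rw [← dist_eq_norm, ← dist_eq_norm] at h1 h2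
    calc dist (f x) (f y) ≤ dist (f x) (f z) + dist (f y) (f z) := dist_triangle_right _ _ _
      _ ≤ K * dist x z + K' * dist y z := add_le_add (hs.dist_le_mul x hx z hz)
          (ht.dist_le_mul y hy z hz')
      _ ≤ K * (C * dist x y) + K' * (C * dist x y) := by gcongr
      _ = _ := by ring
  -- Disjoint polytopes have a positive distance, so boundedness of `f` is enough.
  · have hcs := s.finite_toSet.isCompact_convexHull ℝ
    have hct := t.finite_toSet.isCompact_convexHull ℝ
    obtain ⟨c, hc, hle⟩ := (hcs.prod hct).exists_forall_le' (f := fun p => dist p.1 p.2) (a := 0)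
      (by fun_prop) (by
        rintro ⟨x, y⟩ ⟨hx, hy⟩
        exact dist_pos.2 fun h => hst ⟨x, hx, by rw [show x = y from h]; exact hy⟩)
    obtain ⟨B, hB⟩ := hcs.exists_bound_of_continuousOn hs.continuousOn
    obtain ⟨B', hB'⟩ := hct.exists_bound_of_continuousOn ht.continuousOn
    refine ⟨(|B| + |B'|) / c, by positivity, fun x hx y hy => ?_⟩
    have h1 : c ≤ dist x y := hle (x, y) ⟨hx, hy⟩
    calc dist (f x) (f y) ≤ ‖f x‖ + ‖f y‖ := dist_le_norm_add_norm _ _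
      _ ≤ |B| + |B'| := add_le_add ((hB x hx).trans (le_abs_self _))
          ((hB' y hy).trans (le_abs_self _))
      _ = (|B| + |B'|) / c * c := by field_simp
      _ ≤ _ := by gcongr

end Polytope

/-! ### Finite element functions are Lipschitz -/

section FiniteElement

open scoped NNReal

theorem exists_refElement_eq_convexHull (n : ℕ) (kind : ElementKind) :
    ∃ s : Finset (Euc n), refElement n kind = convexHull ℝ (s : Set (Euc n)) := by
  classical
  cases kind with
  | simplex =>
    refine ⟨insert 0 (Finset.univ.image fun i => EuclideanSpace.single i (1 : ℝ)),
      Subset.antisymm ?_ (convexHull_min ?_ ?_)⟩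
    · rintro x ⟨h0, h1⟩
      have hx : x = (1 - ∑ i, x i) • (0 : Euc n) + ∑ i, x i • EuclideanSpace.single i (1 : ℝ) := by
        ext j
        simp [Finset.sum_apply, Pi.single_apply]
      have hx' : x = ∑ o : Option (Fin n), (o.elim (1 - ∑ i, x i) fun i => x i) •
          (o.elim (0 : Euc n) fun i => EuclideanSpace.single i (1 : ℝ)) := by
        rw [Fintype.sum_option]; exact hx
      rw [hx']
      refine (convex_convexHull ℝ _).sum_mem ?_ ?_ ?_
      · rintro (_ | i) -
        · simpa using h1
        · exact h0 i
      · rw [Fintype.sum_option]; simp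
      · rintro (_ | i) - <;> refine subset_convexHull ℝ _ ?_ <;> simp
    · intro x hx
      simp only [Finset.coe_insert, Finset.coe_image, Finset.coe_univ, image_univ,
        mem_insert_iff, mem_range] at hx
      rcases hx with rfl | ⟨i, rfl⟩
      · simp [refElement]
      · refine ⟨fun j => ?_, ?_⟩
        · simp only [PiLp.single_apply]; split_ifs <;> norm_num
        · simp
    · rintro x ⟨h0, h1⟩ y ⟨h0', h1'⟩ a b ha hb hab
      refine ⟨fun i => ?_, ?_⟩
      · have := h0 i
        have := h0' i
        simp only [PiLp.add_apply, PiLp.smul_apply, smul_eq_mul]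
        positivity
      · simp only [PiLp.add_apply, PiLp.smul_apply, smul_eq_mul, Finset.sum_add_distrib,
          ← Finset.mul_sum]
        nlinarith
  | cube =>
    have hfin : (univ.pi fun _ : Fin n => ({0, 1} : Set ℝ)).Finite :=
      Set.Finite.pi fun _ => (finite_singleton _).insert _
    let e := (EuclideanSpace.equiv (Fin n) ℝ).symm
    refine ⟨(hfin.image e).toFinset, ?_⟩
    have h1 := e.toLinearMap.image_convexHull (univ.pi fun _ : Fin n => ({0, 1} : Set ℝ))
    have h2 : refElement n .cube = e '' univ.pi fun _ : Fin n => Icc (0 : ℝ) 1 := by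
      ext x
      refine ⟨fun hx => ⟨fun i => x i, fun i _ => hx i, rfl⟩, ?_⟩
      rintro ⟨y, hy, rfl⟩ i
      exact hy i (mem_univ i)
    rw [Finite.coe_toFinset, h2, ← segment_eq_Icc zero_le_one]
    simp only [← convexHull_pair]
    rw [← convexHull_pi]
    exact h1

theorem Mesh.exists_elem_eq_convexHull (M : Mesh n) (T : Fin M.card) :
    ∃ s : Finset (Euc n), M.elem T = convexHull ℝ (s : Set (Euc n)) := by
  classical
  obtain ⟨s, hs⟩ := exists_refElement_eq_convexHull n M.kind
  refine ⟨s.image (M.aff T), ?_⟩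
  have := (M.aff T).toAffineMap.image_convexHull (s : Set (Euc n))
  rw [Finset.coe_image, Mesh.elem, hs]
  exact this

theorem Mesh.isCompact_elem (M : Mesh n) (T : Fin M.card) : IsCompact (M.elem T) := by
  obtain ⟨s, hs⟩ := M.exists_elem_eq_convexHull T
  rw [hs]
  exact s.finite_toSet.isCompact_convexHull ℝ

theorem Mesh.convex_elem (M : Mesh n) (T : Fin M.card) : Convex ℝ (M.elem T) := by
  obtain ⟨s, hs⟩ := M.exists_elem_eq_convexHull T
  rw [hs]
  exact convex_convexHull ℝ _

theorem Mesh.exists_lipschitzOnWith_elem (M : Mesh n) {v : Euc n → ℝ} (hv : v ∈ M.feSpace)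
    (T : Fin M.card) : ∃ K, LipschitzOnWith K v (M.elem T) := by
  obtain ⟨p, -, hp⟩ := hv.2 T
  have hsm : ContDiff ℝ 1 fun y => MvPolynomial.eval (fun i => (M.aff T).symm y i) p := by
    have h1 : ContDiff ℝ 1 fun y => (M.aff T).symm y :=
      ContinuousAffineMap.contDiff ⟨(M.aff T).symm.toAffineMap,
        (M.aff T).symm.toAffineMap.continuous_of_finiteDimensional⟩
    have h2 : ContDiff ℝ 1 fun z : Euc n => MvPolynomial.eval (fun i => z i) p := by
      have := AnalyticOnNhd.eval_continuousLinearMap' (𝕜 := ℝ)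
        (fun i => (EuclideanSpace.proj i : Euc n →L[ℝ] ℝ)) p
      exact contDiffOn_univ.1 (this.contDiffOn uniqueDiffOn_univ)
    exact h2.comp h1
  obtain ⟨K, hK⟩ := hsm.contDiffOn.exists_lipschitzOnWith one_ne_zero (M.convex_elem T)
    (M.isCompact_elem T)
  refine ⟨K, fun x hx y hy => ?_⟩
  have hx' : ∀ x ∈ M.elem T, v x = MvPolynomial.eval (fun i => (M.aff T).symm x i) p := by
    rintro _ ⟨z, hz, rfl⟩
    rw [hp z hz]; simp
  rw [hx' x hx, hx' y hy]
  exact hK hx hy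

/-- The union of the elements need not be convex, so the Lipschitz constants of the elements do not
pass to it along segments. The pairwise estimates for polytopes replace this; there are finitely
many pairs. -/
theorem Mesh.exists_lipschitzOnWith (M : Mesh n) {v : Euc n → ℝ} (hv : v ∈ M.feSpace) :
    ∃ K, LipschitzOnWith K v (⋃ T, M.elem T) := by
  have hpair : ∀ p : Fin M.card × Fin M.card, ∃ C : ℝ, 0 ≤ C ∧ ∀ x ∈ M.elem p.1,
      ∀ y ∈ M.elem p.2, dist (v x) (v y) ≤ C * dist x y := fun p => by
    obtain ⟨s, hs⟩ := M.exists_elem_eq_convexHull p.1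
    obtain ⟨t, ht⟩ := M.exists_elem_eq_convexHull p.2
    obtain ⟨K, hK⟩ := M.exists_lipschitzOnWith_elem hv p.1
    obtain ⟨K', hK'⟩ := M.exists_lipschitzOnWith_elem hv p.2
    rw [hs, ht]
    exact exists_dist_le_of_lipschitzOnWith_convexHull s t (hs ▸ hK) (ht ▸ hK')
  choose C hC0 hC using hpair
  refine ⟨(∑ p, C p).toNNReal, LipschitzOnWith.of_dist_le_mul fun x hx y hy => ?_⟩
  obtain ⟨T, hT⟩ := mem_iUnion.1 hx
  obtain ⟨T', hT'⟩ := mem_iUnion.1 hy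
  rw [Real.coe_toNNReal _ (Finset.sum_nonneg fun p _ => hC0 p)]
  refine (hC (T, T') x hT y hT').trans ?_
  gcongr
  exact Finset.single_le_sum (f := C) (fun p _ => hC0 p) (Finset.mem_univ _)

end FiniteElement

/-! ### Lipschitz functions have directional derivatives and traces -/

section Lipschitz

open scoped NNReal

/-- Mollification averages translates of `f`, so it keeps the Lipschitz constant and moves the
values by at most `K` times the radius. -/
theorem LipschitzWith.exists_contDiff_approx {f : Euc n → ℝ} {K : ℝ≥0} (hf : LipschitzWith K f)
    {ε : ℝ} (hε : 0 < ε) :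
    ∃ φ : Euc n → ℝ, ContDiff ℝ ∞ φ ∧ LipschitzWith K φ ∧ ∀ x, |φ x - f x| ≤ ε := by
  obtain ⟨r, hr, hrε⟩ : ∃ r > 0, K * r ≤ ε :=
    ⟨ε / (K + 1), by positivity, by rw [← mul_div_assoc, div_le_iff₀ (by positivity)]; nlinarith⟩
  let ψ : ContDiffBump (0 : Euc n) := ⟨r / 2, r, by positivity, by linarith⟩
  let φ : Euc n → ℝ := MeasureTheory.convolution (ψ.normed volume) f
    (ContinuousLinearMap.lsmul ℝ ℝ) volume
  have hconv : ∀ x, φ x = ∫ z, ψ.normed volume z * f (x - z) := fun x => rfl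
  have hint : ∀ x, Integrable fun z => ψ.normed volume z * f (x - z) := fun x =>
    (ψ.continuous_normed.mul (hf.continuous.comp (by fun_prop))).integrable_of_hasCompactSupport
      ψ.hasCompactSupport_normed.mul_right
  refine ⟨φ, ?_, ?_, fun x => ?_⟩
  · exact ψ.hasCompactSupport_normed.contDiff_convolution_left _ ψ.contDiff_normed
      hf.continuous.locallyIntegrable
  · refine LipschitzWith.of_dist_le_mul fun x y => ?_
    rw [hconv, hconv, dist_eq_norm, ← integral_sub (hint x) (hint y)]
    calc ‖∫ z, (ψ.normed volume z * f (x - z) - ψ.normed volume z * f (y - z))‖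
        ≤ ∫ z, ψ.normed volume z * (K * dist x y) := by
          refine norm_integral_le_of_norm_le (ψ.integrable_normed.mul_const _)
            (Eventually.of_forall fun z => ?_)
          rw [← mul_sub, norm_mul, Real.norm_of_nonneg (ψ.nonneg_normed z), ← dist_eq_norm]
          refine mul_le_mul_of_nonneg_left ?_ (ψ.nonneg_normed z)
          simpa using hf.dist_le_mul (x - z) (y - z)
      _ = K * dist x y := by rw [integral_mul_const, ψ.integral_normed, one_mul]
  · refine ContDiffBump.dist_normed_convolution_le (φ := ψ) (μ := volume) (x₀ := x)
      hf.continuous.aestronglyMeasurable fun y hy => ?_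
    refine (hf.dist_le_mul y x).trans (le_trans ?_ hrε)
    gcongr
    exact (Metric.mem_ball.1 hy).le

/-- Points of nearly minimal norm form a Cauchy sequence: the midpoint of two of them is again in
the larger convex set, and the squared minimal norms `q k` increase to a finite limit. This plays
the role of weak compactness and Mazur's lemma. -/
theorem exists_tendsto_of_antitone_convex {H : Type*} [NormedAddCommGroup H]
    [InnerProductSpace ℝ H] [CompleteSpace H] {K : ℕ → Set H} (hne : ∀ k, (K k).Nonempty)
    (hK : ∀ k, Convex ℝ (K k)) (hanti : Antitone K) {R : ℝ} (hR : ∀ x ∈ K 0, ‖x‖ ≤ R) :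
    ∃ (x : ℕ → H) (g : H), (∀ k, x k ∈ K k) ∧ Tendsto x atTop (𝓝 g) := by
  set q : ℕ → ℝ := fun k => sInf ((fun x => ‖x‖ ^ 2) '' K k) with hq
  have hbdd : ∀ k, BddBelow ((fun x => ‖x‖ ^ 2) '' K k) := fun k =>
    ⟨0, by rintro _ ⟨x, -, rfl⟩; positivity⟩
  have hqle : ∀ k, ∀ x ∈ K k, q k ≤ ‖x‖ ^ 2 := fun k x hx => csInf_le (hbdd k) ⟨x, hx, rfl⟩
  have hmono : Monotone q := fun k l hkl =>
    csInf_le_csInf (hbdd k) ((hne l).image _) (image_mono (hanti hkl))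
  have hqR : ∀ k, q k ≤ R ^ 2 := fun k => by
    obtain ⟨x, hx⟩ := hne k
    exact (hqle k x hx).trans (pow_le_pow_left₀ (norm_nonneg _) (hR x (hanti (Nat.zero_le k) hx)) 2)
  have hlim := tendsto_atTop_ciSup hmono ⟨R ^ 2, by rintro _ ⟨k, rfl⟩; exact hqR k⟩
  set Q := ⨆ k, q k
  have hQ : ∀ k, q k ≤ Q := fun k => le_ciSup ⟨R ^ 2, by rintro _ ⟨k, rfl⟩; exact hqR k⟩ k
  have hx : ∀ k : ℕ, ∃ x ∈ K k, ‖x‖ ^ 2 < q k + 1 / ((k : ℝ) + 1) := fun k => by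
    obtain ⟨_, ⟨x, hx, rfl⟩, hlt⟩ := exists_lt_of_csInf_lt ((hne k).image fun x => ‖x‖ ^ 2)
      (show sInf _ < q k + 1 / ((k : ℝ) + 1) from lt_add_of_pos_right _ (by positivity))
    exact ⟨x, hx, hlt⟩
  choose x hxK hxq using hx
  -- The parallelogram law bounds the squared distance by `2(q k + q l) + 4/(k+1) - 4 q k`, and `q l
  -- ≤ Q`.
  have hdist : ∀ k l, k ≤ l → dist (x k) (x l) ≤ √(2 * (Q - q k) + 4 / ((k : ℝ) + 1)) := by
    intro k l hkl
    rw [dist_eq_norm]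
    refine Real.le_sqrt_of_sq_le ?_
    have hmid : (1 / 2 : ℝ) • x k + (1 / 2 : ℝ) • x l ∈ K k :=
      hK k (hxK k) (hanti hkl (hxK l)) (by norm_num) (by norm_num) (by norm_num)
    have h1 := hqle k _ hmid
    rw [← smul_add, norm_smul, mul_pow] at h1
    have h2 := parallelogram_law_with_norm ℝ (x k) (x l)
    have h3 : 1 / ((l : ℝ) + 1) ≤ 1 / ((k : ℝ) + 1) := by gcongr
    have h4 := hxq k
    have h5 := hxq l
    have h6 := hQ l
    have h7 : (4 : ℝ) / ((k : ℝ) + 1) = 4 * (1 / ((k : ℝ) + 1)) := by ring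
    norm_num at h1
    rw [h7]
    nlinarith
  have hb : Tendsto (fun k : ℕ => √(2 * (Q - q k) + 4 / ((k : ℝ) + 1))) atTop (𝓝 0) := by
    have h4 : Tendsto (fun k : ℕ => (4 : ℝ) / ((k : ℝ) + 1)) atTop (𝓝 0) := by
      simpa [div_eq_mul_inv] using (tendsto_one_div_add_atTop_nhds_zero_nat (𝕜 := ℝ)).const_mul 4
    have := (((tendsto_const_nhds (x := Q)).sub hlim).const_mul 2).add h4
    simpa [Function.comp_def] using (Real.continuous_sqrt.tendsto _).comp this
  obtain ⟨g, hg⟩ := cauchySeq_tendsto_of_complete (cauchySeq_of_le_tendsto_0' _ hdist hb)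
  exact ⟨x, g, hxK, hg⟩

end Lipschitz

theorem tendsto_eLpNorm_zero_of_bound {X : Type*} [MeasurableSpace X] {μ : Measure X}
    [IsFiniteMeasure μ] {u : ℕ → X → ℝ} {c : ℕ → ℝ} (hu : ∀ k, ∀ᵐ x ∂μ, ‖u k x‖ ≤ c k)
    (hc : Tendsto c atTop (𝓝 0)) : Tendsto (fun k => eLpNorm (u k) 2 μ) atTop (𝓝 0) := by
  refine tendsto_of_tendsto_of_tendsto_of_le_of_le tendsto_const_nhds ?_
    (fun k => zero_le) fun k => eLpNorm_le_of_ae_bound (hu k)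
  have h1 := (ENNReal.continuous_ofReal.tendsto _).comp hc
  have h2 : μ univ ^ (2 : ℝ≥0∞).toReal⁻¹ ≠ ⊤ :=
    ENNReal.rpow_ne_top_of_nonneg (by simp) (measure_ne_top _ _)
  simpa [Function.comp_def] using ENNReal.Tendsto.const_mul h1 (Or.inr h2)

-- Smooth approximations converge to `f` uniformly, which settles the values and the trace. Their
-- directional derivatives on the possibly lower dimensional `S` are only known to be bounded in
-- `L²`. But the derivatives of approximations with accuracy `1/(k+1)` and gradient at most `K` form
-- nested bounded convex sets, from which a convergent sequence can be selected.
open scoped NNReal in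
theorem HasCornerCharts.exists_hasDirDerivTrace_of_lipschitzWith {d : ℕ} {S : Set (Euc n)}
    (h : HasCornerCharts d S) {b : Euc n → Euc n} (hb : ContDiff ℝ ∞ b)
    (htan : ∀ x ∈ S, b x ∈ tangentSpaceAt S x) {f : Euc n → ℝ} {K : ℝ≥0}
    (hf : LipschitzWith K f) : ∃ g, HasDirDerivTrace d S b f g f := by
  have := h.isFiniteMeasure_surf
  have := h.isFiniteMeasure_surfBdry
  have hD : ∀ {φ : Euc n → ℝ}, ContDiff ℝ ∞ φ →
      MemLp (fun x => fderiv ℝ φ x (b x)) 2 (surf d S) := fun hφ =>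
    h.memLp_surf ((hφ.continuous_fderiv (by simp)).clm_apply hb.continuous).continuousOn
  have hB : MemLp (fun x => K * ‖b x‖) 2 (surf d S) :=
    h.memLp_surf (hb.continuous.norm.const_mul _).continuousOn
  let A : ℕ → Set (Lp ℝ 2 (surf d S)) := fun k => {y | ∃ φ : Euc n → ℝ, ∃ hφ : ContDiff ℝ ∞ φ,
    (∀ x, ‖fderiv ℝ φ x‖ ≤ K) ∧ (∀ x, |φ x - f x| ≤ 1 / ((k : ℝ) + 1)) ∧ (hD hφ).toLp = y}
  have hne : ∀ k, (A k).Nonempty := by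
    intro k
    obtain ⟨φ, hφ, hφK, hφf⟩ := hf.exists_contDiff_approx (ε := 1 / ((k : ℝ) + 1)) (by positivity)
    exact ⟨_, φ, hφ, fun x => norm_fderiv_le_of_lipschitz ℝ hφK, hφf, rfl⟩
  have hconv : ∀ k, Convex ℝ (A k) := by
    rintro k _ ⟨φ, hφ, hφK, hφf, rfl⟩ _ ⟨χ, hχ, hχK, hχf, rfl⟩ a c ha hc hac
    have hfd : ∀ x, fderiv ℝ (a • φ + c • χ) x = a • fderiv ℝ φ x + c • fderiv ℝ χ x := fun x => by
      have h1 := (hφ.differentiable (by simp) x).const_smul a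
      have h2 := (hχ.differentiable (by simp) x).const_smul c
      rw [fderiv_add h1 h2, fderiv_const_smul (hφ.differentiable (by simp) x),
        fderiv_const_smul (hχ.differentiable (by simp) x)]
    refine ⟨a • φ + c • χ, (contDiff_const.smul hφ).add (contDiff_const.smul hχ), fun x => ?_,
      fun x => ?_, ?_⟩
    · rw [hfd]
      refine (norm_add_le _ _).trans ?_
      rw [norm_smul, norm_smul, Real.norm_of_nonneg ha, Real.norm_of_nonneg hc]
      calc a * ‖fderiv ℝ φ x‖ + c * ‖fderiv ℝ χ x‖ ≤ a * K + c * K := by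
            gcongr
            exacts [hφK x, hχK x]
        _ = K := by rw [← add_mul, hac, one_mul]
    · have : (a • φ + c • χ) x - f x = a * (φ x - f x) + c * (χ x - f x) := by
        simp only [Pi.add_apply, Pi.smul_apply, smul_eq_mul]
        linear_combination (- f x) * hac.symm
      rw [this]
      refine (abs_add_le _ _).trans ?_
      rw [abs_mul, abs_mul, abs_of_nonneg ha, abs_of_nonneg hc]
      calc a * |φ x - f x| + c * |χ x - f x| ≤
          a * (1 / ((k : ℝ) + 1)) + c * (1 / ((k : ℝ) + 1)) := by
            gcongr
            exacts [hφf x, hχf x]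
        _ = _ := by rw [← add_mul, hac, one_mul]
    · rw [← MemLp.toLp_const_smul, ← MemLp.toLp_const_smul, ← MemLp.toLp_add]
      refine (MemLp.toLp_eq_toLp_iff _ _).2 (Eventually.of_forall fun x => ?_)
      simp only [hfd]
      rfl
  have hanti : Antitone A := by
    rintro k l hkl _ ⟨φ, hφ, hφK, hφf, rfl⟩
    refine ⟨φ, hφ, hφK, fun x => (hφf x).trans ?_, rfl⟩
    gcongr
  have hR : ∀ y ∈ A 0, ‖y‖ ≤ ‖hB.toLp‖ := by
    rintro _ ⟨φ, hφ, hφK, -, rfl⟩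
    refine Lp.norm_le_norm_of_ae_le ?_
    filter_upwards [(hD hφ).coeFn_toLp, hB.coeFn_toLp] with x h1 h2
    rw [h1, h2]
    refine (ContinuousLinearMap.le_opNorm _ _).trans (le_trans ?_ (le_abs_self _))
    gcongr
    exact hφK x
  obtain ⟨y, g, hy, hlim⟩ := exists_tendsto_of_antitone_convex hne hconv hanti hR
  choose φ hφ hφK hφf hφy using hy
  refine ⟨g, h.memLp_surf hf.continuous.continuousOn, Lp.memLp g,
    hf.continuous.aestronglyMeasurable, φ, hφ, ?_, ?_, ?_⟩
  · exact tendsto_eLpNorm_zero_of_bound (fun k => Eventually.of_forall fun x => hφf k x)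
      tendsto_one_div_add_atTop_nhds_zero_nat
  · have h1 := (Lp.tendsto_Lp_iff_tendsto_eLpNorm'' _ (fun k => hD (hφ k)) g (Lp.memLp g)).1
      (by simpa only [hφy, Lp.toLp_coeFn] using hlim)
    refine h1.congr fun k => eLpNorm_congr_ae ?_
    filter_upwards [ae_restrict_mem h.measurableSet] with x hx
    rw [inner_tangentialGradient (htan x hx)]
    rfl
  · obtain ⟨M, hM⟩ := h.ae_abs_normal_le hb
    refine tendsto_eLpNorm_zero_of_bound (c := fun k => √M * (1 / ((k : ℝ) + 1))) (fun k => ?_)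
      (by simpa using tendsto_one_div_add_atTop_nhds_zero_nat.const_mul (√M))
    filter_upwards [hM] with x hx
    rw [norm_mul, Real.norm_of_nonneg (Real.sqrt_nonneg _)]
    exact mul_le_mul (Real.sqrt_le_sqrt hx) (hφf k x) (norm_nonneg _) (Real.sqrt_nonneg _)

/-! ### Changes on null sets and sums of functions with a derivative and a trace -/

namespace HasDirDerivTrace

variable {d : ℕ} {S : Set (Euc n)} {b : Euc n → Euc n} {v g t v' g' t' : Euc n → ℝ}

theorem congr_ae (hv : HasDirDerivTrace d S b v g t) (h : v =ᵐ[surf d S] v')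
    (ht : t =ᵐ[surfBdry d S] t') : HasDirDerivTrace d S b v' g t' := by
  obtain ⟨h1, h2, h3, φ, hφ, l1, l2, l3⟩ := hv
  refine ⟨h1.ae_eq h, h2, h3.congr ht, φ, hφ, l1.congr fun k => eLpNorm_congr_ae ?_, l2,
    l3.congr fun k => eLpNorm_congr_ae ?_⟩
  · filter_upwards [h] with x hx
    rw [hx]
  · filter_upwards [ht] with x hx
    rw [hx]

theorem add (h : HasCornerCharts d S) (hb : ContDiff ℝ ∞ b)
    (htan : ∀ x ∈ S, b x ∈ tangentSpaceAt S x) (hv : HasDirDerivTrace d S b v g t)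
    (hv' : HasDirDerivTrace d S b v' g' t') :
    HasDirDerivTrace d S b (v + v') (g + g') (t + t') := by
  have ht2 := h.memLp_sqrt_normal_mul_trace hb htan hv
  have ht2' := h.memLp_sqrt_normal_mul_trace hb htan hv'
  have hs := fun {φ : Euc n → ℝ} (hφ : ContDiff ℝ ∞ φ) => h.memLp_sqrt_normal_mul hb htan
    (h.memLp_surfBdry hφ.continuous.continuousOn)
  obtain ⟨h1, h2, h3, φ, hφ, l1, l2, l3⟩ := hv
  obtain ⟨h1', h2', h3', φ', hφ', l1', l2', l3'⟩ := hv'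
  have key : ∀ {μ : Measure (Euc n)} {p q : ℕ → Euc n → ℝ},
      (∀ k, MemLp (p k) 2 μ) → (∀ k, MemLp (q k) 2 μ) →
      Tendsto (fun k => eLpNorm (p k) 2 μ) atTop (𝓝 0) →
      Tendsto (fun k => eLpNorm (q k) 2 μ) atTop (𝓝 0) →
      Tendsto (fun k => eLpNorm (p k + q k) 2 μ) atTop (𝓝 0) := fun hp hq lp lq =>
    tendsto_of_tendsto_of_tendsto_of_le_of_le tendsto_const_nhds
      (by simpa using lp.add lq) (fun _ => zero_le)
      fun k => eLpNorm_add_le (hp k).1 (hq k).1 (by norm_num)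
  have m := fun {φ : Euc n → ℝ} (hφ : ContDiff ℝ ∞ φ) =>
    h.memLp_surf hφ.continuous.continuousOn
  refine ⟨h1.add h1', h2.add h2', h3.add h3', fun k => φ k + φ' k,
    fun k => (hφ k).add (hφ' k), ?_, ?_, ?_⟩
  · refine (key (fun k => (m (hφ k)).sub h1) (fun k => (m (hφ' k)).sub h1') l1 l1').congr
      fun k => congrArg (eLpNorm · 2 _) (funext fun x => ?_)
    simp only [Pi.add_apply, Pi.sub_apply]
    ring
  · refine (key (fun k => (h.memLp_dirDeriv hb htan (hφ k)).sub h2)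
      (fun k => (h.memLp_dirDeriv hb htan (hφ' k)).sub h2') l2 l2').congr
      fun k => eLpNorm_congr_ae ?_
    filter_upwards [ae_restrict_mem h.measurableSet] with x hx
    simp only [Pi.add_apply, Pi.sub_apply, inner_tangentialGradient (htan x hx)]
    rw [fderiv_add ((hφ k).differentiable (by simp) x) ((hφ' k).differentiable (by simp) x),
      add_apply]
    ring
  · refine (key (fun k => ((hs (hφ k)).sub ht2).ae_eq (.of_forall fun x => (mul_sub _ _ _).symm))
      (fun k => ((hs (hφ' k)).sub ht2').ae_eq (.of_forall fun x => (mul_sub _ _ _).symm)) l3 l3').congr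
      fun k => congrArg (eLpNorm · 2 _) (funext fun x => ?_)
    simp only [Pi.add_apply]
    ring

theorem dirDerivTrace_spec (hv : HasDirDerivTrace d S b v g t) :
    HasDirDerivTrace d S b v (dirDerivTrace d S b v).1 (dirDerivTrace d S b v).2 := by
  have h : ∃ p : (Euc n → ℝ) × (Euc n → ℝ), HasDirDerivTrace d S b v p.1 p.2 := ⟨(g, t), hv⟩
  rw [dirDerivTrace, dif_pos h]
  exact h.choose_spec

end HasDirDerivTrace

/-! ### The discrete space is contained in the domain of the directional derivative -/

namespace FracturedDomain

variable (D : FracturedDomain n)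

theorem comp_subset (d : ℕ) (i : Fin (D.N d)) : D.comp d i ⊆ D.Ω := by
  rw [← D.iUnion_comp]
  exact subset_iUnion₂_of_subset d i Subset.rfl

theorem le_of_comp {d : ℕ} (i : Fin (D.N d)) : d ≤ n := by
  by_contra! h
  exact (Fin.cast (D.N_eq_zero d h) i).elim0

theorem hasCornerCharts (d : ℕ) (i : Fin (D.N d)) : HasCornerCharts d (D.comp d i) :=
  ⟨fun _ hp => (D.submanifold d i).exists_chart (D.le_of_comp i) hp,
    (D.isBounded_Ω.subset (D.comp_subset d i)).isCompact_closure⟩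

namespace Discretization

variable {D} (A : D.Discretization) {β : D.Field (Euc n)} {h : ℝ}

/-- The elements cover `closure Ω₀`, which contains the closure of the component, so the Lipschitz
extension to `ℝⁿ` changes neither the values nor the trace. -/
theorem exists_hasDirDerivTrace_of_mem_Vh (hβ : D.IsSmoothTangential β) (hh : h ∈ Ioc 0 A.h₀)
    {w : D.Field ℝ} (hw : w ∈ A.Vh h) (d : ℕ) (i : Fin (D.N d)) :
    ∃ g t, HasDirDerivTrace d (D.comp d i) (β d i) (w d i) g t := by
  have hS := D.hasCornerCharts d i
  obtain ⟨K, hK⟩ := (A.mesh h).exists_lipschitzOnWith (hw d i)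
  rw [A.iUnion_elem h hh] at hK
  obtain ⟨f, hf, hfe⟩ := hK.extend_real
  have hcl : closure (D.comp d i) ⊆ closure A.Ω₀ :=
    closure_mono ((D.comp_subset d i).trans A.subset_Ω₀)
  obtain ⟨g, hg⟩ := hS.exists_hasDirDerivTrace_of_lipschitzWith (hβ d i).1 (hβ d i).2 hf
  refine ⟨g, w d i, hg.congr_ae ?_ ?_⟩
  · filter_upwards [ae_restrict_mem hS.measurableSet] with x hx
    exact (hfe (hcl (subset_closure hx))).symm
  · filter_upwards [ae_restrict_mem hS.isClosed_bdry.measurableSet] with x hx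
    exact (hfe (hcl hx.1)).symm

/-- Of the extension operators only the equality `Ext u = u` on the component enters, so neither
they nor the mesh affect the constants below. -/
theorem W_subset_Vβ (hβ : D.IsSmoothTangential β) (hh : h ∈ Ioc 0 A.h₀) : A.W β h ⊆ D.Vβ β := by
  rintro v ⟨u, ⟨⟨u', hu', hu⟩, -⟩, w, hw, hv⟩ d i
  have hS := D.hasCornerCharts d i
  obtain ⟨g, t, hgt⟩ := hu' d i
  obtain ⟨g', t', hgt'⟩ := A.exists_hasDirDerivTrace_of_mem_Vh hβ hh hw d i
  refine ⟨g + g', t + t', (hgt.add hS (hβ d i).1 (hβ d i).2 hgt').congr_ae ?_ EventuallyEq.rfl⟩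
  filter_upwards [ae_restrict_mem hS.measurableSet] with x hx
  rw [hv, Pi.add_apply, Pi.add_apply, hu, (A.isExtension d i).extends_val _ hgt.1 hx]

end Discretization

end FracturedDomain

/-! ### Integrability of the traces, jumps and derivatives -/

theorem abs_integral_le_sqrt_mul_sqrt {X : Type*} [MeasurableSpace X] {μ : Measure X}
    {F f g : X → ℝ} (hf : MemLp f 2 μ) (hg : MemLp g 2 μ) (hF : ∀ᵐ x ∂μ, |F x| ≤ |f x| * |g x|) :
    |∫ x, F x ∂μ| ≤ √(∫ x, f x ^ 2 ∂μ) * √(∫ x, g x ^ 2 ∂μ) := by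
  have hn : ∀ {u : X → ℝ} (hu : MemLp u 2 μ), ‖hu.abs.toLp‖ = √(∫ x, u x ^ 2 ∂μ) := fun hu => by
    rw [← Real.sqrt_sq (norm_nonneg hu.abs.toLp), ← real_inner_self_eq_norm_sq, L2.inner_def]
    congr 1
    refine integral_congr_ae ?_
    filter_upwards [hu.abs.coeFn_toLp] with x hx
    rw [hx]
    simp [pow_two]
  have hi : ⟪hf.abs.toLp, hg.abs.toLp⟫ = ∫ x, |f x| * |g x| ∂μ := by
    rw [L2.inner_def]
    refine integral_congr_ae ?_
    filter_upwards [hf.abs.coeFn_toLp, hg.abs.coeFn_toLp] with x hx hy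
    rw [hx, hy]
    simp [mul_comm]
  have hint : Integrable (fun x => |f x| * |g x|) μ := hf.abs.integrable_mul hg.abs
  calc |∫ x, F x ∂μ| ≤ ∫ x, |f x| * |g x| ∂μ := by
        rw [← Real.norm_eq_abs]
        exact norm_integral_le_of_norm_le hint hF
    _ ≤ _ := by
      rw [← hi, ← hn hf, ← hn hg]
      exact real_inner_le_norm _ _

theorem integral_eq_sub_of_forall {X : Type*} [MeasurableSpace X] {μ : Measure X} {F f g : X → ℝ}
    (hf : Integrable f μ) (hg : Integrable g μ) (h : ∀ x, F x = f x - g x) :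
    ∫ x, F x ∂μ = ∫ x, f x ∂μ - ∫ x, g x ∂μ := by
  rw [← integral_sub hf hg]
  exact integral_congr_ae (.of_forall h)

namespace FracturedDomain

variable (D : FracturedDomain n)

open Classical in
/-- The values on `∂Ω_{d,i}` of the functions `v_{d-1,j}`. -/
def lower (v : D.Field ℝ) : D.Field ℝ :=
  fun d _ x => ∑ j, if x ∈ D.comp (d - 1) j then v (d - 1) j x else 0

/-- The integral of `[v][w]` over all boundaries with the weight `f`. -/
def bdryForm (β : D.Field (Euc n)) (f v w : D.Field ℝ) : ℝ :=
  ∑ d ∈ Finset.range (n + 1), ∑ i,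
    ∫ x, f d i x * D.jump β v d i x * D.jump β w d i x ∂surfBdry d (D.comp d i)

variable {D} {β : D.Field (Euc n)} {α v w : D.Field ℝ} {d : ℕ} {i : Fin (D.N d)}

theorem trace_eq (x : Euc n) : D.trace β v d i x = D.jump β v d i x + D.lower v d i x := by
  simp [jump, lower]

/-- `Ω` is open and contains all components, so none of them meets its frontier. -/
theorem lower_eq_zero_of_mem_frontier {x : Euc n} (hx : x ∈ frontier D.Ω) :
    D.lower v d i x = 0 := by
  refine Finset.sum_eq_zero fun j _ => if_neg fun h => ?_
  rw [D.isOpen_Ω.frontier_eq] at hx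
  exact hx.2 (D.comp_subset _ j h)

/-- Components of the same dimension are disjoint: at most one summand is nonzero, and there are no
cross terms. -/
theorem lower_mul (x : Euc n) :
    D.lower (fun d i x => v d i x * w d i x) d i x = D.lower v d i x * D.lower w d i x := by
  classical
  simp only [lower, Finset.sum_mul_sum]
  refine Finset.sum_congr rfl fun j _ => ?_
  rw [Finset.sum_eq_single j]
  · split_ifs <;> simp
  · intro k _ hk
    by_cases hj : x ∈ D.comp (d - 1) j
    · rw [if_neg (c := x ∈ D.comp (d - 1) k), mul_zero]
      have hne : (⟨d - 1, j⟩ : Σ d, Fin (D.N d)) ≠ ⟨d - 1, k⟩ := fun h => hk (by simpa using h.symm)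
      exact disjoint_left.1 (D.disjoint_comp _ _ hne) hj
    · rw [if_neg hj, zero_mul]
  · simp

theorem measurableSet_comp (d : ℕ) (i : Fin (D.N d)) : MeasurableSet (D.comp d i) :=
  (D.hasCornerCharts d i).measurableSet

theorem measurableSet_bdry (d : ℕ) (i : Fin (D.N d)) : MeasurableSet (bdry (D.comp d i)) :=
  (D.hasCornerCharts d i).isClosed_bdry.measurableSet

/-- The measures on `Ω_{d,i}` and on `∂Ω_{d+1,j}` are restrictions of the same Hausdorff measure, so
extension by zero transfers integrability between them. -/
theorem memLp_sumJump {F : D.Field ℝ} {p : ℝ≥0∞}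
    (hF : ∀ d i, MemLp (F d i) p (surfBdry d (D.comp d i))) (d : ℕ) (i : Fin (D.N d)) :
    MemLp (D.sumJump F d i) p (surf d (D.comp d i)) := by
  classical
  refine memLp_finsetSum _ fun j _ => ?_
  exact ((memLp_indicator_iff_restrict (measurableSet_bdry (d + 1) j)).2 (hF (d + 1) j)).restrict _

theorem memLp_lower (hv : ∀ d i, MemLp (v d i) 2 (surf d (D.comp d i))) (d : ℕ)
    (i : Fin (D.N d)) : MemLp (D.lower v d i) 2 (surfBdry d (D.comp d i)) := by
  classical
  refine memLp_finsetSum _ fun j _ => ?_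
  exact ((memLp_indicator_iff_restrict (measurableSet_comp (d - 1) j)).2 (hv (d - 1) j)).restrict _

theorem hasDirDerivTrace_of_mem_Vβ (hv : v ∈ D.Vβ β) (d : ℕ) (i : Fin (D.N d)) :
    HasDirDerivTrace d (D.comp d i) (β d i) (v d i)
      (dirDerivTrace d (D.comp d i) (β d i) (v d i)).1 (D.trace β v d i) :=
  have ⟨_, _, h⟩ := hv d i
  h.dirDerivTrace_spec

theorem memLp_of_mem_Vβ (hv : v ∈ D.Vβ β) (d : ℕ) (i : Fin (D.N d)) :
    MemLp (v d i) 2 (surf d (D.comp d i)) :=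
  (hasDirDerivTrace_of_mem_Vβ hv d i).1

theorem aestronglyMeasurable_normalFlux (hβ : D.IsSmoothTangential β) (d : ℕ) (i : Fin (D.N d)) :
    AEStronglyMeasurable (D.normalFlux β d i) (surfBdry d (D.comp d i)) :=
  (D.hasCornerCharts d i).aestronglyMeasurable_normal (hβ d i).1 (hβ d i).2

theorem memLp_top_normalFlux (hβ : D.IsSmoothTangential β) (d : ℕ) (i : Fin (D.N d)) :
    MemLp (D.normalFlux β d i) ⊤ (surfBdry d (D.comp d i)) := by
  obtain ⟨M, hM⟩ := (D.hasCornerCharts d i).ae_abs_normal_le (hβ d i).1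
  exact memLp_top_of_bound (aestronglyMeasurable_normalFlux hβ d i) M hM

theorem aestronglyMeasurable_jump (hv : v ∈ D.Vβ β) (d : ℕ) (i : Fin (D.N d)) :
    AEStronglyMeasurable (D.jump β v d i) (surfBdry d (D.comp d i)) :=
  (hasDirDerivTrace_of_mem_Vβ hv d i).2.2.1.sub (memLp_lower (memLp_of_mem_Vβ hv) d i).1

theorem memLp_sqrt_mul_jump (hβ : D.IsSmoothTangential β) (hv : v ∈ D.Vβ β) (d : ℕ)
    (i : Fin (D.N d)) :
    MemLp (fun x => √|D.normalFlux β d i x| * D.jump β v d i x) 2 (surfBdry d (D.comp d i)) := by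
  have h := D.hasCornerCharts d i
  refine ((h.memLp_sqrt_normal_mul_trace (hβ d i).1 (hβ d i).2
    (hasDirDerivTrace_of_mem_Vβ hv d i)).sub (h.memLp_sqrt_normal_mul (hβ d i).1 (hβ d i).2
    (memLp_lower (memLp_of_mem_Vβ hv) d i))).ae_eq (.of_forall fun x => ?_)
  exact (mul_sub _ _ _).symm

theorem memLp_normalFlux_mul_jump (hβ : D.IsSmoothTangential β) (hv : v ∈ D.Vβ β) (d : ℕ)
    (i : Fin (D.N d)) :
    MemLp (fun x => D.normalFlux β d i x * D.jump β v d i x) 2 (surfBdry d (D.comp d i)) := by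
  have h := D.hasCornerCharts d i
  refine (h.memLp_sqrt_normal_mul (hβ d i).1 (hβ d i).2 (memLp_sqrt_mul_jump hβ hv d i)).of_le
    ((aestronglyMeasurable_normalFlux hβ d i).mul (aestronglyMeasurable_jump hv d i))
    (.of_forall fun x => le_of_eq ?_)
  rw [norm_mul, norm_mul, norm_mul, ← mul_assoc, Real.norm_of_nonneg (Real.sqrt_nonneg _),
    Real.norm_of_nonneg (Real.sqrt_nonneg _)]
  exact congrArg (· * _) (Real.mul_self_sqrt (abs_nonneg _)).symm

theorem memLp_Dβ (hβ : D.IsSmoothTangential β) (hv : v ∈ D.Vβ β) (d : ℕ) (i : Fin (D.N d)) :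
    MemLp (D.Dβ β v d i) 2 (surf d (D.comp d i)) :=
  (hasDirDerivTrace_of_mem_Vβ hv d i).2.1.sub (memLp_sumJump (memLp_normalFlux_mul_jump hβ hv) d i)

theorem memLp_top_tangentialDiv (hβ : D.IsSmoothTangential β) (d : ℕ) (i : Fin (D.N d)) :
    MemLp (tangentialDiv (D.comp d i) (β d i)) ⊤ (surf d (D.comp d i)) := by
  have h := D.hasCornerCharts d i
  obtain ⟨M, hM⟩ := h.exists_bound_tangentialDiv (hβ d i).1
  exact memLp_top_of_bound (h.aestronglyMeasurable_tangentialDiv (hβ d i).1) M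
    ((ae_restrict_mem h.measurableSet).mono hM)

theorem memLp_top_Div (hβ : D.IsSmoothTangential β) (d : ℕ) (i : Fin (D.N d)) :
    MemLp (D.Div β d i) ⊤ (surf d (D.comp d i)) :=
  (memLp_top_tangentialDiv hβ d i).sub (memLp_sumJump (memLp_top_normalFlux hβ) d i)

theorem memLp_L (hβ : D.IsSmoothTangential β) (hα : ∀ d i, MemLp (α d i) ⊤ (surf d (D.comp d i)))
    (hv : v ∈ D.Vβ β) (d : ℕ) (i : Fin (D.N d)) :
    MemLp (D.L β α v d i) 2 (surf d (D.comp d i)) :=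
  (memLp_Dβ hβ hv d i).add
    (MemLp.mul (p := ⊤) (q := 2) (memLp_of_mem_Vβ hv d i) ((hα d i).add (memLp_top_Div hβ d i)))

theorem integrable_mul_jump_mul_jump (hβ : D.IsSmoothTangential β) (hv : v ∈ D.Vβ β)
    (hw : w ∈ D.Vβ β) {f : Euc n → ℝ} (hf : AEStronglyMeasurable f (surfBdry d (D.comp d i)))
    (hle : ∀ x, |f x| ≤ |D.normalFlux β d i x|) :
    Integrable (fun x => f x * D.jump β v d i x * D.jump β w d i x)
      (surfBdry d (D.comp d i)) := by
  refine ((memLp_sqrt_mul_jump hβ hv d i).integrable_mul (memLp_sqrt_mul_jump hβ hw d i)).mono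
    ((hf.mul (aestronglyMeasurable_jump hv d i)).mul (aestronglyMeasurable_jump hw d i))
    (.of_forall fun x => ?_)
  simp only [Pi.mul_apply, norm_mul, Real.norm_eq_abs]
  rw [abs_of_nonneg (Real.sqrt_nonneg _), mul_mul_mul_comm, Real.mul_self_sqrt (abs_nonneg _),
    mul_assoc]
  exact mul_le_mul_of_nonneg_right (hle x) (by positivity)

/-! ### Integration by parts on the fractured domain -/

theorem innerI_add_innerB (hβ : D.IsSmoothTangential β) (hv : v ∈ D.Vβ β)
    (hw : w ∈ D.Vβ β) {f : D.Field ℝ}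
    (hf : ∀ d i, AEStronglyMeasurable (f d i) (surfBdry d (D.comp d i)))
    (hle : ∀ d i x, |f d i x| ≤ |D.normalFlux β d i x|) :
    D.innerI (fun d i x => f d i x * D.jump β v d i x) (D.jump β w) +
      D.innerB (fun d i x => f d i x * D.trace β v d i x) (D.trace β w) =
    D.bdryForm β f v w := by
  rw [innerI, innerB, bdryForm, ← Finset.sum_add_distrib]
  refine Finset.sum_congr rfl fun d _ => ?_
  rw [← Finset.sum_add_distrib]
  refine Finset.sum_congr rfl fun i _ => ?_
  have hfr : MeasurableSet (frontier D.Ω) := isClosed_frontier.measurableSet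
  rw [← integral_add_compl hfr (integrable_mul_jump_mul_jump hβ hv hw (hf d i) (hle d i)),
    add_comm]
  congr 1
  refine setIntegral_congr_fun hfr fun x hx => ?_
  simp only [trace_eq, lower_eq_zero_of_mem_frontier hx, add_zero]

/-- Both sides are the sum over all pairs `Ω_{d,i}`, `Ω_{d+1,j}` of the integral of `F_{d+1,j}
u_{d,i}` over `Ω_{d,i} ∩ ∂Ω_{d+1,j}`. -/
theorem integral_sumJump_mul {F u : D.Field ℝ}
    (hF : ∀ d i j, IntegrableOn (fun x => F (d + 1) j x * u d i x)
      (D.comp d i ∩ bdry (D.comp (d + 1) j)) μHE[d]) :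
    ∑ d ∈ Finset.range (n + 1), ∑ i, ∫ x, D.sumJump F d i x * u d i x ∂surf d (D.comp d i) =
    ∑ d ∈ Finset.range (n + 1), ∑ i,
      ∫ x, F d i x * D.lower u d i x ∂surfBdry d (D.comp d i) := by
  classical
  have hl : ∀ d i, ∫ x, D.sumJump F d i x * u d i x ∂surf d (D.comp d i) =
      ∑ j, ∫ x in D.comp d i ∩ bdry (D.comp (d + 1) j), F (d + 1) j x * u d i x ∂μHE[d] := by
    intro d i
    have he : (fun x => D.sumJump F d i x * u d i x) = fun x => ∑ j,
        (bdry (D.comp (d + 1) j)).indicator (fun x => F (d + 1) j x * u d i x) x := by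
      ext x
      simp [sumJump, Finset.sum_mul, indicator_apply]
    rw [he]
    rw [integral_finsetSum]
    · refine Finset.sum_congr rfl fun j _ => ?_
      rw [surf, setIntegral_indicator (measurableSet_bdry _ _)]
    · intro j _
      rw [integrable_indicator_iff (measurableSet_bdry _ _), IntegrableOn, surf,
        Measure.restrict_restrict (measurableSet_bdry _ _), inter_comm]
      exact hF d i j
  have hr : ∀ d j, ∫ x, F (d + 1) j x * D.lower u (d + 1) j x ∂surfBdry (d + 1) (D.comp (d + 1) j) =
      ∑ i, ∫ x in D.comp d i ∩ bdry (D.comp (d + 1) j), F (d + 1) j x * u d i x ∂μHE[d] := by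
    intro d j
    have he : (fun x => F (d + 1) j x * D.lower u (d + 1) j x) = fun x => ∑ i : Fin (D.N d),
        (D.comp d i).indicator (fun x => F (d + 1) j x * u d i x) x := by
      ext x
      simp [lower, Finset.mul_sum, indicator_apply]
    rw [he, surfBdry, Nat.add_sub_cancel]
    rw [integral_finsetSum]
    · refine Finset.sum_congr rfl fun i _ => ?_
      rw [surf, setIntegral_indicator (measurableSet_comp _ _), inter_comm]
    · intro i _
      rw [integrable_indicator_iff (measurableSet_comp _ _), IntegrableOn, surf,
        Measure.restrict_restrict (measurableSet_comp _ _)]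
      exact hF d i j
  -- Shift of the dimension by one: the left side has no term for `d = n`, as there are no
  -- components of dimension `n + 1`, and the right side has none for `d = 0`, as points have no
  -- boundary.
  rw [Finset.sum_range_succ, Finset.sum_range_succ' (fun d => ∑ i, ∫ x, F d i x * D.lower u d i x
    ∂surfBdry d (D.comp d i))]
  congr 1
  · refine Finset.sum_congr rfl fun d _ => ?_
    simp only [hl, hr]
    exact Finset.sum_comm
  · have h0 : IsEmpty (Fin (D.N (n + 1))) := by
      rw [D.N_eq_zero _ n.lt_succ_self]; infer_instance
    rw [Finset.sum_eq_zero fun i _ => by rw [hl]; exact Finset.sum_of_isEmpty _,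
      Finset.sum_eq_zero fun i _ => ?_]
    rw [surfBdry, surf, (D.hasCornerCharts 0 i).bdry_eq_empty, Measure.restrict_empty,
      integral_zero_measure]

/-- Integration by parts on the fractured domain. -/
theorem inner_Dβ_add_inner_Dβ (hβ : D.IsSmoothTangential β) (hv : v ∈ D.Vβ β) (hw : w ∈ D.Vβ β) :
    D.inner𝒪 (D.Dβ β v) w + D.inner𝒪 v (D.Dβ β w) +
      D.inner𝒪 (fun d i x => D.Div β d i x * v d i x) w =
    D.bdryForm β (D.normalFlux β) v w := by
  have hdv := fun d i => hasDirDerivTrace_of_mem_Vβ hv d i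
  have hdw := fun d i => hasDirDerivTrace_of_mem_Vβ hw d i
  have hv2 := memLp_of_mem_Vβ hv
  have hw2 := memLp_of_mem_Vβ hw
  have hFv := memLp_normalFlux_mul_jump hβ hv
  have hFw := memLp_normalFlux_mul_jump hβ hw
  have hJv := memLp_sumJump hFv
  have hJw := memLp_sumJump hFw
  have hJ := memLp_sumJump (memLp_top_normalFlux hβ)
  have hT := memLp_top_tangentialDiv hβ
  have hvw : ∀ d i, Integrable (fun x => v d i x * w d i x) (surf d (D.comp d i)) := fun d i =>
    (hv2 d i).integrable_mul (hw2 d i)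
  have restr : ∀ {d : ℕ} {i : Fin (D.N d)} {j : Fin (D.N (d + 1))} {f : Euc n → ℝ} {p : ℝ≥0∞},
      MemLp f p (surf d (D.comp d i)) →
      MemLp f p (μHE[d].restrict (D.comp d i ∩ bdry (D.comp (d + 1) j))) := fun h =>
    h.mono_measure (Measure.restrict_mono inter_subset_left le_rfl)
  have restr' : ∀ {d : ℕ} {i : Fin (D.N d)} {j : Fin (D.N (d + 1))} {f : Euc n → ℝ} {p : ℝ≥0∞},
      MemLp f p (surfBdry (d + 1) (D.comp (d + 1) j)) →
      MemLp f p (μHE[d].restrict (D.comp d i ∩ bdry (D.comp (d + 1) j))) := fun h =>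
    h.mono_measure (Measure.restrict_mono inter_subset_right le_rfl)
  have x1 := integral_sumJump_mul (F := fun d i x => D.normalFlux β d i x * D.jump β v d i x)
    (u := w) fun d i j => (restr' (hFv (d + 1) j)).integrable_mul (restr (hw2 d i))
  have x2 := integral_sumJump_mul (F := fun d i x => D.normalFlux β d i x * D.jump β w d i x)
    (u := v) fun d i j => (restr' (hFw (d + 1) j)).integrable_mul (restr (hv2 d i))
  have x3 := integral_sumJump_mul (F := D.normalFlux β) (u := fun d i x => v d i x * w d i x)
    fun d i j => memLp_one_iff_integrable.1 (MemLp.mul (p := ⊤) (q := 1)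
      (restr (memLp_one_iff_integrable.2 (hvw d i)))
      (restr' (memLp_top_normalFlux hβ (d + 1) j)))
  simp only [lower_mul] at x3
  have e1 : ∀ d i, ∫ x, D.Dβ β v d i x * w d i x ∂surf d (D.comp d i) =
      ∫ x, (dirDerivTrace d (D.comp d i) (β d i) (v d i)).1 x * w d i x ∂surf d (D.comp d i) -
      ∫ x, D.sumJump (fun d i x => D.normalFlux β d i x * D.jump β v d i x) d i x * w d i x
        ∂surf d (D.comp d i) := fun d i => by
    refine integral_eq_sub_of_forall ((hdv d i).2.1.integrable_mul (hw2 d i))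
      ((hJv d i).integrable_mul (hw2 d i)) fun x => ?_
    simp only [Dβ, sub_mul]
  have e2 : ∀ d i, ∫ x, v d i x * D.Dβ β w d i x ∂surf d (D.comp d i) =
      ∫ x, v d i x * (dirDerivTrace d (D.comp d i) (β d i) (w d i)).1 x ∂surf d (D.comp d i) -
      ∫ x, D.sumJump (fun d i x => D.normalFlux β d i x * D.jump β w d i x) d i x * v d i x
        ∂surf d (D.comp d i) := fun d i => by
    refine integral_eq_sub_of_forall ((hv2 d i).integrable_mul (hdw d i).2.1)
      ((hJw d i).integrable_mul (hv2 d i)) fun x => ?_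
    simp only [Dβ]
    ring
  have e3 : ∀ d i, ∫ x, D.Div β d i x * v d i x * w d i x ∂surf d (D.comp d i) =
      ∫ x, tangentialDiv (D.comp d i) (β d i) x * v d i x * w d i x ∂surf d (D.comp d i) -
      ∫ x, D.sumJump (D.normalFlux β) d i x * (v d i x * w d i x) ∂surf d (D.comp d i) :=
    fun d i => by
    refine integral_eq_sub_of_forall
      ((MemLp.mul (p := ⊤) (q := 2) (r := 2) (hv2 d i) (hT d i)).integrable_mul (hw2 d i))
      (memLp_one_iff_integrable.1 (MemLp.mul (p := ⊤) (q := 1)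
        (memLp_one_iff_integrable.2 (hvw d i)) (hJ d i))) fun x => ?_
    simp only [Div]
    ring
  have e4 : ∀ d i, ∫ x, D.normalFlux β d i x * D.jump β v d i x * D.jump β w d i x
        ∂surfBdry d (D.comp d i) =
      ∫ x, D.normalFlux β d i x * D.trace β v d i x * D.trace β w d i x
        ∂surfBdry d (D.comp d i) -
      ∫ x, D.normalFlux β d i x * D.jump β v d i x * D.lower w d i x ∂surfBdry d (D.comp d i) -
      ∫ x, D.normalFlux β d i x * D.jump β w d i x * D.lower v d i x ∂surfBdry d (D.comp d i) -
      ∫ x, D.normalFlux β d i x * (D.lower v d i x * D.lower w d i x)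
        ∂surfBdry d (D.comp d i) := fun d i => by
    have hlv := memLp_lower hv2 d i
    have hlw := memLp_lower hw2 d i
    have i1 := integrable_mul_jump_mul_jump hβ hv hw
      (aestronglyMeasurable_normalFlux hβ d i) fun _ => le_rfl
    have i2 : Integrable (fun x => D.normalFlux β d i x * D.jump β v d i x * D.lower w d i x)
      (surfBdry d (D.comp d i)) := (hFv d i).integrable_mul hlw
    have i3 : Integrable (fun x => D.normalFlux β d i x * D.jump β w d i x * D.lower v d i x)
      (surfBdry d (D.comp d i)) := (hFw d i).integrable_mul hlv
    have i4 : Integrable (fun x => D.normalFlux β d i x * (D.lower v d i x * D.lower w d i x))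
      (surfBdry d (D.comp d i)) :=
      memLp_one_iff_integrable.1 (MemLp.mul (p := ⊤) (q := 1)
        (memLp_one_iff_integrable.2 (hlv.integrable_mul hlw)) (memLp_top_normalFlux hβ d i))
    have hsum : ∫ x, D.normalFlux β d i x * D.trace β v d i x * D.trace β w d i x
        ∂surfBdry d (D.comp d i) = _ :=
      (integral_congr_ae (.of_forall fun x => by
        simp only [trace_eq, Pi.add_apply]; ring)).trans
        (integral_add' ((i1.add i2).add i3) i4)
    rw [hsum, integral_add' (i1.add i2) i3, integral_add' i1 i2]
    ring
  have e5 : ∀ d i, ∫ x, D.normalFlux β d i x * D.trace β v d i x * D.trace β w d i x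
      ∂surfBdry d (D.comp d i) = _ := fun d i =>
    ((D.hasCornerCharts d i).integral_by_parts_trace (hβ d i).1 (hβ d i).2 (hdv d i)
      (hdw d i)).symm
  -- The coupling terms of `D_β v`, `D_β w` and `Div β` cancel the three terms with lower values in
  -- `e4`.
  simp only [inner𝒪, bdryForm, e1, e2, e3, e4, e5, Finset.sum_sub_distrib, Finset.sum_add_distrib]
  rw [x1, x2, x3]
  ring

end FracturedDomain

/-! ### The stabilization form -/

/-- No regularity of `f` is needed, because of the default value zero. -/
theorem memLp_weakGradient (U : Set (Euc n)) (f : Euc n → ℝ) :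
    MemLp (weakGradient U f) 2 (volume.restrict U) := by
  rw [weakGradient]
  split_ifs with h
  · exact h.choose_spec.2.1
  · exact MemLp.zero

/-- The frontier lies in the frontiers of finitely many convex elements. The stabilization
integrates over the closed active mesh a gradient that is defined by its interior, so the difference
has to be null. -/
theorem Mesh.volume_frontier_active (M : Mesh n) (S : Set (Euc n)) :
    volume (frontier (M.active S)) = 0 := by
  have hcl : ∀ T : Fin M.card, IsClosed (⋃ (_ : T ∈ {T | (M.elem T ∩ S).Nonempty}), M.elem T) :=
    fun T => isClosed_iUnion_of_finite fun _ => (M.isCompact_elem T).isClosed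
  have hsub : frontier (M.active S) ⊆ ⋃ T, frontier (M.elem T) := by
    rw [Mesh.active, (isClosed_iUnion_of_finite hcl).frontier_eq]
    rintro x ⟨hx, hxi⟩
    obtain ⟨T, hT, hxT⟩ := mem_iUnion₂.1 hx
    refine mem_iUnion.2 ⟨T, ?_⟩
    rw [(M.isCompact_elem T).isClosed.frontier_eq]
    exact ⟨hxT, fun h => hxi (interior_mono (subset_iUnion₂_of_subset T hT Subset.rfl) h)⟩
  exact measure_mono_null hsub
    (measure_iUnion_null fun T => (M.convex_elem T).addHaar_frontier volume)

namespace FracturedDomain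

variable {D : FracturedDomain n} {β : D.Field (Euc n)} {α v w : D.Field ℝ}

namespace Discretization

variable (A : D.Discretization) {τ₁ τ₂ h : ℝ}

theorem memLp_norm_weakGradient_active (d : ℕ) (i : Fin (D.N d)) (v : Euc n → ℝ) :
    MemLp (fun x => ‖weakGradient (interior ((A.mesh h).active (D.comp d i))) v x‖) 2
      (volume.restrict ((A.mesh h).active (D.comp d i))) := by
  rw [← Measure.restrict_congr_set
    (interior_ae_eq_of_null_frontier ((A.mesh h).volume_frontier_active (D.comp d i)))]
  exact (memLp_weakGradient _ v).norm

theorem stab_self_nonneg (hτ₂ : 0 ≤ τ₂) (hh : 0 < h) (d : ℕ) (i : Fin (D.N d)) (v : Euc n → ℝ) :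
    0 ≤ A.stab τ₂ h d i v v :=
  mul_nonneg (by positivity) (integral_nonneg fun _ => real_inner_self_nonneg)

theorem abs_stab_le (hτ₂ : 0 ≤ τ₂) (hh : 0 < h) (d : ℕ) (i : Fin (D.N d)) (v w : Euc n → ℝ) :
    |A.stab τ₂ h d i v w| ≤ √(A.stab τ₂ h d i v v) * √(A.stab τ₂ h d i w w) := by
  have hc : 0 ≤ τ₂ * h ^ (3 - ((n : ℤ) - (d : ℤ))) := by positivity
  have key := abs_integral_le_sqrt_mul_sqrt (A.memLp_norm_weakGradient_active (h := h) d i v)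
    (A.memLp_norm_weakGradient_active (h := h) d i w)
    (F := fun x => ⟪weakGradient (interior ((A.mesh h).active (D.comp d i))) v x,
      weakGradient (interior ((A.mesh h).active (D.comp d i))) w x⟫)
    (.of_forall fun x => by simpa using abs_real_inner_le_norm _ _)
  simp only [← real_inner_self_eq_norm_sq] at key
  rw [stab, stab, stab, Real.sqrt_mul hc, Real.sqrt_mul hc, abs_mul, abs_of_nonneg hc,
    mul_mul_mul_comm, Real.mul_self_sqrt hc]
  exact mul_le_mul_of_nonneg_left key hc

end Discretization

/-! ### Continuity and coercivity -/

theorem abs_double_sum_le_sqrt_mul_sqrt {F f g : ∀ d, Fin (D.N d) → ℝ}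
    (hf : ∀ d i, 0 ≤ f d i) (hg : ∀ d i, 0 ≤ g d i)
    (hle : ∀ d i, |F d i| ≤ √(f d i) * √(g d i)) :
    |∑ d ∈ Finset.range (n + 1), ∑ i, F d i| ≤
      √(∑ d ∈ Finset.range (n + 1), ∑ i, f d i) * √(∑ d ∈ Finset.range (n + 1), ∑ i, g d i) := by
  simp only [Finset.sum_sigma']
  calc _ ≤ ∑ p ∈ (Finset.range (n + 1)).sigma fun d => (Finset.univ : Finset (Fin (D.N d))),
        √(f p.1 p.2) * √(g p.1 p.2) :=
      (Finset.abs_sum_le_sum_abs _ _).trans (Finset.sum_le_sum fun p _ => hle p.1 p.2)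
    _ ≤ _ := Real.sum_sqrt_mul_sqrt_le _ (fun p => hf p.1 p.2) (fun p => hg p.1 p.2)

theorem double_sum_nonneg {f : ∀ d, Fin (D.N d) → ℝ} (hf : ∀ d i, 0 ≤ f d i) :
    0 ≤ ∑ d ∈ Finset.range (n + 1), ∑ i, f d i :=
  Finset.sum_nonneg fun _ _ => Finset.sum_nonneg fun _ _ => hf _ _

theorem inner𝒪_self_nonneg (v : D.Field ℝ) : 0 ≤ D.inner𝒪 v v :=
  double_sum_nonneg fun _ _ => integral_nonneg fun _ => mul_self_nonneg _

theorem abs_inner𝒪_le (hv : ∀ d i, MemLp (v d i) 2 (surf d (D.comp d i)))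
    (hw : ∀ d i, MemLp (w d i) 2 (surf d (D.comp d i))) :
    |D.inner𝒪 v w| ≤ √(D.inner𝒪 v v) * √(D.inner𝒪 w w) := by
  refine abs_double_sum_le_sqrt_mul_sqrt (fun _ _ => integral_nonneg fun _ => mul_self_nonneg _)
    (fun _ _ => integral_nonneg fun _ => mul_self_nonneg _) fun d i => ?_
  simpa only [pow_two] using abs_integral_le_sqrt_mul_sqrt (hv d i) (hw d i)
    (.of_forall fun x => (abs_mul _ _).le)

theorem abs_inner𝒪_mul_le {κ : D.Field ℝ} {M : ℝ} (hM : 0 ≤ M)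
    (hκ : ∀ d i, ∀ᵐ x ∂surf d (D.comp d i), |κ d i x| ≤ M)
    (hv : ∀ d i, MemLp (v d i) 2 (surf d (D.comp d i)))
    (hw : ∀ d i, MemLp (w d i) 2 (surf d (D.comp d i))) :
    |D.inner𝒪 (fun d i x => κ d i x * v d i x) w| ≤ M * (√(D.inner𝒪 v v) * √(D.inner𝒪 w w)) := by
  have key : |D.inner𝒪 (fun d i x => κ d i x * v d i x) w| ≤
      √(M ^ 2 * D.inner𝒪 v v) * √(D.inner𝒪 w w) := by
    have hMv : M ^ 2 * D.inner𝒪 v v = ∑ d ∈ Finset.range (n + 1), ∑ i,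
        ∫ x, (M * v d i x) ^ 2 ∂surf d (D.comp d i) := by
      simp only [inner𝒪, Finset.mul_sum, ← integral_const_mul]
      simp only [mul_pow, pow_two (v _ _ _)]
    rw [hMv]
    refine abs_double_sum_le_sqrt_mul_sqrt (fun _ _ => integral_nonneg fun _ => sq_nonneg _)
      (fun _ _ => integral_nonneg fun _ => mul_self_nonneg _) fun d i => ?_
    simp only [← pow_two (w d i _)]
    refine abs_integral_le_sqrt_mul_sqrt ((hv d i).const_mul M) (hw d i) ?_
    filter_upwards [hκ d i] with x hx
    rw [abs_mul, abs_mul, abs_mul]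
    exact mul_le_mul_of_nonneg_right
      (mul_le_mul_of_nonneg_right (hx.trans (le_abs_self M)) (abs_nonneg _)) (abs_nonneg _)
  rwa [Real.sqrt_mul (sq_nonneg M), Real.sqrt_sq hM, mul_assoc] at key

theorem bdryForm_self_nonneg {f : D.Field ℝ} (hf : ∀ d i x, 0 ≤ f d i x) :
    0 ≤ D.bdryForm β f v v :=
  double_sum_nonneg fun d i => integral_nonneg fun x => by
    rw [mul_assoc]; exact mul_nonneg (hf d i x) (mul_self_nonneg _)

theorem abs_bdryForm_le (hβ : D.IsSmoothTangential β) (hv : v ∈ D.Vβ β) (hw : w ∈ D.Vβ β)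
    {f : D.Field ℝ} (hle : ∀ d i x, |f d i x| ≤ |D.normalFlux β d i x|) :
    |D.bdryForm β f v w| ≤ √(D.bdryForm β (fun d i x => |D.normalFlux β d i x|) v v) *
      √(D.bdryForm β (fun d i x => |D.normalFlux β d i x|) w w) := by
  have hsq : ∀ (u : D.Field ℝ) d i x, |D.normalFlux β d i x| * D.jump β u d i x *
      D.jump β u d i x = (√|D.normalFlux β d i x| * D.jump β u d i x) ^ 2 := fun u d i x => by
    rw [mul_pow, Real.sq_sqrt (abs_nonneg _), pow_two, mul_assoc]
  simp only [bdryForm, hsq]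
  refine abs_double_sum_le_sqrt_mul_sqrt (fun _ _ => integral_nonneg fun _ => sq_nonneg _)
    (fun _ _ => integral_nonneg fun _ => sq_nonneg _) fun d i => ?_
  refine abs_integral_le_sqrt_mul_sqrt (memLp_sqrt_mul_jump hβ hv d i)
    (memLp_sqrt_mul_jump hβ hw d i) (.of_forall fun x => ?_)
  rw [abs_mul, abs_mul, abs_mul, abs_mul, abs_of_nonneg (Real.sqrt_nonneg _), mul_mul_mul_comm,
    Real.mul_self_sqrt (abs_nonneg _), mul_assoc]
  exact mul_le_mul_of_nonneg_right (hle d i x) (by positivity)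

theorem bdryForm_add (hβ : D.IsSmoothTangential β) (hv : v ∈ D.Vβ β) (hw : w ∈ D.Vβ β)
    {f g : D.Field ℝ} (hf : ∀ d i, AEStronglyMeasurable (f d i) (surfBdry d (D.comp d i)))
    (hg : ∀ d i, AEStronglyMeasurable (g d i) (surfBdry d (D.comp d i)))
    (hfle : ∀ d i x, |f d i x| ≤ |D.normalFlux β d i x|)
    (hgle : ∀ d i x, |g d i x| ≤ |D.normalFlux β d i x|) :
    D.bdryForm β (fun d i x => f d i x + g d i x) v w =
      D.bdryForm β f v w + D.bdryForm β g v w := by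
  simp only [bdryForm, ← Finset.sum_add_distrib]
  refine Finset.sum_congr rfl fun d _ => Finset.sum_congr rfl fun i _ => ?_
  rw [← integral_add (integrable_mul_jump_mul_jump hβ hv hw (hf d i) (hfle d i))
    (integrable_mul_jump_mul_jump hβ hv hw (hg d i) (hgle d i))]
  simp only [add_mul]

/-- The two zero order terms add up to `2α + 2 Div β`; integration by parts consumes one `Div β`. -/
theorem inner_L_add_inner_L (hβ : D.IsSmoothTangential β)
    (hα : ∀ d i, MemLp (α d i) ⊤ (surf d (D.comp d i))) (hv : v ∈ D.Vβ β) (hw : w ∈ D.Vβ β) :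
    D.inner𝒪 (D.L β α v) w + D.inner𝒪 v (D.L β α w) =
      D.inner𝒪 (fun d i x => (2 * α d i x + D.Div β d i x) * v d i x) w +
        D.bdryForm β (D.normalFlux β) v w := by
  rw [← inner_Dβ_add_inner_Dβ hβ hv hw]
  simp only [inner𝒪, ← Finset.sum_add_distrib]
  refine Finset.sum_congr rfl fun d _ => Finset.sum_congr rfl fun i _ => ?_
  have hv2 := memLp_of_mem_Vβ hv d i
  have hw2 := memLp_of_mem_Vβ hw d i
  have hDv := memLp_top_Div hβ d i
  have mulL2 : ∀ {p u : Euc n → ℝ}, MemLp p ⊤ (surf d (D.comp d i)) →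
      MemLp u 2 (surf d (D.comp d i)) → MemLp (fun x => p x * u x) 2 (surf d (D.comp d i)) :=
    fun hp hu => MemLp.mul (p := ⊤) (q := 2) hu hp
  have i1 := (memLp_L hβ hα hv d i).integrable_mul hw2
  have i2 := hv2.integrable_mul (memLp_L hβ hα hw d i)
  have i3 := (mulL2 (((hα d i).const_mul 2).add hDv) hv2).integrable_mul hw2
  have i4 := (memLp_Dβ hβ hv d i).integrable_mul hw2
  have i5 := hv2.integrable_mul (memLp_Dβ hβ hw d i)
  have i6 := (mulL2 hDv hv2).integrable_mul hw2
  refine (integral_add' i1 i2).symm.trans (Eq.trans (integral_congr_ae (.of_forall fun x => ?_))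
    ((integral_add' i3 ((i4.add i5).add i6)).trans (congrArg (_ + ·)
      ((integral_add' (i4.add i5) i6).trans (congrArg (· + _) (integral_add' i4 i5))))))
  simp only [L, Pi.add_apply, Pi.mul_apply]
  ring

/-- The sum of the essential bounds over the finitely many components serves for all of them. -/
theorem exists_bound_two_mul_add_Div (hβ : D.IsSmoothTangential β)
    (hα : ∀ d i, MemLp (α d i) ⊤ (surf d (D.comp d i))) :
    ∃ M, 0 ≤ M ∧ ∀ d i, ∀ᵐ x ∂surf d (D.comp d i), |2 * α d i x + D.Div β d i x| ≤ M := by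
  have h1 : ∀ d i, ∃ M : ℝ, 0 ≤ M ∧
      ∀ᵐ x ∂surf d (D.comp d i), |2 * α d i x + D.Div β d i x| ≤ M := fun d i => by
    have hm := ((hα d i).const_mul 2).add (memLp_top_Div hβ d i)
    have hlt := hm.2
    rw [eLpNorm_exponent_top] at hlt
    refine ⟨(eLpNormEssSup ((fun x => 2 * α d i x) + D.Div β d i)
      (surf d (D.comp d i))).toReal, ENNReal.toReal_nonneg, ?_⟩
    filter_upwards [enorm_ae_le_eLpNormEssSup ((fun x => 2 * α d i x) + D.Div β d i)
      (surf d (D.comp d i))] with x hx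
    simpa using ENNReal.toReal_mono hlt.ne hx
  choose M hM0 hM using h1
  refine ⟨∑ d ∈ Finset.range (n + 1), ∑ i, M d i, double_sum_nonneg hM0, fun d i => ?_⟩
  filter_upwards [hM d i] with x hx
  refine hx.trans ((Finset.single_le_sum (f := M d) (fun j _ => hM0 d j)
    (Finset.mem_univ i)).trans ?_)
  exact Finset.single_le_sum (f := fun d => ∑ i, M d i)
    (fun d _ => Finset.sum_nonneg fun j _ => hM0 d j)
    (Finset.mem_range.2 (Nat.lt_succ_of_le (D.le_of_comp i)))

namespace Discretization

variable (A : D.Discretization) {τ₁ τ₂ h : ℝ}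

theorem aestronglyMeasurable_inflow (hβ : D.IsSmoothTangential β) (d : ℕ) (i : Fin (D.N d)) :
    AEStronglyMeasurable (inflow β d i) (surfBdry d (D.comp d i)) :=
  (continuous_abs.comp (continuous_id.min continuous_const)).comp_aestronglyMeasurable
    (aestronglyMeasurable_normalFlux hβ d i)

theorem abs_inflow_le (d : ℕ) (i : Fin (D.N d)) (x : Euc n) :
    |inflow β d i x| ≤ |D.normalFlux β d i x| := by
  rw [inflow, abs_abs]
  rcases le_total (D.normalFlux β d i x) 0 with h | h
  · rw [min_eq_left h]
  · rw [min_eq_right h]; simp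

/-- The sum is the positive part of `ν·β`, the weight that remains in the proof of continuity. -/
theorem abs_normalFlux_add_inflow_le (d : ℕ) (i : Fin (D.N d)) (x : Euc n) :
    |D.normalFlux β d i x + inflow β d i x| ≤ |D.normalFlux β d i x| := by
  rw [inflow]
  rcases le_total (D.normalFlux β d i x) 0 with h | h
  · rw [min_eq_left h, abs_of_nonpos h]; simpa using h
  · rw [min_eq_right h]; simp

theorem normalFlux_add_inflow_add_inflow (d : ℕ) (i : Fin (D.N d)) (x : Euc n) :
    D.normalFlux β d i x + inflow β d i x + inflow β d i x = |D.normalFlux β d i x| := by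
  rw [inflow]
  rcases le_total (D.normalFlux β d i x) 0 with h | h
  · rw [min_eq_left h, abs_of_nonpos h]; ring
  · rw [min_eq_right h, abs_of_nonneg h]; simp

theorem a_eq (hβ : D.IsSmoothTangential β) (hv : v ∈ D.Vβ β) (hw : w ∈ D.Vβ β) :
    A.a β α τ₁ τ₂ h v w = D.inner𝒪 (D.L β α v) w + τ₁ * h * D.inner𝒪 (D.L β α v) (D.L β α w) +
      ∑ d ∈ Finset.range (n + 1), ∑ i, A.stab τ₂ h d i (v d i) (w d i) +
      D.bdryForm β (inflow β) v w := by
  rw [a, add_assoc, innerI_add_innerB hβ hv hw (aestronglyMeasurable_inflow hβ) abs_inflow_le]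
  simp only [aComp, inner𝒪, Finset.sum_add_distrib, Finset.mul_sum, mul_assoc, integral_const_mul]

theorem energySq_eq (hβ : D.IsSmoothTangential β) (hv : v ∈ D.Vβ β) :
    A.energySq β α τ₂ h v = D.inner𝒪 v v + h * D.inner𝒪 (D.L β α v) (D.L β α v) +
      ∑ d ∈ Finset.range (n + 1), ∑ i, A.stab τ₂ h d i (v d i) (v d i) +
      D.bdryForm β (fun d i x => |D.normalFlux β d i x|) v v := by
  rw [energySq, add_assoc _ (D.innerI _ _), innerI_add_innerB hβ hv hv
    (f := fun d i x => |D.normalFlux β d i x|)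
    (fun d i => (aestronglyMeasurable_normalFlux hβ d i).norm) fun d i x => (abs_abs _).le]

theorem energySq_parts_nonneg (hτ₂ : 0 ≤ τ₂) (hh : 0 < h) (v : D.Field ℝ) :
    0 ≤ D.inner𝒪 v v ∧ 0 ≤ h * D.inner𝒪 (D.L β α v) (D.L β α v) ∧
      0 ≤ ∑ d ∈ Finset.range (n + 1), ∑ i, A.stab τ₂ h d i (v d i) (v d i) ∧
      0 ≤ D.bdryForm β (fun d i x => |D.normalFlux β d i x|) v v :=
  ⟨inner𝒪_self_nonneg v, mul_nonneg hh.le (inner𝒪_self_nonneg _),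
    double_sum_nonneg fun d i => A.stab_self_nonneg hτ₂ hh d i _,
    bdryForm_self_nonneg fun _ _ _ => abs_nonneg _⟩

/-- Continuity of `a_h`. -/
theorem abs_a_le (hβ : D.IsSmoothTangential β)
    (hα : ∀ d i, MemLp (α d i) ⊤ (surf d (D.comp d i))) (hτ₁ : 0 < τ₁) (hτ₂ : 0 ≤ τ₂)
    (hh : 0 < h) (hv : v ∈ D.Vβ β) (hw : w ∈ D.Vβ β) {M : ℝ} (hM : 0 ≤ M)
    (hκ : ∀ d i, ∀ᵐ x ∂surf d (D.comp d i), |2 * α d i x + D.Div β d i x| ≤ M) :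
    |A.a β α τ₁ τ₂ h v w| ≤
      (M + τ₁ + 3) * A.energyNormStar β α τ₂ h v * A.energyNorm β α τ₂ h w := by
  have hv2 := memLp_of_mem_Vβ hv
  have hw2 := memLp_of_mem_Vβ hw
  have hLv := memLp_L hβ hα hv
  have hLw := memLp_L hβ hα hw
  obtain ⟨x0, y0, z0, b0⟩ := A.energySq_parts_nonneg (β := β) (α := α) hτ₂ hh v
  obtain ⟨x0', y0', z0', b0'⟩ := A.energySq_parts_nonneg (β := β) (α := α) hτ₂ hh w
  have hs0 : 0 ≤ h⁻¹ * D.inner𝒪 v v := mul_nonneg (inv_nonneg.2 hh.le) x0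
  set P := A.energyNormStar β α τ₂ h v with hP
  set Q := A.energyNorm β α τ₂ h w with hQ
  rw [energyNormStar, A.energySq_eq hβ hv] at hP
  rw [energyNorm, A.energySq_eq hβ hw] at hQ
  have hPQ : ∀ {a b : ℝ}, √a ≤ P → √b ≤ Q → √a * √b ≤ P * Q := fun ha hb =>
    mul_le_mul ha hb (Real.sqrt_nonneg _) ((Real.sqrt_nonneg _).trans ha)
  -- The only place where the star norm is needed: `h^{-1/2}` goes to `v` and `h^{1/2}` to `Lw`.
  have t1 : |D.inner𝒪 v (D.L β α w)| ≤ P * Q := by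
    refine (abs_inner𝒪_le hv2 hLw).trans (le_trans (le_of_eq ?_)
      (hPQ (a := h⁻¹ * D.inner𝒪 v v) (b := h * D.inner𝒪 (D.L β α w) (D.L β α w)) ?_ ?_))
    · rw [← Real.sqrt_mul hs0, ← Real.sqrt_mul x0]
      congr 1
      field_simp
    · rw [hP]; exact Real.sqrt_le_sqrt (by linarith)
    · rw [hQ]; exact Real.sqrt_le_sqrt (by linarith)
  have t2 : |D.inner𝒪 (fun d i x => (2 * α d i x + D.Div β d i x) * v d i x) w| ≤ M * (P * Q) := by
    refine (abs_inner𝒪_mul_le hM hκ hv2 hw2).trans (mul_le_mul_of_nonneg_left (hPQ ?_ ?_) hM)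
    · rw [hP]; exact Real.sqrt_le_sqrt (by linarith)
    · rw [hQ]; exact Real.sqrt_le_sqrt (by linarith)
  have t3 : |h * D.inner𝒪 (D.L β α v) (D.L β α w)| ≤ P * Q := by
    rw [abs_mul, abs_of_pos hh]
    refine (mul_le_mul_of_nonneg_left (abs_inner𝒪_le hLv hLw) hh.le).trans
      (le_trans (le_of_eq ?_) (hPQ (a := h * D.inner𝒪 (D.L β α v) (D.L β α v))
        (b := h * D.inner𝒪 (D.L β α w) (D.L β α w)) ?_ ?_))
    · rw [Real.sqrt_mul hh.le, Real.sqrt_mul hh.le, mul_mul_mul_comm, Real.mul_self_sqrt hh.le]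
    · rw [hP]; exact Real.sqrt_le_sqrt (by linarith)
    · rw [hQ]; exact Real.sqrt_le_sqrt (by linarith)
  have t4 : |∑ d ∈ Finset.range (n + 1), ∑ i, A.stab τ₂ h d i (v d i) (w d i)| ≤ P * Q := by
    refine (abs_double_sum_le_sqrt_mul_sqrt (fun d i => A.stab_self_nonneg hτ₂ hh d i (v d i))
      (fun d i => A.stab_self_nonneg hτ₂ hh d i (w d i))
      fun d i => A.abs_stab_le hτ₂ hh d i _ _).trans (hPQ ?_ ?_)
    · rw [hP]; exact Real.sqrt_le_sqrt (by linarith)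
    · rw [hQ]; exact Real.sqrt_le_sqrt (by linarith)
  have t5 : |D.bdryForm β (fun d i x => D.normalFlux β d i x + inflow β d i x) v w| ≤ P * Q := by
    refine (abs_bdryForm_le hβ hv hw abs_normalFlux_add_inflow_le).trans (hPQ ?_ ?_)
    · rw [hP]; exact Real.sqrt_le_sqrt (by linarith)
    · rw [hQ]; exact Real.sqrt_le_sqrt (by linarith)
  rw [bdryForm_add hβ hv hw (aestronglyMeasurable_normalFlux hβ) (aestronglyMeasurable_inflow hβ)
    (fun _ _ _ => le_rfl) abs_inflow_le] at t5
  have hid := inner_L_add_inner_L hβ hα hv hw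
  rw [A.a_eq hβ hv hw]
  rw [abs_le] at t1 t2 t3 t4 t5 ⊢
  have t3' := mul_le_mul_of_nonneg_left t3.1 hτ₁.le
  have t3'' := mul_le_mul_of_nonneg_left t3.2 hτ₁.le
  -- By `hid`, the form is `-t1 + t2 + τ₁ t3 + t4 + t5` in terms of the quantities estimated above,
  -- which gives the constant `1 + M + τ₁ + 1 + 1`.
  constructor <;> nlinarith

/-- Coercivity of `a_h`. -/
theorem energySq_le (hβ : D.IsSmoothTangential β)
    (hα : ∀ d i, MemLp (α d i) ⊤ (surf d (D.comp d i))) (hτ₁ : 0 < τ₁) (hτ₂ : 0 ≤ τ₂)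
    (hh : 0 < h) (hv : v ∈ D.Vβ β) {c₀ : ℝ} (hc₀ : 0 < c₀)
    (hκ : ∀ d i, ∀ᵐ x ∂surf d (D.comp d i), c₀ ≤ 2 * α d i x + D.Div β d i x) :
    A.energySq β α τ₂ h v ≤ (2 / c₀ + 1 / τ₁ + 2) * A.a β α τ₁ τ₂ h v v := by
  obtain ⟨x0, y0, z0, b0⟩ := A.energySq_parts_nonneg (β := β) (α := α) hτ₂ hh v
  have hid := inner_L_add_inner_L hβ hα hv hv
  have hsymm : D.inner𝒪 v (D.L β α v) = D.inner𝒪 (D.L β α v) v := by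
    simp only [inner𝒪, mul_comm]
  have hX : c₀ * D.inner𝒪 v v ≤
      D.inner𝒪 (fun d i x => (2 * α d i x + D.Div β d i x) * v d i x) v := by
    simp only [inner𝒪, Finset.mul_sum, ← integral_const_mul]
    refine Finset.sum_le_sum fun d _ => Finset.sum_le_sum fun i _ => integral_mono_ae ?_ ?_ ?_
    · exact ((memLp_of_mem_Vβ hv d i).integrable_mul (memLp_of_mem_Vβ hv d i)).const_mul c₀
    · exact (MemLp.mul (p := ⊤) (q := 2) (r := 2) (memLp_of_mem_Vβ hv d i)
        (((hα d i).const_mul 2).add (memLp_top_Div hβ d i))).integrable_mul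
        (memLp_of_mem_Vβ hv d i)
    · filter_upwards [hκ d i] with x hx
      rw [mul_assoc]
      exact mul_le_mul_of_nonneg_right hx (mul_self_nonneg _)
  -- `|x| = x + 2|x|_-`, so half of the flux term together with the inflow term is half of the
  -- boundary norm.
  have hB : D.bdryForm β (fun d i x => |D.normalFlux β d i x|) v v =
      D.bdryForm β (D.normalFlux β) v v + D.bdryForm β (inflow β) v v +
        D.bdryForm β (inflow β) v v := by
    have hF := aestronglyMeasurable_normalFlux hβ
    have hI := aestronglyMeasurable_inflow hβ
    rw [← bdryForm_add hβ hv hv hF hI (fun _ _ _ => le_rfl) abs_inflow_le,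
      ← bdryForm_add (f := fun d i x => D.normalFlux β d i x + inflow β d i x) hβ hv hv
        (fun d i => (hF d i).add (hI d i)) hI abs_normalFlux_add_inflow_le
        abs_inflow_le]
    simp only [normalFlux_add_inflow_add_inflow]
  rw [A.a_eq hβ hv hv, A.energySq_eq hβ hv]
  set X := D.inner𝒪 v v
  set Y := D.inner𝒪 (D.L β α v) (D.L β α v)
  set Z := ∑ d ∈ Finset.range (n + 1), ∑ i, A.stab τ₂ h d i (v d i) (v d i)
  set B := D.bdryForm β (fun d i x => |D.normalFlux β d i x|) v v
  set K := D.inner𝒪 (fun d i x => (2 * α d i x + D.Div β d i x) * v d i x) v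
  have ha : D.inner𝒪 (D.L β α v) v + τ₁ * h * Y + Z + D.bdryForm β (inflow β) v v =
      K / 2 + τ₁ * (h * Y) + Z + B / 2 := by
    linarith
  have hτY : 0 ≤ τ₁ * (h * Y) := mul_nonneg hτ₁.le y0
  have hK : 0 ≤ K := (mul_nonneg hc₀.le x0).trans hX
  rw [ha]
  -- Each part of the energy is compared with the whole form: `X` costs `2/c₀`, `hY` costs `1/τ₁`,
  -- and `Z + B` costs 2 because of the factor `1/2` at `B`.
  have h1 : X ≤ 2 / c₀ * (K / 2 + τ₁ * (h * Y) + Z + B / 2) := by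
    rw [div_mul_eq_mul_div, le_div_iff₀ hc₀]
    linarith
  have h2 : h * Y ≤ 1 / τ₁ * (K / 2 + τ₁ * (h * Y) + Z + B / 2) := by
    rw [div_mul_eq_mul_div, le_div_iff₀ hτ₁]
    linarith
  linarith

end Discretization

end FracturedDomain

end

theorem mainTheorem2 (n : ℕ) (D : FracturedDomain n)
    (β : D.Field (Euc n)) (hβ : D.IsSmoothTangential β)
    (α : D.Field ℝ) (hα : ∀ d i, MemLp (α d i) ⊤ (surf d (D.comp d i)))
    (τ₁ τ₂ : ℝ) (hτ₁ : 0 < τ₁) (hτ₂ : 0 ≤ τ₂) :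
    (∃ C > 0, ∀ A : D.Discretization, ∀ h ∈ Set.Ioc 0 A.h₀, ∀ v ∈ A.W β h, ∀ w ∈ A.W β h,
      |A.a β α τ₁ τ₂ h v w| ≤
        C * A.energyNormStar β α τ₂ h v * A.energyNorm β α τ₂ h w) ∧
    (∀ c₀ > 0, (∀ d i, ∀ᵐ x ∂surf d (D.comp d i), c₀ ≤ 2 * α d i x + D.Div β d i x) →
      ∃ C > 0, ∀ A : D.Discretization, ∀ h ∈ Set.Ioc 0 A.h₀, ∀ v ∈ A.W β h,
        A.energyNorm β α τ₂ h v ^ 2 ≤ C * A.a β α τ₁ τ₂ h v v) := by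
  refine ⟨?_, fun c₀ hc₀ hκ => ?_⟩
  · obtain ⟨M, hM, hκ⟩ := FracturedDomain.exists_bound_two_mul_add_Div hβ hα
    -- The constant depends only on the essential bound of `2α + Div β` and on `τ₁`; it is fixed
    -- before the discretization and `h` are chosen.
    refine ⟨M + τ₁ + 3, by positivity, fun A h hh v hv w hw => ?_⟩
    exact A.abs_a_le hβ hα hτ₁ hτ₂ hh.1 (A.W_subset_Vβ hβ hh hv) (A.W_subset_Vβ hβ hh hw) hM hκ
  · refine ⟨2 / c₀ + 1 / τ₁ + 2, by positivity, fun A h hh v hv => ?_⟩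
    have hv' := A.W_subset_Vβ hβ hh hv
    rw [FracturedDomain.Discretization.energyNorm, Real.sq_sqrt]
    · exact A.energySq_le hβ hα hτ₁ hτ₂ hh.1 hv' hc₀ hκ
    · rw [A.energySq_eq hβ hv']
      obtain ⟨x0, y0, z0, b0⟩ := A.energySq_parts_nonneg (β := β) (α := α) hτ₂ hh.1 v
      positivity
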